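/- Let $0\le\gamma\le 1$ and let $B=B(r,\theta)$ be a measurable collision cross-section satisfying, for some constant $C_B$, Grad's angular cutoff condition $0\le B(r,\theta)\le C_B\,r^\gamma\cos\theta\sin\theta$ for all $r>0$ and $\theta\in[0,\pi/2]$. For $v,v_*\in\mathbb{R}^3$, $v\ne v_*$, let $e_1=\frac{v_*-v}{|v_*-v|}$, let $(e_1,e_2,e_3)$ be an orthonormal basis of $\mathbb{R}^3$ (chosen measurably), $\alpha=\cos\theta\,e_1+\sin\theta\cos\varepsilon\,e_2+\sin\theta\sin\varepsilon\,e_3$, $v'=v+((v_*-v)\cdot\alpha)\alpha$, $v'_*=v_*-((v_*-v)\cdot\alpha)\alpha$, and $$Q(F,G)(v)=\int_{\mathbb{R}^3}\int_0^{2\pi}\int_0^{\pi/2}\bigl(F(v')G(v'_*)-F(v)G(v_*)\bigr)B(|v-v_*|,\theta)\,d\theta\,d\varepsilon\,dv_* .$$ Let $M(v)=\pi^{-3/2}e^{-|v|^2}$, let $L(f)=M^{-1/2}\bigl(Q(M,M^{1/2}f)+Q(M^{1/2}f,M)\bigr)$ be the linearized collision operator, let $\nu(v)=\int_{\mathbb{R}^3}\int_0^{2\pi}\int_0^{\pi/2}M(v_*)B(|v-v_*|,\theta)\,d\theta\,d\varepsilon\,dv_*$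 be the collision frequency, and let $K$ be defined by the decomposition $L(f)=-\nu f+K(f)$; $K$ acts on functions of $(x,v)$ with $x$ as a parameter. Let $\Omega\subset\mathbb{R}^3$ be a bounded convex open set. For $x\in\Omega$, $v\in\mathbb{R}^3$ put $\tau_-(x,v)=\inf\{t>0:\ x-tv\notin\Omega\}$ (with $\inf\emptyset=\infty$) and $$(S_\Omega h)(x,v)=\int_0^{\tau_-(x,v)}e^{-\nu(v)s}\,h(x-sv,v)\,ds .$$ For $s\in(0,1)$ let $L^2_v(\mathbb{R}^3;H^s_x(\Omega))$ be the space of $f\in L^2(\Omega\times\mathbb{R}^3)$ with finite norm $$\|f\|_{L^2_v(\mathbb{R}^3;H^s_x(\Omega))}=\left(\|f\|_{L^2(\Omega\times\mathbb{R}^3)}^2+\int_{\mathbb{R}^3}\int_\Omega\int_\Omega\frac{|f(x,v)-f(y,v)|^2}{|x-y|^{3+2s}}\,dx\,dy\,dv\right)^{1/2}.$$ Then $KS_\Omega K$ is a bounded linear operator from $L^2(\Omega\times\mathbb{R}^3)$ to $L^2_v(\mathbb{R}^3;H^{1/2}_x(\Omega))$. That is: for every real-valued $f\in L^2(\Omega\times\mathbb{R}^3)$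 all the integrals defining $Kf$, $S_\Omega Kf$ and $KS_\Omega Kf$ converge absolutely at almost every $(x,v)\in\Omega\times\mathbb{R}^3$; they define a linear operator on almost-everywhere equivalence classes; and there is a constant $C$, independent of $f$, such that $$\|KS_\Omega Kf\|_{L^2_v(\mathbb{R}^3;H^{1/2}_x(\Omega))}\le C\,\|f\|_{L^2(\Omega\times\mathbb{R}^3)}\qquad\text{for all } f\in L^2(\Omega\times\mathbb{R}^3).$$ -/

import Mathlib

open MeasureTheory
open scoped ENNReal NNReal

noncomputable section

namespace KineticAveraging

/-- Physical space and velocity space `ℝ³`, with the Euclidean norm. -/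
abbrev E3 : Type := EuclideanSpace ℝ (Fin 3)

/-! ### The collision operator -/

/-- A unit vector orthogonal to the unit vector `u`, chosen measurably in `u`. -/
def frameTwo (u : E3) : E3 :=
  if u 0 = 0 ∧ u 1 = 0 then !₂[1, 0, 0]
  else (Real.sqrt (u 0 ^ 2 + u 1 ^ 2))⁻¹ • !₂[-(u 1), u 0, 0]

/-- The cross product of `u` and `frameTwo u`. -/
def frameThree (u : E3) : E3 :=
  !₂[u 1 * frameTwo u 2 - u 2 * frameTwo u 1,
     u 2 * frameTwo u 0 - u 0 * frameTwo u 2,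
     u 0 * frameTwo u 1 - u 1 * frameTwo u 0]

/-- `u`, `frameTwo u`, `frameThree u` is an orthonormal basis of `ℝ³` for each unit vector `u`. -/
theorem orthonormal_frame (u : E3) (hu : ‖u‖ = 1) :
    Orthonormal ℝ ![u, frameTwo u, frameThree u] := by
  have h1 : u 0 ^ 2 + u 1 ^ 2 + u 2 ^ 2 = 1 := by
    have := EuclideanSpace.norm_sq_eq u
    rw [hu] at this
    simp [Fin.sum_univ_three] at this
    linarith
  have key : ∃ a b : ℝ, frameTwo u = !₂[a, b, 0] ∧ a ^ 2 + b ^ 2 = 1 ∧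
      u 0 * a + u 1 * b = 0 := by
    by_cases h : u 0 = 0 ∧ u 1 = 0
    · refine ⟨1, 0, ?_, by norm_num, by simp [h.1]⟩
      simp [frameTwo, h]
    · have hpos : 0 < u 0 ^ 2 + u 1 ^ 2 := by
        by_contra hn
        exact h ⟨by nlinarith [sq_nonneg (u 0), sq_nonneg (u 1)],
          by nlinarith [sq_nonneg (u 0), sq_nonneg (u 1)]⟩
      have hs := Real.sq_sqrt hpos.le
      have hs0 : Real.sqrt (u 0 ^ 2 + u 1 ^ 2) ≠ 0 := (Real.sqrt_pos.2 hpos).ne'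
      refine ⟨(Real.sqrt (u 0 ^ 2 + u 1 ^ 2))⁻¹ * (-(u 1)),
        (Real.sqrt (u 0 ^ 2 + u 1 ^ 2))⁻¹ * u 0, ?_, ?_, by ring⟩
      · rw [frameTwo, if_neg h]
        ext i
        fin_cases i <;> simp
      · field_simp
        rw [hs]
        ring
  obtain ⟨a, b, hab, hn, ho⟩ := key
  have h3 : frameThree u = !₂[-(u 2 * b), u 2 * a, u 0 * b - u 1 * a] := by
    rw [frameThree, hab]
    ext i
    fin_cases i <;> simp
  have hc : (u 0 * b - u 1 * a) ^ 2 = u 0 ^ 2 + u 1 ^ 2 := by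
    linear_combination (u 0 ^ 2 + u 1 ^ 2) * hn - (u 0 * a + u 1 * b) * ho
  have n2 : ‖frameTwo u‖ = 1 := by
    rw [hab, EuclideanSpace.norm_eq]
    simp [Fin.sum_univ_three, hn]
  have n3 : ‖frameThree u‖ = 1 := by
    have h : (u 2 * b) ^ 2 + (u 2 * a) ^ 2 + (u 0 * b - u 1 * a) ^ 2 = 1 := by
      linear_combination u 2 ^ 2 * hn + hc + h1
    rw [h3, EuclideanSpace.norm_eq]
    simp [Fin.sum_univ_three, h]
  have i12 : inner ℝ u (frameTwo u) = 0 := by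
    rw [hab]
    simp [PiLp.inner_apply, Fin.sum_univ_three]
    linarith
  have i13 : inner ℝ u (frameThree u) = 0 := by
    rw [h3]
    simp [PiLp.inner_apply, Fin.sum_univ_three]
    ring
  have i23 : inner ℝ (frameTwo u) (frameThree u) = 0 := by
    rw [h3, hab]
    simp [PiLp.inner_apply, Fin.sum_univ_three]
    ring
  refine ⟨fun i => ?_, fun i j hij => ?_⟩
  · fin_cases i <;> simp [hu, n2, n3]
  · fin_cases i <;> fin_cases j <;>
      simp_all [real_inner_comm]

/-- `e₁ = (v_* - v) / |v_* - v|`. -/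
def relDir (v vs : E3) : E3 := ‖vs - v‖⁻¹ • (vs - v)

/-- `α = cos θ e₁ + sin θ cos ε e₂ + sin θ sin ε e₃`. -/
def scatterDir (v vs : E3) (ε θ : ℝ) : E3 :=
  Real.cos θ • relDir v vs + (Real.sin θ * Real.cos ε) • frameTwo (relDir v vs)
    + (Real.sin θ * Real.sin ε) • frameThree (relDir v vs)

/-- `v' = v + ((v_* - v) · α) α`. -/
def postV (v vs : E3) (ε θ : ℝ) : E3 :=
  v + inner ℝ (vs - v) (scatterDir v vs ε θ) • scatterDir v vs ε θ

/-- `v'_* = v_* - ((v_* - v) · α) α`. -/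
def postVs (v vs : E3) (ε θ : ℝ) : E3 :=
  vs - inner ℝ (vs - v) (scatterDir v vs ε θ) • scatterDir v vs ε θ

/-- The measure `dθ dε dv_*` on `ℝ³ × (0, 2π) × (0, π/2)`; a point is `(v_*, ε, θ)`. -/
def collMeasure : Measure (E3 × ℝ × ℝ) :=
  (volume : Measure E3).prod
    ((volume.restrict (Set.Ioo 0 (2 * Real.pi))).prod
      (volume.restrict (Set.Ioo 0 (Real.pi / 2))))

/-- The integrand of `Q(F, G)(v)` as a function of `(v_*, ε, θ)`. -/
def collIntegrand (B : ℝ → ℝ → ℝ) (F G : E3 → ℝ) (v : E3) (p : E3 × ℝ × ℝ) : ℝ :=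
  (F (postV v p.1 p.2.1 p.2.2) * G (postVs v p.1 p.2.1 p.2.2) - F v * G p.1)
    * B ‖v - p.1‖ p.2.2

/-- The Boltzmann collision operator
`Q(F, G)(v) = ∫∫∫ (F(v') G(v'_*) - F(v) G(v_*)) B(|v - v_*|, θ) dθ dε dv_*`. -/
def collQ (B : ℝ → ℝ → ℝ) (F G : E3 → ℝ) (v : E3) : ℝ :=
  ∫ p, collIntegrand B F G v p ∂collMeasure

/-- The Maxwellian `M(v) = π^(-3/2) exp(-|v|²)`. -/
def maxwellian (v : E3) : ℝ := Real.pi ^ (-(3 / 2) : ℝ) * Real.exp (-‖v‖ ^ 2)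

/-- `M^(1/2) f`. -/
def weighted (f : E3 → ℝ) (v : E3) : ℝ := Real.sqrt (maxwellian v) * f v

/-- The linearized collision operator
`L f = M^(-1/2) (Q(M, M^(1/2) f) + Q(M^(1/2) f, M))`. -/
def collL (B : ℝ → ℝ → ℝ) (f : E3 → ℝ) (v : E3) : ℝ :=
  (Real.sqrt (maxwellian v))⁻¹ *
    (collQ B maxwellian (weighted f) v + collQ B (weighted f) maxwellian v)

/-- The collision frequency `ν(v) = ∫∫∫ M(v_*) B(|v - v_*|, θ) dθ dε dv_*`. -/
def collFreq (B : ℝ → ℝ → ℝ) (v : E3) : ℝ :=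
  ∫ p : E3 × ℝ × ℝ, maxwellian p.1 * B ‖v - p.1‖ p.2.2 ∂collMeasure

/-- The operator `K` of the decomposition `L f = -ν f + K f`. -/
def collK (B : ℝ → ℝ → ℝ) (f : E3 → ℝ) (v : E3) : ℝ :=
  collL B f v + collFreq B v * f v

/-- The collision integrals that define `K f (v)` converge absolutely. -/
def CollConverges (B : ℝ → ℝ → ℝ) (f : E3 → ℝ) (v : E3) : Prop :=
  Integrable (collIntegrand B maxwellian (weighted f) v) collMeasure ∧
  Integrable (collIntegrand B (weighted f) maxwellian v) collMeasure ∧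
  Integrable (fun p : E3 × ℝ × ℝ => maxwellian p.1 * B ‖v - p.1‖ p.2.2) collMeasure

/-- `K` acting on functions of `(x, v)`, with `x` as a parameter. -/
def opK (B : ℝ → ℝ → ℝ) (f : E3 × E3 → ℝ) (z : E3 × E3) : ℝ :=
  collK B (fun w => f (z.1, w)) z.2

/-- Grad's angular cutoff assumption `0 ≤ B(r, θ) ≤ C r^γ cos θ sin θ`. -/
def AngularCutoff (γ : ℝ) (B : ℝ → ℝ → ℝ) : Prop :=
  ∃ C : ℝ, ∀ r : ℝ, 0 < r → ∀ θ ∈ Set.Icc 0 (Real.pi / 2),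
    0 ≤ B r θ ∧ B r θ ≤ C * r ^ γ * Real.cos θ * Real.sin θ

/-! ### Transport in a domain -/

/-- The backward exit time `τ₋(x, v) = inf {t > 0 : x - t v ∉ Ω}`, with `inf ∅ = ∞`. -/
def exitTime (Ω : Set E3) (x v : E3) : ℝ≥0∞ :=
  ⨅ (t : ℝ) (_ : 0 < t) (_ : x - t • v ∉ Ω), ENNReal.ofReal t

/-- The interval `(0, τ₋(x, v))`. -/
def travelTimes (Ω : Set E3) (x v : E3) : Set ℝ :=
  {s : ℝ | 0 < s ∧ ENNReal.ofReal s < exitTime Ω x v}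

/-- The integrand `s ↦ exp(-ν(v) s) h(x - s v, v)` at `z = (x, v)`. -/
def transportIntegrand (ν : E3 → ℝ) (h : E3 × E3 → ℝ) (z : E3 × E3) (s : ℝ) : ℝ :=
  Real.exp (-(ν z.2) * s) * h (z.1 - s • z.2, z.2)

/-- `(S_Ω h)(x, v) = ∫ s in 0..τ₋(x, v), exp(-ν(v) s) h(x - s v, v)`. -/
def opS (Ω : Set E3) (ν : E3 → ℝ) (h : E3 × E3 → ℝ) (z : E3 × E3) : ℝ :=
  ∫ s in travelTimes Ω z.1 z.2, transportIntegrand ν h z s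

/-- The operator `S_Ω K`. -/
def opSK (Ω : Set E3) (B : ℝ → ℝ → ℝ) (f : E3 × E3 → ℝ) : E3 × E3 → ℝ :=
  opS Ω (collFreq B) (opK B f)

/-- The operator `K S_Ω K`. -/
def opKSK (Ω : Set E3) (B : ℝ → ℝ → ℝ) (f : E3 × E3 → ℝ) : E3 × E3 → ℝ :=
  opK B (opSK Ω B f)

/-! ### Function spaces -/

/-- Lebesgue measure on `Ω × ℝ³`. -/
def phaseMeasure (Ω : Set E3) : Measure (E3 × E3) :=
  (volume.restrict Ω).prod volume

/-- `∫_{ℝ³} ∫_Ω ∫_Ω |f(x,v) - f(y,v)|² / |x - y|^(3+2s) dx dy dv`. -/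
def slobodeckij (s : ℝ) (Ω : Set E3) (f : E3 × E3 → ℝ) : ℝ≥0∞ :=
  ∫⁻ v : E3, ∫⁻ y in Ω, ∫⁻ x in Ω,
    ENNReal.ofReal (|f (x, v) - f (y, v)| ^ 2 / ‖x - y‖ ^ (3 + 2 * s))

/-- Membership in `L²_v(ℝ³; H^s_x(Ω))`, for `0 < s < 1`. -/
def MemL2Hs (s : ℝ) (Ω : Set E3) (f : E3 × E3 → ℝ) : Prop :=
  MemLp f 2 (phaseMeasure Ω) ∧ slobodeckij s Ω f < ∞

/-- The norm of `L²_v(ℝ³; H^s_x(Ω))`, for `0 < s < 1`. -/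
def normL2Hs (s : ℝ) (Ω : Set E3) (f : E3 × E3 → ℝ) : ℝ≥0∞ :=
  (eLpNorm f 2 (phaseMeasure Ω) ^ 2 + slobodeckij s Ω f) ^ (1 / 2 : ℝ)

end KineticAveraging

end

/-! After a Fourier transform in `x`, damped transport along a fixed velocity `w` over a length at
most `D` (a bound for the diameter of `Ω`) is multiplication by a function of modulus at most
`min(D/|w|, 1/|w·ξ|)`. Decay in `ξ` is lost only for small `w` or for `w` nearly orthogonal to `ξ`,
and the velocity integrations in `K` repair this. The geometric mean of the two bounds is `D^{1/2}
|ξ|^{-1/2} μ(w)`, with `μ(w) = |w|^{-1/2} |w·ω|^{-1/2}` and `ω = ξ/|ξ|`. Half a derivative is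
gained, at the price of a weight that is singular on a plane but integrable against the kernel of
`K` uniformly in `ω`.

Grad's estimate (`lintegral_kWeight_le`): every term of `K` is dominated by convolution in velocity
with `|w|⁻¹ exp(-|w|²/8)`. For the gain terms the collision direction `u` is fixed and the relative
velocity `V` is integrated first. Only `t = V·u` enters the argument `v' = v + t u`, so the
transverse part of `V` integrates out. The remaining integral over rays, averaged over directions,
is an integral over `ℝ³` with density `|w|⁻²`.

Velocity averaging: `lintegral_gradKernel_weight_le` integrates `μ` against this kernel, and the
Schur-type bound `lintegral_conv_weight_conv_sq_le` gives an `L²` estimate for kernel, weight,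
kernel. The weight is absorbed once by the kernel on either side, which is why `K` stands on both
sides of `S_Ω`. With Plancherel and `slobodeckij_half_le_fourier` this is the `H^{1/2}` bound on
`ℝ³`.

Reduction to `ℝ³`: extend `f` by zero. `K` acts at fixed `x`, so `K f` also vanishes off `Ω`, and by
convexity `S_Ω K f` agrees on `Ω` with truncated free transport of that extension
(`ae_opS_eq_freeS`). Restricting back to `Ω` only decreases the norms.

The operators are Bochner integrals, equal to `0` where they diverge, and `f` is only an almost
everywhere class. Absolute convergence and insensitivity to null sets are therefore carried along at
every stage. Finite volume of `Ω` makes the slices in `x` integrable, so that classical Fourier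
integrals and Fubini apply. -/

namespace KineticAveraging

open FourierTransform SchwartzMap

/-! ### Plancherel and the Fourier form of the `H^{1/2}` seminorm -/

/-- The classical and the `L²` Fourier transforms agree on `L¹ ∩ L²`. -/
theorem fourier_toLp_ae_eq {g : E3 → ℂ} (h1 : Integrable g) (h2 : MemLp g 2) :
    (𝓕 (h2.toLp g) : Lp ℂ 2 (volume : Measure E3)) =ᵐ[volume] 𝓕 g := by
  have hc : Continuous (𝓕 g) :=
    VectorFourier.fourierIntegral_continuous Real.continuous_fourierChar
      (by exact continuous_inner) h1
  -- Both functions are locally integrable, so pairing with test functions suffices. The transform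
  -- moves onto the test function by duality of tempered distributions for the `L²` version, and by
  -- Fubini for the classical one.
  refine ae_eq_of_integral_contDiff_smul_eq ?_ hc.locallyIntegrable ?_
  · exact (Lp.memLp _).locallyIntegrable (by norm_num)
  intro φ hφ hφc
  have hφ' : ContDiff ℝ (⊤ : ℕ∞) (fun x => (φ x : ℂ)) :=
    Complex.ofRealCLM.contDiff.comp hφ
  have hφc' : HasCompactSupport (fun x => (φ x : ℂ)) :=
    hφc.comp_left Complex.ofReal_zero
  set ψ : 𝓢(E3, ℂ) := hφc'.toSchwartzMap hφ'
  have hψ : ∀ x, ψ x = (φ x : ℂ) := fun x => rfl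
  have key := congrArg (fun T => T ψ) (Lp.fourier_toTemperedDistribution_eq (h2.toLp g))
  simp only [TemperedDistribution.fourier_apply, Lp.toTemperedDistribution_apply] at key
  have e1 : ∀ h : E3 → ℂ, ∫ x, φ x • h x = ∫ x, ψ x • h x := by
    intro h
    refine integral_congr_ae (Filter.Eventually.of_forall fun x => ?_)
    simp [hψ]
  rw [e1, e1, ← key]
  have e2 : ∫ x, (𝓕 ψ) x • (h2.toLp g : E3 → ℂ) x = ∫ x, (𝓕 ψ) x • g x := by
    refine integral_congr_ae ?_
    filter_upwards [h2.coeFn_toLp] with x hx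
    rw [hx]
  rw [e2]
  have e3 := VectorFourier.integral_fourierIntegral_smul_eq_flip (μ := (volume : Measure E3))
    (ν := (volume : Measure E3)) (L := innerₗ E3) (e := Real.fourierChar)
    (f := fun x => ψ x) (g := g)
    Real.continuous_fourierChar (by exact continuous_inner) ψ.integrable h1
  rw [flip_innerₗ] at e3
  rw [SchwartzMap.fourier_coe]
  exact e3

/-- Plancherel's theorem on `L¹ ∩ L²`. -/
theorem lintegral_enorm_fourier_sq {g : E3 → ℂ} (h1 : Integrable g) (h2 : MemLp g 2) :
    ∫⁻ ξ, ‖𝓕 g ξ‖ₑ ^ 2 = ∫⁻ x, ‖g x‖ₑ ^ 2 := by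
  have hn := Lp.norm_fourier_eq (h2.toLp g)
  have aux : ∀ f : E3 → ℂ, ∫⁻ x, ‖f x‖ₑ ^ 2 = eLpNorm f 2 volume ^ 2 := by
    intro f
    have := eLpNorm_nnreal_pow_eq_lintegral (f := f) (μ := (volume : Measure E3)) (p := 2)
      (by norm_num)
    simpa using this.symm
  rw [aux, aux]
  congr 1
  rw [← eLpNorm_congr_ae (fourier_toLp_ae_eq h1 h2), ← eLpNorm_congr_ae h2.coeFn_toLp]
  rw [Lp.norm_def, Lp.norm_def] at hn
  exact (ENNReal.toReal_eq_toReal_iff' (Lp.eLpNorm_ne_top _) (Lp.eLpNorm_ne_top _)).1 hn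

/-- The modulus is at most `2`, and at most `2π|t| ≤ 7|t|`; the constant `49 = 7²` covers both cases
after squaring. -/
theorem enorm_fourierChar_sub_one_le (t : ℝ) :
    ‖(Real.fourierChar t : ℂ) - 1‖ₑ ^ 2 ≤ ENNReal.ofReal (49 * min 1 (t ^ 2)) := by
  have h1 : ‖(Real.fourierChar t : ℂ) - 1‖ ≤ 2 := by
    refine (norm_sub_le _ _).trans ?_
    rw [Circle.norm_coe, norm_one]; norm_num
  have h2 : ‖(Real.fourierChar t : ℂ) - 1‖ ≤ 7 * |t| := by
    rw [Real.fourierChar_apply, mul_comm]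
    refine Real.norm_exp_I_mul_ofReal_sub_one_le.trans ?_
    rw [Real.norm_eq_abs, abs_mul, abs_of_pos Real.two_pi_pos]
    have := Real.pi_lt_d2
    gcongr
    linarith
  rw [← ofReal_norm, ← ENNReal.ofReal_pow (norm_nonneg _)]
  apply ENNReal.ofReal_le_ofReal
  rcases min_cases 1 (t ^ 2) with ⟨h, _⟩ | ⟨h, _⟩
  · rw [h]; nlinarith [norm_nonneg ((Real.fourierChar t : ℂ) - 1)]
  · rw [h]
    calc _ ≤ (7 * |t|) ^ 2 := by gcongr
      _ = _ := by rw [mul_pow, sq_abs]; norm_num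

theorem lintegral_comp_smul_E3 (f : E3 → ℝ≥0∞) {s : ℝ} (hs : 0 < s) (hf : Measurable f) :
    ∫⁻ x, f (s • x) = ENNReal.ofReal (s ^ 3)⁻¹ * ∫⁻ x, f x := by
  have h := Measure.map_addHaar_smul (volume : Measure E3) hs.ne'
  rw [← lintegral_map hf (measurable_const_smul s), h, lintegral_smul_measure]
  simp [abs_of_pos hs]

/-- In `ℝ³` the integrand behaves like `|h|⁻²` at the origin and `|h|⁻⁴` at infinity, both
integrable there. -/
theorem lintegral_min_one_sq_div_lt_top :
    ∫⁻ h : E3, ENNReal.ofReal (min 1 (‖h‖ ^ 2) / ‖h‖ ^ 4) < ∞ := by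
  refine Integrable.lintegral_lt_top (f := fun h : E3 => min 1 (‖h‖ ^ 2) / ‖h‖ ^ 4) ?_
  refine (integrable_fun_norm_addHaar volume (f := fun r : ℝ => min 1 (r ^ 2) / r ^ 4)).2 ?_
  have hi : IntegrableOn (fun r : ℝ => 2 * (1 + r ^ 2)⁻¹) (Set.Ioi 0) :=
    (integrable_inv_one_add_sq.const_mul 2).integrableOn
  refine hi.mono' (by fun_prop) ?_
  filter_upwards [ae_restrict_mem measurableSet_Ioi] with r hr
  have hr : 0 < r := hr
  have h2 : 0 < r ^ 2 := by positivity
  simp only [finrank_euclideanSpace, Fintype.card_fin, smul_eq_mul, Nat.add_one_sub_one]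
  rw [Real.norm_of_nonneg (by positivity)]
  rw [show r ^ (3 - 1) * (min 1 (r ^ 2) / r ^ 4) = min 1 (r ^ 2) / r ^ 2 by
    norm_num; field_simp, ← div_eq_mul_inv, div_le_div_iff₀ h2 (by positivity)]
  rcases min_cases 1 (r ^ 2) with ⟨h, h'⟩ | ⟨h, h'⟩ <;> rw [h] <;> nlinarith

/-- Scaling: the substitution `h ↦ |ξ| h` produces `|ξ|⁴ · |ξ|⁻³ = |ξ|`. The exponent `4 = 3 +
2·(1/2)` is the one of the seminorm of order `1/2`. -/
theorem lintegral_fourierChar_sub_one_le :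
    ∃ C : ℝ≥0∞, C ≠ ∞ ∧ ∀ ξ : E3,
      ∫⁻ h : E3, ‖(Real.fourierChar (inner ℝ h ξ) : ℂ) - 1‖ₑ ^ 2 / ‖h‖ₑ ^ 4 ≤ C * ‖ξ‖ₑ := by
  refine ⟨49 * ∫⁻ h : E3, ENNReal.ofReal (min 1 (‖h‖ ^ 2) / ‖h‖ ^ 4),
    ENNReal.mul_ne_top (by simp) lintegral_min_one_sq_div_lt_top.ne, fun ξ => ?_⟩
  rcases eq_or_ne ξ 0 with rfl | hξ
  · simp
  have hpos : 0 < ‖ξ‖ := norm_pos_iff.2 hξ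
  have key : ∀ h : E3, h ≠ 0 → ‖(Real.fourierChar (inner ℝ h ξ) : ℂ) - 1‖ₑ ^ 2 / ‖h‖ₑ ^ 4 ≤
      ENNReal.ofReal (49 * ‖ξ‖ ^ 4) *
        ENNReal.ofReal (min 1 (‖‖ξ‖ • h‖ ^ 2) / ‖‖ξ‖ • h‖ ^ 4) := by
    intro h hh
    have hh' : 0 < ‖h‖ := norm_pos_iff.2 hh
    rw [← ENNReal.ofReal_mul (by positivity), ← ofReal_norm h,
      ← ENNReal.ofReal_pow (norm_nonneg _)]
    refine (ENNReal.div_le_div_right (enorm_fourierChar_sub_one_le _) _).trans ?_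
    rw [← ENNReal.ofReal_div_of_pos (by positivity)]
    apply ENNReal.ofReal_le_ofReal
    rw [norm_smul, norm_norm]
    have : (inner ℝ h ξ) ^ 2 ≤ (‖ξ‖ * ‖h‖) ^ 2 := by
      rw [← sq_abs]
      gcongr
      rw [mul_comm]
      exact abs_real_inner_le_norm h ξ
    calc 49 * min 1 ((inner ℝ h ξ) ^ 2) / ‖h‖ ^ 4 ≤ 49 * min 1 ((‖ξ‖ * ‖h‖) ^ 2) / ‖h‖ ^ 4 := by
          gcongr
      _ = _ := by field_simp
  calc _ ≤ ∫⁻ h : E3, ENNReal.ofReal (49 * ‖ξ‖ ^ 4) *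
        ENNReal.ofReal (min 1 (‖‖ξ‖ • h‖ ^ 2) / ‖‖ξ‖ • h‖ ^ 4) := by
        refine lintegral_mono_ae ?_
        filter_upwards [Measure.ae_ne volume (0 : E3)] with h hh using key h hh
    _ = ENNReal.ofReal (49 * ‖ξ‖ ^ 4) * (ENNReal.ofReal (‖ξ‖ ^ 3)⁻¹ *
        ∫⁻ h : E3, ENNReal.ofReal (min 1 (‖h‖ ^ 2) / ‖h‖ ^ 4)) := by
        rw [lintegral_const_mul _ (by fun_prop), lintegral_comp_smul_E3 (fun h : E3 =>
          ENNReal.ofReal (min 1 (‖h‖ ^ 2) / ‖h‖ ^ 4)) hpos (by fun_prop)]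
    _ = _ := by
        rw [← mul_assoc, ← ENNReal.ofReal_mul (by positivity)]
        rw [show 49 * ‖ξ‖ ^ 4 * (‖ξ‖ ^ 3)⁻¹ = 49 * ‖ξ‖ by field_simp,
          ENNReal.ofReal_mul (by norm_num), ofReal_norm]
        norm_num
        ring

/-- The Slobodeckij seminorm of order `1/2` is controlled by the Fourier side. -/
theorem slobodeckij_half_le_fourier :
    ∃ C : ℝ≥0∞, C ≠ ∞ ∧ ∀ g : E3 → ℂ, Measurable g → Integrable g → MemLp g 2 →
      ∫⁻ y, ∫⁻ x, ‖g x - g y‖ₑ ^ 2 / ‖x - y‖ₑ ^ 4 ≤ C * ∫⁻ ξ, ‖ξ‖ₑ * ‖𝓕 g ξ‖ₑ ^ 2 := by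
  obtain ⟨C, hC, hCb⟩ := lintegral_fourierChar_sub_one_le
  refine ⟨C, hC, fun g hg h1 h2 => ?_⟩
  have hFm : Measurable (𝓕 g) :=
    (VectorFourier.fourierIntegral_continuous Real.continuous_fourierChar
      (by exact continuous_inner) h1).measurable
  have shift : ∀ h : E3, ∫⁻ y, ‖g (y + h) - g y‖ₑ ^ 2 =
      ∫⁻ ξ, ‖(Real.fourierChar (inner ℝ h ξ) : ℂ) - 1‖ₑ ^ 2 * ‖𝓕 g ξ‖ₑ ^ 2 := by
    intro h
    have i1 : Integrable (fun y => g (y + h)) := h1.comp_add_right h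
    have m1 : MemLp (fun y => g (y + h)) 2 :=
      h2.comp_measurePreserving (measurePreserving_add_right volume h)
    rw [← lintegral_enorm_fourier_sq (g := fun y => g (y + h) - g y) (i1.sub h1) (m1.sub h2)]
    refine lintegral_congr fun ξ => ?_
    rw [← mul_pow, ← enorm_mul]
    congr 2
    have e1 : 𝓕 (fun y => g (y + h) - g y) ξ = 𝓕 (fun y => g (y + h)) ξ - 𝓕 g ξ := by
      simp only [Real.fourier_eq]
      rw [← integral_sub]
      · simp only [smul_sub]
      · exact (Real.fourierIntegral_convergent_iff ξ).2 i1
      · exact (Real.fourierIntegral_convergent_iff ξ).2 h1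
    have e2 : 𝓕 (fun y => g (y + h)) ξ = Real.fourierChar (inner ℝ h ξ) • 𝓕 g ξ :=
      congrFun (VectorFourier.fourierIntegral_comp_add_right Real.fourierChar volume
        (innerₗ E3) g h) ξ
    rw [e1, e2, Circle.smul_def, smul_eq_mul]
    ring
  -- Put `x = y + h`, integrate in `y` first by Plancherel for the increment of `g`, then integrate
  -- in `h` at fixed `ξ`.
  calc ∫⁻ y, ∫⁻ x, ‖g x - g y‖ₑ ^ 2 / ‖x - y‖ₑ ^ 4
      = ∫⁻ y, ∫⁻ h, ‖g (y + h) - g y‖ₑ ^ 2 / ‖h‖ₑ ^ 4 := by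
        refine lintegral_congr fun y => ?_
        rw [← lintegral_add_left_eq_self _ y]
        simp
    _ = ∫⁻ h, ∫⁻ y, ‖g (y + h) - g y‖ₑ ^ 2 / ‖h‖ₑ ^ 4 :=
        lintegral_lintegral_swap (by simp only [Function.uncurry_def]; fun_prop)
    _ = ∫⁻ h : E3, ∫⁻ ξ, ‖(Real.fourierChar (inner ℝ h ξ) : ℂ) - 1‖ₑ ^ 2 * ‖𝓕 g ξ‖ₑ ^ 2
          / ‖h‖ₑ ^ 4 := by
        refine lintegral_congr fun h => ?_
        simp only [div_eq_mul_inv]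
        rw [lintegral_mul_const'' _ (by fun_prop), lintegral_mul_const'' _ (by fun_prop), shift]
    _ = ∫⁻ ξ, ∫⁻ h : E3, ‖(Real.fourierChar (inner ℝ h ξ) : ℂ) - 1‖ₑ ^ 2 * ‖𝓕 g ξ‖ₑ ^ 2
          / ‖h‖ₑ ^ 4 :=
        lintegral_lintegral_swap (by simp only [Function.uncurry_def]; fun_prop)
    _ ≤ ∫⁻ ξ, C * (‖ξ‖ₑ * ‖𝓕 g ξ‖ₑ ^ 2) := by
        refine lintegral_mono fun ξ => ?_
        have : ∀ h : E3, ‖(Real.fourierChar (inner ℝ h ξ) : ℂ) - 1‖ₑ ^ 2 * ‖𝓕 g ξ‖ₑ ^ 2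
          / ‖h‖ₑ ^ 4 = ‖(Real.fourierChar (inner ℝ h ξ) : ℂ) - 1‖ₑ ^ 2 / ‖h‖ₑ ^ 4 *
            ‖𝓕 g ξ‖ₑ ^ 2 := fun h => by simp only [div_eq_mul_inv]; ring
        simp only [this]
        rw [lintegral_mul_const _ (by fun_prop), ← mul_assoc]
        gcongr
        exact hCb ξ
    _ = _ := lintegral_const_mul _ (by fun_prop)

/-! ### Negative powers in `[0, ∞]` -/

/-- Exponents of one sign never produce `0 · ∞`, so `z = 0` is allowed and singular points need not
be excluded from later integrals. -/
theorem rpow_neg_add {z : ℝ≥0∞} (hz : z ≠ ∞) {a b : ℝ} (ha : 0 ≤ a) (hb : 0 ≤ b) :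
    z ^ (-(a + b)) = z ^ (-a) * z ^ (-b) := by
  rw [ENNReal.rpow_neg, ENNReal.rpow_neg, ENNReal.rpow_neg, ENNReal.rpow_add_of_nonneg _ _ ha hb,
    ENNReal.mul_inv]
  · exact Or.inr (ENNReal.rpow_ne_top_of_nonneg hb hz)
  · exact Or.inl (ENNReal.rpow_ne_top_of_nonneg ha hz)

theorem rpow_neg_anti {y z : ℝ≥0∞} (h : y ≤ z) {a : ℝ} (ha : 0 ≤ a) :
    z ^ (-a) ≤ y ^ (-a) := by
  rw [ENNReal.rpow_neg, ENNReal.rpow_neg]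
  exact ENNReal.inv_le_inv.2 (ENNReal.rpow_le_rpow h ha)

/-! ### One-dimensional integrals -/

theorem lintegral_ball_rpow_lt_top {S : ℝ} (hS : S < 1) :
    ∫⁻ t in Metric.ball (0 : ℝ) 1, ‖t‖ₑ ^ (-S) < ∞ := by
  have h : IntegrableOn (fun t : ℝ => ‖t‖ ^ (-S)) (Metric.ball 0 1) := by
    refine (integrableOn_fun_norm_addHaar volume (f := fun r : ℝ => r ^ (-S))).2 ?_
    simp only [Module.finrank_self, Nat.sub_self, pow_zero, one_smul]
    exact (intervalIntegral.integrableOn_Ioo_rpow_iff one_pos).2 (by linarith)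
  refine lt_of_le_of_lt (lintegral_mono_ae ?_) h.lintegral_lt_top
  filter_upwards [ae_restrict_of_ae (Measure.ae_ne volume (0 : ℝ))] with t ht
  rw [← ofReal_norm, ENNReal.ofReal_rpow_of_pos (norm_pos_iff.2 ht)]

theorem lintegral_exp_sq_lt_top {c : ℝ} (hc : 0 < c) :
    ∫⁻ t : ℝ, ENNReal.ofReal (Real.exp (-c * t ^ 2)) < ∞ :=
  (integrable_exp_neg_mul_sq hc).lintegral_lt_top

/-- Uniform bound for products of two inverse powers against a translated Gaussian. -/
theorem lintegral_rpow_rpow_exp_le {a b c : ℝ} (ha : 0 ≤ a) (hb : 0 ≤ b) (hab : a + b < 1)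
    (hc : 0 < c) :
    ∃ C : ℝ≥0∞, C ≠ ∞ ∧ ∀ p : ℝ,
      ∫⁻ t : ℝ, ‖t‖ₑ ^ (-a) * ‖p - t‖ₑ ^ (-b) * ENNReal.ofReal (Real.exp (-c * (p - t) ^ 2))
        ≤ C := by
  set J := ∫⁻ t in Metric.ball (0 : ℝ) 1, ‖t‖ₑ ^ (-(a + b))
  set E := ∫⁻ t : ℝ, ENNReal.ofReal (Real.exp (-c * t ^ 2))
  have hE : ∀ p : ℝ, ∫⁻ t : ℝ, ENNReal.ofReal (Real.exp (-c * (p - t) ^ 2)) = E :=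
    fun p => lintegral_sub_left_eq_self (fun t => ENNReal.ofReal (Real.exp (-c * t ^ 2))) p
  have one : ∀ p : ℝ, ∫⁻ t : ℝ, ‖t‖ₑ ^ (-(a + b)) * ENNReal.ofReal (Real.exp (-c * (p - t) ^ 2))
      ≤ J + E := by
    intro p
    rw [← hE p, show J = _ from (lintegral_indicator Metric.isOpen_ball.measurableSet _).symm,
      ← lintegral_add_right _ (by fun_prop)]
    refine lintegral_mono fun t => ?_
    have hle1 : ENNReal.ofReal (Real.exp (-c * (p - t) ^ 2)) ≤ 1 := by
      rw [ENNReal.ofReal_le_one]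
      exact Real.exp_le_one_iff.2 (by nlinarith [sq_nonneg (p - t)])
    -- Inside the unit ball the Gaussian is bounded by `1` and the power is integrable; outside, the
    -- power is at most `1` and the Gaussian is integrable.
    by_cases ht : t ∈ Metric.ball (0 : ℝ) 1
    · rw [Set.indicator_of_mem ht]
      exact (mul_le_of_le_one_right' hle1).trans le_self_add
    · rw [Set.indicator_of_notMem ht, zero_add]
      refine mul_le_of_le_one_left' ?_
      have h1 : 1 ≤ ‖t‖ₑ := by
        rw [← ofReal_norm]
        simpa using ht
      calc ‖t‖ₑ ^ (-(a + b)) ≤ 1 ^ (-(a + b)) := rpow_neg_anti h1 (by positivity)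
        _ = 1 := ENNReal.one_rpow _
  have hJE : J + E ≠ ∞ :=
    ENNReal.add_ne_top.2 ⟨(lintegral_ball_rpow_lt_top hab).ne, (lintegral_exp_sq_lt_top hc).ne⟩
  refine ⟨(J + E) + (J + E), ENNReal.add_ne_top.2 ⟨hJE, hJE⟩, fun p => ?_⟩
  have two : ∫⁻ t : ℝ, ‖p - t‖ₑ ^ (-(a + b)) * ENNReal.ofReal (Real.exp (-c * (p - t) ^ 2))
      ≤ J + E := by
    rw [lintegral_sub_left_eq_self
      (fun t => ‖t‖ₑ ^ (-(a + b)) * ENNReal.ofReal (Real.exp (-c * t ^ 2))) p]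
    simpa using one 0
  refine le_trans ?_ (add_le_add (one p) two)
  rw [← lintegral_add_left (by fun_prop)]
  refine lintegral_mono fun t => ?_
  rw [← add_mul]
  gcongr
  -- Replacing the larger of `|t|`, `|p - t|` by the smaller one bounds the product by a single
  -- power `-(a + b)` of the smaller, with only one singular point left to treat.
  rcases le_total ‖t‖ₑ ‖p - t‖ₑ with h | h
  · refine le_trans ?_ le_self_add
    rw [rpow_neg_add (by simp) ha hb]
    exact mul_le_mul' le_rfl (rpow_neg_anti h hb)
  · refine le_trans ?_ le_add_self
    rw [rpow_neg_add (by simp) ha hb]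
    exact mul_le_mul' (rpow_neg_anti h ha) le_rfl

theorem lintegral_mul_mul {f g h : ℝ → ℝ≥0∞} (hf : Measurable f) (hg : Measurable g)
    (hh : Measurable h) :
    ∫⁻ t, ∫⁻ x, ∫⁻ y, f t * (g x * h y) = (∫⁻ t, f t) * ((∫⁻ x, g x) * ∫⁻ y, h y) := by
  have e1 : ∀ t x, ∫⁻ y, f t * (g x * h y) = f t * (g x * ∫⁻ y, h y) := fun t x => by
    rw [lintegral_const_mul _ (by fun_prop), lintegral_const_mul _ hh]
  have e2 : ∀ t, ∫⁻ x, f t * (g x * ∫⁻ y, h y) = f t * ((∫⁻ x, g x) * ∫⁻ y, h y) := fun t => by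
    rw [lintegral_const_mul _ (by fun_prop), lintegral_mul_const _ hg]
  simp only [e1, e2]
  rw [lintegral_mul_const _ hf]

/-! ### Coordinates in the frame of a unit vector -/

/-- The point with coordinates `(t, x, y)` in the frame of `u`. -/
noncomputable def framePoint (u : E3) (t x y : ℝ) : E3 := t • u + x • frameTwo u + y • frameThree u

/-- The frame of a unit vector as an orthonormal basis. -/
noncomputable def frameBasis (u : E3) (hu : ‖u‖ = 1) : OrthonormalBasis (Fin 3) ℝ E3 :=
  (basisOfOrthonormalOfCardEqFinrank (orthonormal_frame u hu) (by simp)).toOrthonormalBasis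
    (by simpa using orthonormal_frame u hu)

theorem frameBasis_apply (u : E3) (hu : ‖u‖ = 1) (i : Fin 3) :
    frameBasis u hu i = ![u, frameTwo u, frameThree u] i := by
  simp [frameBasis]

theorem frameBasis_repr_symm (u : E3) (hu : ‖u‖ = 1) (w : E3) :
    (frameBasis u hu).repr.symm w = framePoint u (w 0) (w 1) (w 2) := by
  rw [← OrthonormalBasis.sum_repr_symm]
  simp [Fin.sum_univ_three, frameBasis_apply, framePoint]

theorem exists_framePoint (u : E3) (hu : ‖u‖ = 1) (v : E3) :
    ∃ t x y, v = framePoint u t x y := by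
  have h := frameBasis_repr_symm u hu ((frameBasis u hu).repr v)
  rw [LinearIsometryEquiv.symm_apply_apply] at h
  exact ⟨_, _, _, h⟩

theorem norm_sq_framePoint (u : E3) (hu : ‖u‖ = 1) (t x y : ℝ) :
    ‖framePoint u t x y‖ ^ 2 = t ^ 2 + x ^ 2 + y ^ 2 := by
  have h := frameBasis_repr_symm u hu !₂[t, x, y]
  simp only [Fin.isValue, Matrix.cons_val] at h
  rw [← h, LinearIsometryEquiv.norm_map, EuclideanSpace.norm_sq_eq]
  simp [Fin.sum_univ_three]

theorem inner_framePoint (u : E3) (hu : ‖u‖ = 1) (t x y : ℝ) :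
    inner ℝ (framePoint u t x y) u = t := by
  have h := orthonormal_frame u hu
  have h1 : inner ℝ (frameTwo u) u = 0 := h.2 (i := 1) (j := 0) (by decide)
  have h2 : inner ℝ (frameThree u) u = 0 := h.2 (i := 2) (j := 0) (by decide)
  simp [framePoint, inner_add_left, inner_smul_left, h1, h2, hu]

theorem framePoint_sub (u : E3) (t x y t' x' y' : ℝ) :
    framePoint u t x y - framePoint u t' x' y' = framePoint u (t - t') (x - x') (y - y') := by
  simp only [framePoint, sub_smul]; abel

theorem framePoint_add (u : E3) (t x y t' x' y' : ℝ) :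
    framePoint u t x y + framePoint u t' x' y' = framePoint u (t + t') (x + x') (y + y') := by
  simp only [framePoint, add_smul]; abel

@[fun_prop]
theorem continuous_framePoint (u : E3) :
    Continuous fun p : ℝ × ℝ × ℝ => framePoint u p.1 p.2.1 p.2.2 := by
  unfold framePoint; fun_prop

/-- Integration in the coordinates of the frame of a unit vector. -/
theorem lintegral_framePoint (u : E3) (hu : ‖u‖ = 1) {Φ : E3 → ℝ≥0∞} (hΦ : Measurable Φ) :
    ∫⁻ V, Φ V = ∫⁻ t : ℝ, ∫⁻ x : ℝ, ∫⁻ y : ℝ, Φ (framePoint u t x y) := by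
  have hm : Measurable fun p : ℝ × ℝ × ℝ => Φ (framePoint u p.1 p.2.1 p.2.2) :=
    hΦ.comp (continuous_framePoint u).measurable
  calc ∫⁻ V, Φ V = ∫⁻ w : E3, Φ (framePoint u (w 0) (w 1) (w 2)) := by
        rw [← (frameBasis u hu).measurePreserving_repr_symm.lintegral_comp hΦ]
        simp only [frameBasis_repr_symm]
    _ = ∫⁻ w : Fin 3 → ℝ, Φ (framePoint u (w 0) (w 1) (w 2)) := by
        rw [← (EuclideanSpace.volume_preserving_symm_measurableEquiv_toLp (Fin 3)).lintegral_comp_emb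
          (MeasurableEquiv.measurableEmbedding _)]
        rfl
    _ = ∫⁻ p : ℝ × (Fin 2 → ℝ), Φ (framePoint u p.1 (p.2 0) (p.2 1)) := by
        rw [← (volume_preserving_piFinSuccAbove (fun _ : Fin 3 => ℝ) 0).lintegral_comp_emb
          (MeasurableEquiv.measurableEmbedding _)]
        rfl
    _ = ∫⁻ t : ℝ, ∫⁻ q : Fin 2 → ℝ, Φ (framePoint u t (q 0) (q 1)) := by
        rw [Measure.volume_eq_prod, lintegral_prod]
        have : Measurable fun p : ℝ × (Fin 2 → ℝ) => (p.1, p.2 0, p.2 1) := by fun_prop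
        exact (hm.comp this).aemeasurable
    _ = ∫⁻ t : ℝ, ∫⁻ q : ℝ × ℝ, Φ (framePoint u t q.1 q.2) := by
        refine lintegral_congr fun t => ?_
        rw [← (volume_preserving_finTwoArrow ℝ).lintegral_comp_emb
          (MeasurableEquiv.measurableEmbedding _)]
        rfl
    _ = _ := by
        refine lintegral_congr fun t => ?_
        rw [Measure.volume_eq_prod, lintegral_prod]
        exact (hm.comp measurable_prodMk_left).aemeasurable

/-! ### The dominating kernel -/

/-- The kernel `|w|⁻¹ exp(-|w|²/8)`, which dominates the kernel of `K`. -/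
noncomputable def gradKernel (w : E3) : ℝ≥0∞ := ‖w‖ₑ⁻¹ * ENNReal.ofReal (Real.exp (-‖w‖ ^ 2 / 8))

@[fun_prop]
theorem measurable_gradKernel : Measurable gradKernel := by unfold gradKernel; fun_prop

theorem gradKernel_neg (w : E3) : gradKernel (-w) = gradKernel w := by simp [gradKernel]

theorem gradKernel_sub_comm (v w : E3) : gradKernel (v - w) = gradKernel (w - v) := by
  rw [← gradKernel_neg, neg_sub]

theorem gradKernel_eq_ofReal {w : E3} (hw : w ≠ 0) :
    gradKernel w = ENNReal.ofReal (‖w‖⁻¹ * Real.exp (-‖w‖ ^ 2 / 8)) := by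
  rw [gradKernel, ENNReal.ofReal_mul (by positivity),
    ENNReal.ofReal_inv_of_pos (norm_pos_iff.2 hw), ofReal_norm]

theorem lintegral_gradKernel_lt_top : ∫⁻ w, gradKernel w < ∞ := by
  have h : Integrable (fun w : E3 => ‖w‖⁻¹ * Real.exp (-‖w‖ ^ 2 / 8)) := by
    refine (integrable_fun_norm_addHaar volume
      (f := fun r : ℝ => r⁻¹ * Real.exp (-r ^ 2 / 8))).2 ?_
    have hi : IntegrableOn (fun r : ℝ => r * Real.exp (-(1 / 8) * r ^ 2)) (Set.Ioi 0) :=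
      (integrable_mul_exp_neg_mul_sq (by norm_num)).integrableOn
    refine hi.congr_fun (fun r hr => ?_) measurableSet_Ioi
    have hr : 0 < r := hr
    simp only [finrank_euclideanSpace, Fintype.card_fin, smul_eq_mul]
    rw [show -(1 / 8) * r ^ 2 = -r ^ 2 / 8 by ring]
    norm_num
    field_simp
  refine lt_of_le_of_lt (lintegral_mono_ae ?_) h.lintegral_lt_top
  filter_upwards [Measure.ae_ne volume (0 : E3)] with w hw using (gradKernel_eq_ofReal hw).le

/-- The Jacobian `r²` cancels the singularity `r⁻²`. Square integrability lets the kernel be paired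
with functions that are merely `L²` in velocity. -/
theorem lintegral_gradKernel_sq_lt_top : ∫⁻ w, gradKernel w ^ 2 < ∞ := by
  have h : Integrable (fun w : E3 => (‖w‖⁻¹ * Real.exp (-‖w‖ ^ 2 / 8)) ^ 2) := by
    refine (integrable_fun_norm_addHaar volume
      (f := fun r : ℝ => (r⁻¹ * Real.exp (-r ^ 2 / 8)) ^ 2)).2 ?_
    have hi : IntegrableOn (fun r : ℝ => Real.exp (-(1 / 4) * r ^ 2)) (Set.Ioi 0) :=
      (integrable_exp_neg_mul_sq (by norm_num)).integrableOn
    refine hi.congr_fun (fun r hr => ?_) measurableSet_Ioi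
    have hr : 0 < r := hr
    simp only [finrank_euclideanSpace, Fintype.card_fin, smul_eq_mul]
    rw [mul_pow, ← Real.exp_nat_mul, show -(1 / 4) * r ^ 2 = (2 : ℕ) * (-r ^ 2 / 8) by
      push_cast; ring]
    norm_num
    field_simp
  refine lt_of_le_of_lt (lintegral_mono_ae ?_) h.lintegral_lt_top
  filter_upwards [Measure.ae_ne volume (0 : E3)] with w hw
  rw [gradKernel_eq_ofReal hw, ENNReal.ofReal_pow (by positivity)]

/-- Negative powers of `|w|` can thus be distributed over chosen coordinates, which makes the
integrals factor. -/
theorem abs_coord_le_norm_framePoint (u : E3) (hu : ‖u‖ = 1) (t x y : ℝ) :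
    ‖t‖ₑ ≤ ‖framePoint u t x y‖ₑ ∧ ‖x‖ₑ ≤ ‖framePoint u t x y‖ₑ ∧
      ‖y‖ₑ ≤ ‖framePoint u t x y‖ₑ := by
  have h := norm_sq_framePoint u hu t x y
  have aux : ∀ s : ℝ, s ^ 2 ≤ t ^ 2 + x ^ 2 + y ^ 2 → ‖s‖ₑ ≤ ‖framePoint u t x y‖ₑ := by
    intro s hs
    rw [enorm_le_iff_norm_le, Real.norm_eq_abs]
    refine abs_le_of_sq_le_sq (by rw [h]; exact hs) (norm_nonneg _)
  refine ⟨aux _ ?_, aux _ ?_, aux _ ?_⟩ <;> nlinarith [sq_nonneg t, sq_nonneg x, sq_nonneg y]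

/-- The weight `|w|^(-1/2) |w · ω|^(-1/2)` is integrated by the kernel, uniformly in `v`, `ω`. -/
theorem lintegral_gradKernel_weight_le :
    ∃ C : ℝ≥0∞, C ≠ ∞ ∧ ∀ v ω : E3, ‖ω‖ = 1 →
      ∫⁻ w, gradKernel (v - w) * (‖w‖ₑ ^ (-(1 / 2) : ℝ) * ‖inner ℝ w ω‖ₑ ^ (-(1 / 2) : ℝ)) ≤ C := by
  have h8 : (0 : ℝ) < 1 / 8 := by norm_num
  -- Coordinates `(t, x, y)` with `t = w·ω`. The factor `|w|^{-1/2}` is split evenly between `t` and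
  -- `x`, and the kernel singularity `|v - w|⁻¹` evenly between the two transverse directions. The
  -- total exponents are `1/2 + 1/4` in `t`, `1/4 + 1/2` in `x` and `1/2` in `y`, all below `1`.
  obtain ⟨C1, hC1, b1⟩ := lintegral_rpow_rpow_exp_le (a := 3 / 4) (b := 0) (by norm_num) le_rfl
    (by norm_num) h8
  obtain ⟨C2, hC2, b2⟩ := lintegral_rpow_rpow_exp_le (a := 1 / 4) (b := 1 / 2) (by norm_num)
    (by norm_num) (by norm_num) h8
  obtain ⟨C3, hC3, b3⟩ := lintegral_rpow_rpow_exp_le (a := 0) (b := 1 / 2) le_rfl (by norm_num)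
    (by norm_num) h8
  refine ⟨C1 * (C2 * C3), ENNReal.mul_ne_top hC1 (ENNReal.mul_ne_top hC2 hC3),
    fun v ω hω => ?_⟩
  obtain ⟨p, q, r, rfl⟩ := exists_framePoint ω hω v
  rw [lintegral_framePoint ω hω (by fun_prop)]
  have key : ∀ t x y : ℝ, gradKernel (framePoint ω p q r - framePoint ω t x y) *
      (‖framePoint ω t x y‖ₑ ^ (-(1 / 2) : ℝ) *
        ‖inner ℝ (framePoint ω t x y) ω‖ₑ ^ (-(1 / 2) : ℝ)) ≤
      (‖t‖ₑ ^ (-(3 / 4) : ℝ) * ‖p - t‖ₑ ^ (-(0) : ℝ) *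
        ENNReal.ofReal (Real.exp (-(1 / 8) * (p - t) ^ 2))) *
      ((‖x‖ₑ ^ (-(1 / 4) : ℝ) * ‖q - x‖ₑ ^ (-(1 / 2) : ℝ) *
        ENNReal.ofReal (Real.exp (-(1 / 8) * (q - x) ^ 2))) *
      (‖y‖ₑ ^ (-(0) : ℝ) * ‖r - y‖ₑ ^ (-(1 / 2) : ℝ) *
        ENNReal.ofReal (Real.exp (-(1 / 8) * (r - y) ^ 2)))) := by
    intro t x y
    rw [framePoint_sub, inner_framePoint ω hω, gradKernel]
    obtain ⟨ht, hx, -⟩ := abs_coord_le_norm_framePoint ω hω t x y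
    obtain ⟨-, hx', hy'⟩ := abs_coord_le_norm_framePoint ω hω (p - t) (q - x) (r - y)
    have e1 : ‖framePoint ω (p - t) (q - x) (r - y)‖ₑ⁻¹ ≤
        ‖q - x‖ₑ ^ (-(1 / 2) : ℝ) * ‖r - y‖ₑ ^ (-(1 / 2) : ℝ) := by
      rw [← ENNReal.rpow_neg_one, show (-1 : ℝ) = -(1 / 2 + 1 / 2) by norm_num,
        rpow_neg_add (by simp) (by norm_num) (by norm_num)]
      exact mul_le_mul' (rpow_neg_anti hx' (by norm_num)) (rpow_neg_anti hy' (by norm_num))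
    have e2 : ‖framePoint ω t x y‖ₑ ^ (-(1 / 2) : ℝ) ≤
        ‖t‖ₑ ^ (-(1 / 4) : ℝ) * ‖x‖ₑ ^ (-(1 / 4) : ℝ) := by
      rw [show (-(1 / 2) : ℝ) = -(1 / 4 + 1 / 4) by norm_num,
        rpow_neg_add (by simp) (by norm_num) (by norm_num)]
      exact mul_le_mul' (rpow_neg_anti ht (by norm_num)) (rpow_neg_anti hx (by norm_num))
    have e3 : ‖t‖ₑ ^ (-(3 / 4) : ℝ) = ‖t‖ₑ ^ (-(1 / 4) : ℝ) * ‖t‖ₑ ^ (-(1 / 2) : ℝ) := by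
      rw [← rpow_neg_add (by simp) (by norm_num) (by norm_num)]
      norm_num
    have e4 : ENNReal.ofReal (Real.exp (-‖framePoint ω (p - t) (q - x) (r - y)‖ ^ 2 / 8)) =
        ENNReal.ofReal (Real.exp (-(1 / 8) * (p - t) ^ 2)) *
        (ENNReal.ofReal (Real.exp (-(1 / 8) * (q - x) ^ 2)) *
        ENNReal.ofReal (Real.exp (-(1 / 8) * (r - y) ^ 2))) := by
      rw [norm_sq_framePoint ω hω, ← ENNReal.ofReal_mul (Real.exp_nonneg _), ← Real.exp_add,
        ← ENNReal.ofReal_mul (Real.exp_nonneg _), ← Real.exp_add]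
      congr 2
      ring
    rw [e3, e4, neg_zero, ENNReal.rpow_zero, ENNReal.rpow_zero, mul_one, one_mul]
    calc _ ≤ (‖q - x‖ₑ ^ (-(1 / 2) : ℝ) * ‖r - y‖ₑ ^ (-(1 / 2) : ℝ)) * _ *
          ((‖t‖ₑ ^ (-(1 / 4) : ℝ) * ‖x‖ₑ ^ (-(1 / 4) : ℝ)) * ‖t‖ₑ ^ (-(1 / 2) : ℝ)) :=
        mul_le_mul' (mul_le_mul' e1 le_rfl) (mul_le_mul' e2 le_rfl)
      _ = _ := by ring
  calc _ ≤ _ := lintegral_mono fun t => lintegral_mono fun x => lintegral_mono fun y => key t x y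
    _ ≤ _ := by
      rw [lintegral_mul_mul (by fun_prop) (by fun_prop) (by fun_prop)]
      exact mul_le_mul' (b1 p) (mul_le_mul' (b2 q) (b3 r))

/-! ### Measurability of the collision parametrization -/

theorem measurable_vec3 {α : Type*} [MeasurableSpace α] {a b c : α → ℝ} (ha : Measurable a)
    (hb : Measurable b) (hc : Measurable c) : Measurable fun x => (!₂[a x, b x, c x] : E3) := by
  refine (MeasurableEquiv.toLp 2 (Fin 3 → ℝ)).measurable.comp (measurable_pi_iff.2 fun i => ?_)
  fin_cases i <;> simpa

@[fun_prop]
theorem measurable_frameTwo : Measurable frameTwo := by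
  unfold frameTwo
  refine Measurable.ite ?_ measurable_const ?_
  · have m0 : Measurable fun u : E3 => u 0 := by fun_prop
    have m1 : Measurable fun u : E3 => u 1 := by fun_prop
    exact (m0 (measurableSet_singleton 0)).inter (m1 (measurableSet_singleton 0))
  · have m : Measurable fun u : E3 => (Real.sqrt (u 0 ^ 2 + u 1 ^ 2))⁻¹ := by fun_prop
    refine m.smul (measurable_vec3 ?_ ?_ ?_) <;> fun_prop

@[fun_prop]
theorem measurable_frameThree : Measurable frameThree := by
  unfold frameThree
  refine measurable_vec3 ?_ ?_ ?_ <;> fun_prop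

@[fun_prop]
theorem measurable_scatterDir :
    Measurable fun q : E3 × E3 × ℝ × ℝ => scatterDir q.1 q.2.1 q.2.2.1 q.2.2.2 := by
  unfold scatterDir relDir; fun_prop

@[fun_prop]
theorem measurable_postV :
    Measurable fun q : E3 × E3 × ℝ × ℝ => postV q.1 q.2.1 q.2.2.1 q.2.2.2 := by
  unfold postV; fun_prop

@[fun_prop]
theorem measurable_postVs :
    Measurable fun q : E3 × E3 × ℝ × ℝ => postVs q.1 q.2.1 q.2.2.1 q.2.2.2 := by
  unfold postVs; fun_prop

/-! ### Geometry of the collision map -/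

theorem scatterDir_eq_framePoint (v vs : E3) (ε θ : ℝ) :
    scatterDir v vs ε θ = framePoint (relDir v vs) (Real.cos θ) (Real.sin θ * Real.cos ε)
      (Real.sin θ * Real.sin ε) := rfl

theorem norm_relDir {v vs : E3} (h : vs ≠ v) : ‖relDir v vs‖ = 1 := by
  have : ‖vs - v‖ ≠ 0 := norm_ne_zero_iff.2 (sub_ne_zero.2 h)
  rw [relDir, norm_smul, norm_inv, norm_norm, inv_mul_cancel₀ this]

theorem norm_smul_relDir {v vs : E3} (h : vs ≠ v) : ‖vs - v‖ • relDir v vs = vs - v := by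
  have : ‖vs - v‖ ≠ 0 := norm_ne_zero_iff.2 (sub_ne_zero.2 h)
  rw [relDir, smul_smul, mul_inv_cancel₀ this, one_smul]

theorem inner_scatterDir {v vs : E3} (h : vs ≠ v) (ε θ : ℝ) :
    inner ℝ (vs - v) (scatterDir v vs ε θ) = ‖vs - v‖ * Real.cos θ := by
  conv_lhs => rw [← norm_smul_relDir h]
  rw [real_inner_smul_left, real_inner_comm, scatterDir_eq_framePoint,
    inner_framePoint _ (norm_relDir h)]

theorem norm_scatterDir {v vs : E3} (h : vs ≠ v) (ε θ : ℝ) : ‖scatterDir v vs ε θ‖ = 1 := by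
  have h1 := norm_sq_framePoint (relDir v vs) (norm_relDir h) (Real.cos θ)
    (Real.sin θ * Real.cos ε) (Real.sin θ * Real.sin ε)
  rw [← scatterDir_eq_framePoint] at h1
  have h2 : ‖scatterDir v vs ε θ‖ ^ 2 = 1 := by
    rw [h1]
    linear_combination (Real.sin θ) ^ 2 * Real.sin_sq_add_cos_sq ε + Real.sin_sq_add_cos_sq θ
  exact (pow_eq_one_iff_of_nonneg (norm_nonneg _) (by norm_num)).1 h2

/-- Exchanging `θ` with `π/2 - θ` and rotating by `π` exchanges the two outgoing velocities. -/
theorem postV_swap {v vs : E3} (h : vs ≠ v) (ε θ : ℝ) :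
    postV v vs (ε + Real.pi) (Real.pi / 2 - θ) = postVs v vs ε θ := by
  simp only [postV, postVs, inner_scatterDir h]
  have hV := norm_smul_relDir h
  have : vs = v + ‖vs - v‖ • relDir v vs := by rw [hV]; abel
  conv_rhs => rw [this]
  have e : ‖v + ‖vs - v‖ • relDir v vs - v‖ = ‖vs - v‖ := by rw [← this]
  have e' : relDir v (v + ‖vs - v‖ • relDir v vs) = relDir v vs := by rw [← this]
  simp only [scatterDir, e, e']
  rw [Real.cos_pi_div_two_sub, Real.sin_pi_div_two_sub, Real.cos_add_pi, Real.sin_add_pi]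
  -- Homogenizing with `sin² + cos² = 1` makes the identity polynomial in the trigonometric
  -- coefficients.
  have h1 : ‖vs - v‖ • relDir v vs =
      (‖vs - v‖ * (Real.sin θ ^ 2 + Real.cos θ ^ 2)) • relDir v vs := by
    rw [Real.sin_sq_add_cos_sq, mul_one]
  rw [h1]
  module

theorem postVs_swap {v vs : E3} (h : vs ≠ v) (ε θ : ℝ) :
    postVs v vs (ε + Real.pi) (Real.pi / 2 - θ) = postV v vs ε θ := by
  have h1 : ∀ ε θ, postV v vs ε θ + postVs v vs ε θ = v + vs := fun ε θ => by
    simp only [postV, postVs]; abel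
  have h2 := h1 (ε + Real.pi) (Real.pi / 2 - θ)
  rw [postV_swap h, ← h1 ε θ, add_comm (postV v vs ε θ)] at h2
  exact add_left_cancel h2

/-! ### Polar and spherical coordinates -/

/-- Any two period intervals are fundamental domains of the same translation group. This moves the
polar angle from `(-π, π)` to `(0, 2π)`, and later absorbs a shift of `ε` by `π`. -/
theorem setLIntegral_periodic {F : ℝ → ℝ≥0∞} (hF : Function.Periodic F (2 * Real.pi)) (a : ℝ) :
    ∫⁻ ε in Set.Ioo a (a + 2 * Real.pi), F ε = ∫⁻ ε in Set.Ioo 0 (2 * Real.pi), F ε := by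
  rw [setLIntegral_congr Ioo_ae_eq_Ioc, setLIntegral_congr (Ioo_ae_eq_Ioc (a := (0 : ℝ)))]
  have h1 := isAddFundamentalDomain_Ioc Real.two_pi_pos a
  have h2 := isAddFundamentalDomain_Ioc Real.two_pi_pos 0
  rw [zero_add] at h2
  refine h1.setLIntegral_eq h2 F ?_
  rintro ⟨g, n, rfl⟩ x
  have := hF.int_mul n x
  rw [← this, add_comm]
  simp [AddSubgroup.vadd_def]

theorem lintegral_polar {G : ℝ → ℝ → ℝ≥0∞} (hG : Measurable fun p : ℝ × ℝ => G p.1 p.2) :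
    ∫⁻ x, ∫⁻ y, G x y = ∫⁻ r in Set.Ioi (0 : ℝ), ∫⁻ ε in Set.Ioo 0 (2 * Real.pi),
      ENNReal.ofReal r * G (r * Real.cos ε) (r * Real.sin ε) := by
  have h := lintegral_comp_polarCoord_symm fun p => G p.1 p.2
  rw [Measure.volume_eq_prod, lintegral_prod _ hG.aemeasurable] at h
  rw [← h, polarCoord_target, ← Measure.prod_restrict, lintegral_prod]
  · refine lintegral_congr fun r => ?_
    rw [← setLIntegral_periodic _ (-Real.pi)]
    · rw [show -Real.pi + 2 * Real.pi = Real.pi by ring]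
      rfl
    · intro ε
      simp
  · refine Measurable.aemeasurable ?_
    simp only [polarCoord_symm_apply, smul_eq_mul]
    have : Measurable fun p : ℝ × ℝ => (p.1 * Real.cos p.2, p.1 * Real.sin p.2) := by fun_prop
    exact (by fun_prop : Measurable fun p : ℝ × ℝ => ENNReal.ofReal p.1).mul (hG.comp this)

/-- Used with `t` the height along an axis and `ρ` the distance to it; the open quadrant is exactly
the range `θ ∈ (0, π/2)`. -/
theorem lintegral_polar_quadrant {G : ℝ → ℝ → ℝ≥0∞} (hG : Measurable fun p : ℝ × ℝ => G p.1 p.2) :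
    ∫⁻ t in Set.Ioi (0 : ℝ), ∫⁻ ρ in Set.Ioi (0 : ℝ), G t ρ =
      ∫⁻ r in Set.Ioi (0 : ℝ), ∫⁻ θ in Set.Ioo 0 (Real.pi / 2),
        ENNReal.ofReal r * G (r * Real.cos θ) (r * Real.sin θ) := by
  set Q : Set (ℝ × ℝ) := Set.Ioi 0 ×ˢ Set.Ioi 0
  have hQ : MeasurableSet Q := measurableSet_Ioi.prod measurableSet_Ioi
  have h := lintegral_comp_polarCoord_symm (Q.indicator fun p => G p.1 p.2)
  rw [lintegral_indicator hQ, Measure.volume_eq_prod, ← Measure.prod_restrict,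
    lintegral_prod _ hG.aemeasurable] at h
  have hm : Measurable fun p : ℝ × ℝ => (p.1 * Real.cos p.2, p.1 * Real.sin p.2) := by fun_prop
  rw [← h, polarCoord_target, ← Measure.prod_restrict, lintegral_prod]
  · refine setLIntegral_congr_fun measurableSet_Ioi fun r (hr : 0 < r) => ?_
    have hsub : Set.Ioo 0 (Real.pi / 2) ⊆ Set.Ioo (-Real.pi) Real.pi := fun θ hθ =>
      ⟨by linarith [hθ.1, Real.pi_pos], by linarith [hθ.2, Real.pi_pos]⟩
    rw [← Set.inter_eq_self_of_subset_left hsub, ← Measure.restrict_restrict measurableSet_Ioo,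
      ← lintegral_indicator (μ := volume.restrict (Set.Ioo (-Real.pi) Real.pi))
        (s := Set.Ioo 0 (Real.pi / 2)) measurableSet_Ioo]
    refine setLIntegral_congr_fun (s := Set.Ioo (-Real.pi) Real.pi) measurableSet_Ioo
      fun θ hθ => ?_
    simp only [polarCoord_symm_apply, smul_eq_mul]
    by_cases hθ' : θ ∈ Set.Ioo 0 (Real.pi / 2)
    · have hc := Real.cos_pos_of_mem_Ioo (show θ ∈ Set.Ioo (-(Real.pi / 2)) (Real.pi / 2) from
        ⟨by linarith [hθ'.1, Real.pi_pos], hθ'.2⟩)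
      have hs := Real.sin_pos_of_pos_of_lt_pi hθ'.1 hθ.2
      rw [Set.indicator_of_mem hθ', Set.indicator_of_mem]
      exact ⟨mul_pos hr hc, mul_pos hr hs⟩
    · rw [Set.indicator_of_notMem hθ', Set.indicator_of_notMem, mul_zero]
      rintro ⟨h1, h2⟩
      have hc : 0 < Real.cos θ := (mul_pos_iff_of_pos_left hr).1 h1
      have hs : 0 < Real.sin θ := (mul_pos_iff_of_pos_left hr).1 h2
      apply hθ'
      have h0 : 0 < θ := by
        by_contra h0
        exact absurd (Real.sin_nonpos_of_nonpos_of_neg_pi_le (not_lt.1 h0) hθ.1.le) (not_le.2 hs)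
      refine ⟨h0, ?_⟩
      by_contra h0
      exact absurd (Real.cos_nonpos_of_pi_div_two_le_of_le (not_lt.1 h0)
        (by linarith [hθ.2, Real.pi_pos])) (not_le.2 hc)
  · refine Measurable.aemeasurable ?_
    simp only [polarCoord_symm_apply, smul_eq_mul]
    exact (by fun_prop : Measurable fun p : ℝ × ℝ => ENNReal.ofReal p.1).mul
      ((hG.indicator hQ).comp hm)

/-- Spherical coordinates in the half space around a unit vector `e`. -/
theorem lintegral_spherical (e : E3) (he : ‖e‖ = 1) {Φ : E3 → ℝ≥0∞} (hΦ : Measurable Φ) :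
    ∫⁻ a in {a : E3 | 0 < inner ℝ a e}, Φ a =
      ∫⁻ r in Set.Ioi (0 : ℝ), ∫⁻ θ in Set.Ioo 0 (Real.pi / 2),
        ∫⁻ ε in Set.Ioo 0 (2 * Real.pi), ENNReal.ofReal (r ^ 2 * Real.sin θ) *
          Φ (r • framePoint e (Real.cos θ) (Real.sin θ * Real.cos ε)
            (Real.sin θ * Real.sin ε)) := by
  have hS : MeasurableSet {a : E3 | 0 < inner ℝ a e} :=
    measurableSet_lt measurable_const (by fun_prop)
  have hm : Measurable fun p : ℝ × ℝ × ℝ => Φ (framePoint e p.1 p.2.1 p.2.2) :=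
    hΦ.comp (continuous_framePoint e).measurable
  rw [← lintegral_indicator hS, lintegral_framePoint e he (hΦ.indicator hS)]
  have e1 : ∀ t x y, {a : E3 | 0 < inner ℝ a e}.indicator Φ (framePoint e t x y) =
      (Set.Ioi 0).indicator (fun t => Φ (framePoint e t x y)) t := by
    intro t x y
    by_cases ht : 0 < t
    · rw [Set.indicator_of_mem, Set.indicator_of_mem (by exact ht)]
      simpa [inner_framePoint e he] using ht
    · rw [Set.indicator_of_notMem, Set.indicator_of_notMem (by exact ht)]
      simpa [inner_framePoint e he] using ht
  have e2 : ∀ t, ∫⁻ x, ∫⁻ y, {a : E3 | 0 < inner ℝ a e}.indicator Φ (framePoint e t x y) =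
      (Set.Ioi 0).indicator (fun t => ∫⁻ x, ∫⁻ y, Φ (framePoint e t x y)) t := by
    intro t
    simp only [e1]
    by_cases ht : t ∈ Set.Ioi (0 : ℝ)
    · simp only [Set.indicator_of_mem ht]
    · simp only [Set.indicator_of_notMem ht, lintegral_zero]
  simp only [e2]
  rw [lintegral_indicator measurableSet_Ioi]
  -- Cylindrical coordinates around `e` come first, then polar coordinates in the quadrant of height
  -- and radius. The two Jacobians `r sin θ` and `r` multiply to `r² sin θ`.
  have e3 : ∀ t, ∫⁻ x, ∫⁻ y, Φ (framePoint e t x y) =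
      ∫⁻ ρ in Set.Ioi (0 : ℝ), ∫⁻ ε in Set.Ioo 0 (2 * Real.pi), ENNReal.ofReal ρ *
        Φ (framePoint e t (ρ * Real.cos ε) (ρ * Real.sin ε)) := fun t =>
    lintegral_polar (G := fun x y => Φ (framePoint e t x y)) (hm.comp measurable_prodMk_left)
  simp only [e3]
  have hm2 : Measurable fun p : (ℝ × ℝ) × ℝ =>
      ENNReal.ofReal p.1.2 * Φ (framePoint e p.1.1 (p.1.2 * Real.cos p.2)
        (p.1.2 * Real.sin p.2)) := by
    have h1 : Measurable fun p : (ℝ × ℝ) × ℝ =>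
      (p.1.1, p.1.2 * Real.cos p.2, p.1.2 * Real.sin p.2) := by fun_prop
    have h2 := hm.comp h1
    have h3 : Measurable fun p : (ℝ × ℝ) × ℝ => ENNReal.ofReal p.1.2 := by fun_prop
    exact h3.mul h2
  have hm3 : Measurable fun p : ℝ × ℝ => ∫⁻ ε in Set.Ioo 0 (2 * Real.pi), ENNReal.ofReal p.2 *
      Φ (framePoint e p.1 (p.2 * Real.cos ε) (p.2 * Real.sin ε)) :=
    Measurable.lintegral_prod_right' (ν := volume.restrict (Set.Ioo 0 (2 * Real.pi))) hm2
  rw [lintegral_polar_quadrant (G := fun t ρ => ∫⁻ ε in Set.Ioo 0 (2 * Real.pi),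
    ENNReal.ofReal ρ * Φ (framePoint e t (ρ * Real.cos ε) (ρ * Real.sin ε))) hm3]
  refine setLIntegral_congr_fun measurableSet_Ioi fun r (hr : 0 < r) => ?_
  refine setLIntegral_congr_fun measurableSet_Ioo fun θ hθ => ?_
  have hs : 0 ≤ Real.sin θ := Real.sin_nonneg_of_nonneg_of_le_pi hθ.1.le
    (by linarith [hθ.2, Real.pi_pos])
  rw [← lintegral_const_mul' _ _ ENNReal.ofReal_ne_top]
  refine lintegral_congr fun ε => ?_
  rw [← mul_assoc, ← ENNReal.ofReal_mul hr.le]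
  congr 2
  · ring
  · simp only [framePoint, smul_add, smul_smul, mul_assoc]

theorem setLIntegral_Ioi_comp_mul {c : ℝ} (hc : 0 < c) {f : ℝ → ℝ≥0∞} (hf : Measurable f) :
    ∫⁻ t in Set.Ioi (0 : ℝ), f t = ENNReal.ofReal c * ∫⁻ s in Set.Ioi (0 : ℝ), f (c * s) := by
  have h := Real.smul_map_volume_mul_left hc.ne'
  rw [abs_of_pos hc] at h
  have hm : Measurable ((Set.Ioi (0 : ℝ)).indicator f) := hf.indicator measurableSet_Ioi
  rw [← lintegral_indicator measurableSet_Ioi, ← lintegral_indicator measurableSet_Ioi]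
  conv_lhs => rw [← h]
  rw [lintegral_smul_measure, lintegral_map hm (measurable_const_mul c), smul_eq_mul]
  congr 1
  refine lintegral_congr fun s => ?_
  by_cases hs : 0 < s
  · rw [Set.indicator_of_mem (by exact mul_pos hc hs), Set.indicator_of_mem (by exact hs)]
  · rw [Set.indicator_of_notMem, Set.indicator_of_notMem (by exact hs)]
    exact fun h' => hs ((mul_pos_iff_of_pos_left hc).1 h')

/-- With `u = τ⁻²` the integrand is `u² e^{-u}`, and `e^u ≥ 1 + u + u²/2` bounds it by `4u/(1 + u) =
4/(1 + τ²)`. The value of the integral is the constant in `lintegral_ray_le`. -/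
theorem lintegral_inv_pow_exp_lt_top :
    ∫⁻ τ in Set.Ioi (0 : ℝ), ENNReal.ofReal ((τ ^ 4)⁻¹ * Real.exp (-(τ⁻¹) ^ 2)) < ∞ := by
  have hi : IntegrableOn (fun r : ℝ => 4 * (1 + r ^ 2)⁻¹) (Set.Ioi 0) :=
    (integrable_inv_one_add_sq.const_mul 4).integrableOn
  refine lt_of_le_of_lt (setLIntegral_mono' measurableSet_Ioi fun τ hτ => ?_) hi.lintegral_lt_top
  have hτ : 0 < τ := hτ
  apply ENNReal.ofReal_le_ofReal
  set u := (τ⁻¹) ^ 2 with hu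
  have hu0 : 0 ≤ u := by positivity
  have e1 : (τ ^ 4)⁻¹ = u ^ 2 := by rw [hu]; field_simp
  have e2 : (1 + τ ^ 2)⁻¹ = u / (1 + u) := by rw [hu]; field_simp; ring
  rw [e1, e2, Real.exp_neg, ← div_eq_mul_inv, div_le_iff₀ (Real.exp_pos _)]
  have h3 : 1 + u + u ^ 2 / 2 ≤ Real.exp u := Real.quadratic_le_exp_of_nonneg hu0
  calc u ^ 2 ≤ 4 * (u / (1 + u)) * (1 + u + u ^ 2 / 2) := by
        rw [show 4 * (u / (1 + u)) * (1 + u + u ^ 2 / 2) = 4 * u * (1 + u + u ^ 2 / 2) / (1 + u) by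
          ring, le_div_iff₀ (by positivity)]
        nlinarith [mul_nonneg hu0 hu0, mul_nonneg hu0 (mul_nonneg hu0 hu0)]
    _ ≤ _ := by gcongr

/-- Averaging ray integrals over all directions produces the weight `|w|⁻²`. -/
theorem lintegral_ray_le :
    ∃ C : ℝ≥0∞, C ≠ ∞ ∧ ∀ φ : E3 → ℝ≥0∞, Measurable φ →
      ∫⁻ a : E3, ENNReal.ofReal (Real.exp (-‖a‖ ^ 2)) *
        ∫⁻ t in Set.Ioi (0 : ℝ), φ (t • (‖a‖⁻¹ • a)) ≤ C * ∫⁻ w, ‖w‖ₑ⁻¹ ^ 2 * φ w := by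
  refine ⟨_, lintegral_inv_pow_exp_lt_top.ne, fun φ hφ => ?_⟩
  have m0 : Measurable fun q : E3 × ℝ => φ (q.2 • q.1) := hφ.comp (by fun_prop)
  refine le_of_eq ?_
  -- Substitute `t = |a| s`, then `w = s a` at fixed `s`, then `s = |w| τ` at fixed `w`. The powers
  -- of `|w|` combine to `|w|⁻²` and the `τ`-integral separates as a constant.
  calc _ = ∫⁻ a : E3, ∫⁻ s in Set.Ioi (0 : ℝ),
        ENNReal.ofReal (Real.exp (-‖a‖ ^ 2) * ‖a‖) * φ (s • a) := by
        refine lintegral_congr_ae ?_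
        filter_upwards [Measure.ae_ne volume (0 : E3)] with a ha
        have ha' : 0 < ‖a‖ := norm_pos_iff.2 ha
        rw [setLIntegral_Ioi_comp_mul ha' (f := fun t => φ (t • (‖a‖⁻¹ • a))) (by fun_prop), ← mul_assoc,
          ← ENNReal.ofReal_mul (Real.exp_nonneg _),
          ← lintegral_const_mul' _ _ ENNReal.ofReal_ne_top]
        refine lintegral_congr fun s => ?_
        rw [smul_smul, mul_right_comm, mul_inv_cancel₀ ha'.ne', one_mul]
    _ = ∫⁻ s in Set.Ioi (0 : ℝ), ∫⁻ a : E3,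
        ENNReal.ofReal (Real.exp (-‖a‖ ^ 2) * ‖a‖) * φ (s • a) := by
        refine lintegral_lintegral_swap (Measurable.aemeasurable ?_)
        exact (by fun_prop : Measurable fun q : E3 × ℝ =>
          ENNReal.ofReal (Real.exp (-‖q.1‖ ^ 2) * ‖q.1‖)).mul m0
    _ = ∫⁻ s in Set.Ioi (0 : ℝ), ∫⁻ w : E3, ENNReal.ofReal
        ((s ^ 3)⁻¹ * (Real.exp (-‖s⁻¹ • w‖ ^ 2) * ‖s⁻¹ • w‖)) * φ w := by
        refine setLIntegral_congr_fun measurableSet_Ioi fun s (hs : 0 < s) => ?_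
        have h := lintegral_comp_smul_E3 (fun w : E3 => ENNReal.ofReal
          (Real.exp (-‖s⁻¹ • w‖ ^ 2) * ‖s⁻¹ • w‖) * φ w) hs (by fun_prop)
        simp only [inv_smul_smul₀ hs.ne'] at h
        rw [h, ← lintegral_const_mul' _ _ ENNReal.ofReal_ne_top]
        refine lintegral_congr fun w => ?_
        rw [ENNReal.ofReal_mul (p := (s ^ 3)⁻¹) (by positivity), mul_assoc]
    _ = ∫⁻ w : E3, ∫⁻ s in Set.Ioi (0 : ℝ), ENNReal.ofReal
        ((s ^ 3)⁻¹ * (Real.exp (-‖s⁻¹ • w‖ ^ 2) * ‖s⁻¹ • w‖)) * φ w := by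
        refine lintegral_lintegral_swap (Measurable.aemeasurable ?_)
        simp only [Function.uncurry_def]
        fun_prop
    _ = _ := by
        rw [← lintegral_const_mul _ (by fun_prop)]
        refine lintegral_congr_ae ?_
        filter_upwards [Measure.ae_ne volume (0 : E3)] with w hw
        have hw' : 0 < ‖w‖ := norm_pos_iff.2 hw
        rw [lintegral_mul_const _ (by fun_prop), ← mul_assoc]
        congr 1
        rw [setLIntegral_Ioi_comp_mul hw' (by fun_prop), mul_comm (∫⁻ _ in _, _), ← ofReal_norm,
          ← ENNReal.ofReal_inv_of_pos hw', ← ENNReal.ofReal_pow (by positivity),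
          ← lintegral_const_mul' _ _ ENNReal.ofReal_ne_top,
          ← lintegral_const_mul' _ _ ENNReal.ofReal_ne_top]
        refine setLIntegral_congr_fun measurableSet_Ioi fun s (hs : 0 < s) => ?_
        rw [← ENNReal.ofReal_mul (by positivity), ← ENNReal.ofReal_mul (by positivity)]
        congr 1
        have : ‖(‖w‖ * s)⁻¹ • w‖ = s⁻¹ := by
          rw [norm_smul, norm_inv, norm_mul, norm_norm, Real.norm_of_nonneg hs.le]
          field_simp
        rw [this]
        field_simp

/-! ### Grad's estimate for the gain and loss terms -/

/-- The gain integrand in terms of the relative velocity `V` and the direction `u`. -/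
noncomputable def gainDensity (γ : ℝ) (g : E3 → ℝ≥0∞) (v V u : E3) : ℝ≥0∞ :=
  ENNReal.ofReal (‖V‖ ^ (γ - 1) * inner ℝ V u * Real.exp (-‖v + V‖ ^ 2 / 2) *
    Real.exp (-‖v + V - inner ℝ V u • u‖ ^ 2 / 2)) * g (v + inner ℝ V u • u)

/-- Only an inequality because of `x = 0`: for `s > 0` the real power `0 ^ (-s)` is `0` by
convention, the extended one is `∞`. -/
theorem ofReal_rpow_le (x : E3) {s : ℝ} (hs : 0 ≤ s) :
    ENNReal.ofReal (‖x‖ ^ (-s)) ≤ ‖x‖ₑ ^ (-s) := by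
  rcases eq_or_ne x 0 with rfl | hx
  · rcases hs.eq_or_lt with rfl | hs
    · simp
    · simp [hs]
  · rw [← ofReal_norm, ENNReal.ofReal_rpow_of_pos (norm_pos_iff.2 hx)]

/-- In the frame of `u` the argument of `g` depends on `t = V·u` alone, so the two transverse
coordinates of `V` integrate out. There `|V|^{γ-1}` is split into a power `-(1-γ)/2 > -1` of each
coordinate, and the two Gaussians multiply to a full one in `q + x` and `r + y`, whose centre does
not affect the bound. -/
theorem lintegral_gainDensity_le {γ : ℝ} (hγ0 : 0 ≤ γ) (hγ1 : γ ≤ 1) :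
    ∃ C : ℝ≥0∞, C ≠ ∞ ∧ ∀ (v u : E3) (g : E3 → ℝ≥0∞), ‖u‖ = 1 → Measurable g →
      ∫⁻ V in {V : E3 | 0 < inner ℝ V u}, gainDensity γ g v V u ≤
        C * ∫⁻ t in Set.Ioi (0 : ℝ), ENNReal.ofReal (t * Real.exp (-t ^ 2 / 4)) *
          g (v + t • u) := by
  obtain ⟨C, hC, b⟩ := lintegral_rpow_rpow_exp_le (a := (1 - γ) / 2) (b := 0) (c := 1)
    (by linarith) le_rfl (by linarith) one_pos
  refine ⟨C * C, ENNReal.mul_ne_top hC hC, fun v u g hu hg => ?_⟩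
  have hS : MeasurableSet {V : E3 | 0 < inner ℝ V u} :=
    measurableSet_lt measurable_const (by fun_prop)
  have hm : Measurable fun V => gainDensity γ g v V u := by
    unfold gainDensity; fun_prop
  obtain ⟨p, q, r, rfl⟩ := exists_framePoint u hu v
  set v := framePoint u p q r
  rw [← lintegral_indicator hS, lintegral_framePoint u hu (hm.indicator hS),
    ← lintegral_indicator measurableSet_Ioi, ← lintegral_const_mul _
    (by exact (Measurable.indicator (by fun_prop) measurableSet_Ioi))]
  refine lintegral_mono fun t => ?_
  by_cases ht : t ∈ Set.Ioi (0 : ℝ)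
  swap
  · rw [Set.indicator_of_notMem ht, mul_zero, nonpos_iff_eq_zero]
    have : ∀ x y, {V : E3 | 0 < inner ℝ V u}.indicator (fun V => gainDensity γ g v V u)
        (framePoint u t x y) = 0 := fun x y =>
      Set.indicator_of_notMem (by simpa [inner_framePoint u hu] using ht) _
    simp [this]
  rw [Set.indicator_of_mem ht]
  have ht : 0 < t := ht
  set F : ℝ → ℝ → ℝ≥0∞ := fun z x => ‖x‖ₑ ^ (-((1 - γ) / 2)) * ‖-z - x‖ₑ ^ (-(0 : ℝ)) *
    ENNReal.ofReal (Real.exp (-1 * (-z - x) ^ 2)) with hF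
  have key : ∀ x y, {V : E3 | 0 < inner ℝ V u}.indicator (fun V => gainDensity γ g v V u)
      (framePoint u t x y) ≤
      (ENNReal.ofReal (t * Real.exp (-t ^ 2 / 4)) * g (v + t • u)) * (F q x * F r y) := by
    intro x y
    rw [Set.indicator_of_mem (by simpa [inner_framePoint u hu] using ht), gainDensity,
      inner_framePoint u hu]
    have e1 : v + framePoint u t x y = framePoint u (p + t) (q + x) (r + y) := framePoint_add ..
    have e2 : v + framePoint u t x y - t • u = framePoint u p (q + x) (r + y) := by
      rw [e1]; simp only [framePoint]; module
    have hexp : Real.exp (-‖v + framePoint u t x y‖ ^ 2 / 2) *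
        Real.exp (-‖v + framePoint u t x y - t • u‖ ^ 2 / 2) ≤
        Real.exp (-t ^ 2 / 4) * (Real.exp (-1 * (-q - x) ^ 2) *
          Real.exp (-1 * (-r - y) ^ 2)) := by
      rw [e2, e1, norm_sq_framePoint u hu, norm_sq_framePoint u hu, ← Real.exp_add,
        ← Real.exp_add, ← Real.exp_add]
      apply Real.exp_le_exp.2
      -- Along `u` the exponents satisfy `(p + t)² + p² = t²/2 + (2p + t)²/2 ≥ t²/2`, the source of
      -- `exp(-t²/4)`.
      nlinarith [sq_nonneg (2 * p + t)]
    have hpow : ENNReal.ofReal (‖framePoint u t x y‖ ^ (γ - 1)) ≤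
        ‖x‖ₑ ^ (-((1 - γ) / 2)) * ‖y‖ₑ ^ (-((1 - γ) / 2)) := by
      obtain ⟨-, hx, hy⟩ := abs_coord_le_norm_framePoint u hu t x y
      rw [show γ - 1 = -(1 - γ) by ring]
      refine (ofReal_rpow_le _ (by linarith)).trans ?_
      rw [show -(1 - γ) = -((1 - γ) / 2 + (1 - γ) / 2) by ring,
        rpow_neg_add (by simp) (by linarith) (by linarith)]
      exact mul_le_mul' (rpow_neg_anti hx (by linarith)) (rpow_neg_anti hy (by linarith))
    calc _ ≤ ENNReal.ofReal (‖framePoint u t x y‖ ^ (γ - 1) * (t * (Real.exp (-t ^ 2 / 4) *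
          (Real.exp (-1 * (-q - x) ^ 2) * Real.exp (-1 * (-r - y) ^ 2))))) * g (v + t • u) := by
          refine mul_le_mul' (ENNReal.ofReal_le_ofReal ?_) le_rfl
          rw [mul_assoc (_ * t), mul_assoc]
          gcongr
      _ = ENNReal.ofReal (‖framePoint u t x y‖ ^ (γ - 1)) *
          (ENNReal.ofReal (t * Real.exp (-t ^ 2 / 4)) * (ENNReal.ofReal
          (Real.exp (-1 * (-q - x) ^ 2)) * ENNReal.ofReal (Real.exp (-1 * (-r - y) ^ 2)))) *
          g (v + t • u) := by
          rw [ENNReal.ofReal_mul (by positivity), ← mul_assoc t, ENNReal.ofReal_mul (by positivity),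
            ENNReal.ofReal_mul (Real.exp_nonneg _)]
      _ ≤ _ * _ * _ := mul_le_mul' (mul_le_mul' hpow le_rfl) le_rfl
      _ = _ := by
          simp only [hF, neg_zero, ENNReal.rpow_zero, mul_one]
          ring
  calc _ ≤ ∫⁻ x, ∫⁻ y, (ENNReal.ofReal (t * Real.exp (-t ^ 2 / 4)) * g (v + t • u)) *
        (F q x * F r y) := lintegral_mono fun x => lintegral_mono fun y => key x y
    _ = (ENNReal.ofReal (t * Real.exp (-t ^ 2 / 4)) * g (v + t • u)) *
        ((∫⁻ x, F q x) * ∫⁻ y, F r y) := by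
        have m : ∀ z, Measurable (F z) := fun z => by simp only [hF]; fun_prop
        have e1 : ∀ x, ∫⁻ y, (ENNReal.ofReal (t * Real.exp (-t ^ 2 / 4)) * g (v + t • u)) *
            (F q x * F r y) = (ENNReal.ofReal (t * Real.exp (-t ^ 2 / 4)) * g (v + t • u)) *
            (F q x * ∫⁻ y, F r y) := fun x => by
          rw [lintegral_const_mul _ ((m r).const_mul _), lintegral_const_mul _ (m r)]
        simp only [e1]
        rw [lintegral_const_mul _ ((m q).mul_const _), lintegral_mul_const _ (m q)]
    _ ≤ (ENNReal.ofReal (t * Real.exp (-t ^ 2 / 4)) * g (v + t • u)) * (C * C) :=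
        mul_le_mul' le_rfl (mul_le_mul' (b (-q)) (b (-r)))
    _ = _ := mul_comm _ _

theorem lintegral_collMeasure {F : E3 × ℝ × ℝ → ℝ≥0∞} (hF : Measurable F) :
    ∫⁻ p, F p ∂collMeasure = ∫⁻ vs, ∫⁻ θ in Set.Ioo 0 (Real.pi / 2),
      ∫⁻ ε in Set.Ioo 0 (2 * Real.pi), F (vs, ε, θ) := by
  rw [collMeasure, lintegral_prod _ hF.aemeasurable]
  refine lintegral_congr fun vs => ?_
  rw [lintegral_prod_symm]
  exact (hF.comp measurable_prodMk_left).aemeasurable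

theorem ae_collMeasure_ne (v : E3) : ∀ᵐ p ∂collMeasure, p.1 ≠ v :=
  Measure.quasiMeasurePreserving_fst.ae (Measure.ae_ne volume v)

theorem ae_collMeasure_mem :
    ∀ᵐ p ∂collMeasure, p.2.1 ∈ Set.Ioo 0 (2 * Real.pi) ∧ p.2.2 ∈ Set.Ioo 0 (Real.pi / 2) := by
  have h : ∀ᵐ q ∂((volume.restrict (Set.Ioo 0 (2 * Real.pi))).prod
      (volume.restrict (Set.Ioo (0 : ℝ) (Real.pi / 2)))),
      q.1 ∈ Set.Ioo 0 (2 * Real.pi) ∧ q.2 ∈ Set.Ioo 0 (Real.pi / 2) := by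
    rw [Measure.prod_restrict]
    filter_upwards [ae_restrict_mem (measurableSet_Ioo.prod measurableSet_Ioo)] with q hq using hq
  exact Measure.quasiMeasurePreserving_snd.ae h

/-- Grad's cutoff bound `|v - v_*|^γ cos θ sin θ`. -/
noncomputable def cutoffWeight (γ : ℝ) (v : E3) (p : E3 × ℝ × ℝ) : ℝ :=
  ‖v - p.1‖ ^ γ * Real.cos p.2.2 * Real.sin p.2.2

/-- The square root of the Maxwellian, up to a constant. -/
noncomputable def halfGauss (v : E3) : ℝ := Real.exp (-‖v‖ ^ 2 / 2)

@[fun_prop]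
theorem measurable_halfGauss : Measurable halfGauss := by unfold halfGauss; fun_prop

theorem halfGauss_pos (v : E3) : 0 < halfGauss v := Real.exp_pos _

@[fun_prop]
theorem Measurable.postV' {α : Type*} [MeasurableSpace α] {a b : α → E3} {c d : α → ℝ}
    (ha : Measurable a) (hb : Measurable b) (hc : Measurable c) (hd : Measurable d) :
    Measurable fun x => postV (a x) (b x) (c x) (d x) :=
  measurable_postV.comp (ha.prodMk (hb.prodMk (hc.prodMk hd)))

@[fun_prop]
theorem Measurable.postVs' {α : Type*} [MeasurableSpace α] {a b : α → E3} {c d : α → ℝ}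
    (ha : Measurable a) (hb : Measurable b) (hc : Measurable c) (hd : Measurable d) :
    Measurable fun x => postVs (a x) (b x) (c x) (d x) :=
  measurable_postVs.comp (ha.prodMk (hb.prodMk (hc.prodMk hd)))

/-- The gain integrand weighting the value of `g` at `v'`. -/
noncomputable def gainV (γ : ℝ) (g : E3 → ℝ≥0∞) (v : E3) (p : E3 × ℝ × ℝ) : ℝ≥0∞ :=
  ENNReal.ofReal (cutoffWeight γ v p * halfGauss p.1 * halfGauss (postVs v p.1 p.2.1 p.2.2)) *
    g (postV v p.1 p.2.1 p.2.2)

/-- The gain integrand weighting the value of `g` at `v'_*`. -/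
noncomputable def gainVs (γ : ℝ) (g : E3 → ℝ≥0∞) (v : E3) (p : E3 × ℝ × ℝ) : ℝ≥0∞ :=
  ENNReal.ofReal (cutoffWeight γ v p * halfGauss p.1 * halfGauss (postV v p.1 p.2.1 p.2.2)) *
    g (postVs v p.1 p.2.1 p.2.2)

theorem measurable_gainV (γ : ℝ) {g : E3 → ℝ≥0∞} (hg : Measurable g) (v : E3) :
    Measurable (gainV γ g v) := by
  unfold gainV cutoffWeight; fun_prop

theorem measurable_gainVs (γ : ℝ) {g : E3 → ℝ≥0∞} (hg : Measurable g) (v : E3) :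
    Measurable (gainVs γ g v) := by
  unfold gainVs cutoffWeight; fun_prop

/-- The map `(ε, θ) ↦ (ε + π, π/2 - θ)` exchanges the outgoing velocities and fixes the weight `cos
θ sin θ`, so only one gain term needs an estimate. The symmetry belongs to the cutoff bound and not
to `B` itself, which is why it is applied after domination. -/
theorem lintegral_gainVs_eq (γ : ℝ) {g : E3 → ℝ≥0∞} (hg : Measurable g) (v : E3) :
    ∫⁻ p, gainVs γ g v p ∂collMeasure = ∫⁻ p, gainV γ g v p ∂collMeasure := by
  rw [lintegral_collMeasure (measurable_gainVs γ hg v),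
    lintegral_collMeasure (measurable_gainV γ hg v)]
  refine lintegral_congr_ae ?_
  filter_upwards [Measure.ae_ne volume v] with vs hvs
  have e1 : ∀ ε θ, gainVs γ g v (vs, ε, θ) =
      gainV γ g v (vs, ε + Real.pi, Real.pi / 2 - θ) := by
    intro ε θ
    simp only [gainVs, gainV, cutoffWeight, postV_swap hvs, postVs_swap hvs,
      Real.cos_pi_div_two_sub, Real.sin_pi_div_two_sub]
    congr 2
    ring
  simp only [e1]
  have hper : ∀ θ, Function.Periodic (fun ε => gainV γ g v (vs, ε, θ)) (2 * Real.pi) := by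
    intro θ ε
    simp only [gainV, postV, postVs, scatterDir, cutoffWeight, Real.cos_add_two_pi,
      Real.sin_add_two_pi]
  have e2 : ∀ θ, ∫⁻ ε in Set.Ioo 0 (2 * Real.pi), gainV γ g v (vs, ε + Real.pi, θ) =
      ∫⁻ ε in Set.Ioo 0 (2 * Real.pi), gainV γ g v (vs, ε, θ) := by
    intro θ
    rw [← setLIntegral_periodic (hper θ) Real.pi]
    have h := (measurePreserving_add_right (volume : Measure ℝ) Real.pi).setLIntegral_comp_emb
      (measurableEmbedding_addRight Real.pi) (fun ε => gainV γ g v (vs, ε, θ))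
      (Set.Ioo 0 (2 * Real.pi))
    rw [Set.image_add_const_Ioo, zero_add, add_comm (2 * Real.pi)] at h
    exact h
  simp only [e2]
  have h := (Measure.measurePreserving_sub_left (volume : Measure ℝ)
    (Real.pi / 2)).setLIntegral_comp_emb (MeasurableEquiv.subLeft (Real.pi / 2)).measurableEmbedding
      (fun θ => ∫⁻ ε in Set.Ioo 0 (2 * Real.pi), gainV γ g v (vs, ε, θ)) (Set.Ioo 0 (Real.pi / 2))
  rw [Set.image_const_sub_Ioo, sub_zero, sub_self] at h
  exact h

/-- Finite and nonzero, so this normalization can be divided out at the end. -/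
theorem lintegral_sq_exp_ne :
    (∫⁻ r in Set.Ioi (0 : ℝ), ENNReal.ofReal (r ^ 2 * Real.exp (-r ^ 2))) ≠ 0 ∧
    (∫⁻ r in Set.Ioi (0 : ℝ), ENNReal.ofReal (r ^ 2 * Real.exp (-r ^ 2))) ≠ ∞ := by
  constructor
  · rw [← pos_iff_ne_zero, setLIntegral_pos_iff (by fun_prop)]
    refine lt_of_lt_of_le (?_ : 0 < volume (Set.Ioi (0 : ℝ))) (measure_mono fun r hr => ⟨?_, hr⟩)
    · simp
    · have hr : 0 < r := hr
      simp only [Function.mem_support, ne_eq, ENNReal.ofReal_eq_zero, not_le]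
      positivity
  · have h : IntegrableOn (fun r : ℝ => r ^ 2 * Real.exp (-r ^ 2)) (Set.Ioi 0) := by
      have := integrable_rpow_mul_exp_neg_mul_sq (b := 1) one_pos (s := 2) (by norm_num)
      simpa using this.integrableOn
    exact h.lintegral_lt_top.ne

/-- An auxiliary radius `r` with weight `r² e^{-r²}` turns the angular integral over the hemisphere
into a Gaussian integral over vectors `a` whose direction is the collision direction. Both variables
then range over `ℝ³` and Tonelli can exchange them, with no surface measure. The factor `sin θ` of
the cutoff is the spherical Jacobian, and `|V|^γ cos θ = |V|^{γ-1} (V·u)`. -/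
theorem lintegral_gainV_eq (γ : ℝ) {g : E3 → ℝ≥0∞} (hg : Measurable g) (v : E3) :
    (∫⁻ r in Set.Ioi (0 : ℝ), ENNReal.ofReal (r ^ 2 * Real.exp (-r ^ 2))) *
      ∫⁻ p, gainV γ g v p ∂collMeasure =
    ∫⁻ V, ∫⁻ a in {a : E3 | 0 < inner ℝ a V}, ENNReal.ofReal (Real.exp (-‖a‖ ^ 2)) *
      gainDensity γ g v V (‖a‖⁻¹ • a) := by
  rw [lintegral_collMeasure (measurable_gainV γ hg v)]
  rw [← lintegral_sub_right_eq_self (fun V => ∫⁻ a in {a : E3 | 0 < inner ℝ a V},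
    ENNReal.ofReal (Real.exp (-‖a‖ ^ 2)) * gainDensity γ g v V (‖a‖⁻¹ • a)) v,
    ← lintegral_const_mul' _ _ lintegral_sq_exp_ne.2]
  refine lintegral_congr_ae ?_
  filter_upwards [Measure.ae_ne volume v] with vs hvs
  have he := norm_relDir hvs
  have hV : 0 < ‖vs - v‖ := norm_pos_iff.2 (sub_ne_zero.2 hvs)
  have hset : {a : E3 | 0 < inner ℝ a (vs - v)} = {a : E3 | 0 < inner ℝ a (relDir v vs)} := by
    ext a
    simp only [Set.mem_ofPred_eq]
    rw [← norm_smul_relDir hvs, real_inner_smul_right, mul_pos_iff_of_pos_left hV]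
  have hm : Measurable fun a : E3 => ENNReal.ofReal (Real.exp (-‖a‖ ^ 2)) *
      gainDensity γ g v (vs - v) (‖a‖⁻¹ • a) := by
    unfold gainDensity; fun_prop
  rw [hset, lintegral_spherical _ he hm,
    ← lintegral_mul_const _ (by fun_prop)]
  refine setLIntegral_congr_fun measurableSet_Ioi fun r (hr : 0 < r) => ?_
  rw [← lintegral_const_mul' _ _ ENNReal.ofReal_ne_top]
  refine setLIntegral_congr_fun measurableSet_Ioo fun θ hθ => ?_
  rw [← lintegral_const_mul' _ _ ENNReal.ofReal_ne_top]
  refine lintegral_congr fun ε => ?_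
  have hs : 0 ≤ Real.sin θ := Real.sin_nonneg_of_nonneg_of_le_pi hθ.1.le
    (by linarith [hθ.2, Real.pi_pos])
  have hc : 0 ≤ Real.cos θ := Real.cos_nonneg_of_mem_Icc
    ⟨by linarith [hθ.1, Real.pi_pos], hθ.2.le⟩
  rw [← scatterDir_eq_framePoint]
  have h1 := norm_scatterDir hvs ε θ
  have h2 : ‖r • scatterDir v vs ε θ‖ = r := by
    rw [norm_smul, h1, mul_one, Real.norm_of_nonneg hr.le]
  rw [h2, smul_smul, inv_mul_cancel₀ hr.ne', one_smul, gainV, gainDensity, ← mul_assoc, ← mul_assoc,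
    ← mul_assoc]
  have h3 : v + (vs - v) - inner ℝ (vs - v) (scatterDir v vs ε θ) • scatterDir v vs ε θ =
      postVs v vs ε θ := by simp [postVs]
  rw [h3, add_sub_cancel]
  have h4 : v + inner ℝ (vs - v) (scatterDir v vs ε θ) • scatterDir v vs ε θ = postV v vs ε θ := rfl
  rw [h4, inner_scatterDir hvs, ← ENNReal.ofReal_mul (by positivity),
    ← ENNReal.ofReal_mul (by positivity), ← ENNReal.ofReal_mul (by positivity)]
  congr 2
  simp only [cutoffWeight, halfGauss]
  rw [norm_sub_rev v vs, show ‖vs - v‖ ^ γ = ‖vs - v‖ ^ (γ - 1) * ‖vs - v‖ by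
    rw [← Real.rpow_add_one hV.ne']; ring_nf]
  ring

theorem ray_weight_le (w : E3) :
    ‖w‖ₑ⁻¹ ^ 2 * ENNReal.ofReal (‖w‖ * Real.exp (-‖w‖ ^ 2 / 4)) ≤ gradKernel w := by
  rcases eq_or_ne w 0 with rfl | hw
  · simp
  have hw' : 0 < ‖w‖ := norm_pos_iff.2 hw
  rw [gradKernel_eq_ofReal hw, ← ofReal_norm, ← ENNReal.ofReal_inv_of_pos hw',
    ← ENNReal.ofReal_pow (by positivity), ← ENNReal.ofReal_mul (by positivity)]
  apply ENNReal.ofReal_le_ofReal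
  rw [show ‖w‖⁻¹ ^ 2 * (‖w‖ * Real.exp (-‖w‖ ^ 2 / 4)) = ‖w‖⁻¹ * Real.exp (-‖w‖ ^ 2 / 4) by
    field_simp]
  have : -‖w‖ ^ 2 / 4 ≤ -‖w‖ ^ 2 / 8 := by nlinarith [sq_nonneg ‖w‖]
  gcongr

/-- The gain terms are dominated by convolution with `gradKernel`. -/
theorem lintegral_gainV_le {γ : ℝ} (hγ0 : 0 ≤ γ) (hγ1 : γ ≤ 1) :
    ∃ C : ℝ≥0∞, C ≠ ∞ ∧ ∀ (v : E3) (g : E3 → ℝ≥0∞), Measurable g →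
      ∫⁻ p, gainV γ g v p ∂collMeasure ≤ C * ∫⁻ w, gradKernel (v - w) * g w := by
  obtain ⟨C1, hC1, b1⟩ := lintegral_ray_le
  obtain ⟨C2, hC2, b2⟩ := lintegral_gainDensity_le hγ0 hγ1
  obtain ⟨hc0, hc⟩ := lintegral_sq_exp_ne
  set c := ∫⁻ r in Set.Ioi (0 : ℝ), ENNReal.ofReal (r ^ 2 * Real.exp (-r ^ 2))
  refine ⟨c⁻¹ * (C2 * C1), ENNReal.mul_ne_top (ENNReal.inv_ne_top.2 hc0)
    (ENNReal.mul_ne_top hC2 hC1), fun v g hg => ?_⟩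
  have key : c * ∫⁻ p, gainV γ g v p ∂collMeasure ≤
      (C2 * C1) * ∫⁻ w, gradKernel (v - w) * g w := by
    rw [lintegral_gainV_eq γ hg v]
    have hS : MeasurableSet {q : E3 × E3 | 0 < inner ℝ q.2 q.1} :=
      measurableSet_lt measurable_const (by fun_prop)
    have hm : Measurable fun q : E3 × E3 => ENNReal.ofReal (Real.exp (-‖q.2‖ ^ 2)) *
        gainDensity γ g v q.1 (‖q.2‖⁻¹ • q.2) := by
      unfold gainDensity; fun_prop
    have hm2 := hm.indicator hS
    have e1 : ∀ V, ∫⁻ a in {a : E3 | 0 < inner ℝ a V}, ENNReal.ofReal (Real.exp (-‖a‖ ^ 2)) *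
        gainDensity γ g v V (‖a‖⁻¹ • a) = ∫⁻ a, {q : E3 × E3 | 0 < inner ℝ q.2 q.1}.indicator
        (fun q : E3 × E3 => ENNReal.ofReal (Real.exp (-‖q.2‖ ^ 2)) *
        gainDensity γ g v q.1 (‖q.2‖⁻¹ • q.2)) (V, a) := by
      intro V
      rw [← lintegral_indicator (measurableSet_lt measurable_const (by fun_prop))]
      rfl
    simp only [e1]
    -- The decisive exchange: at fixed direction `a/|a|` the relative velocity is integrated first,
    -- over the half space `V·a > 0`.
    rw [lintegral_lintegral_swap (f := fun V a => {q : E3 × E3 | 0 < inner ℝ q.2 q.1}.indicator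
        (fun q : E3 × E3 => ENNReal.ofReal (Real.exp (-‖q.2‖ ^ 2)) *
        gainDensity γ g v q.1 (‖q.2‖⁻¹ • q.2)) (V, a)) hm2.aemeasurable]
    set φ : E3 → ℝ≥0∞ := fun w => ENNReal.ofReal (‖w‖ * Real.exp (-‖w‖ ^ 2 / 4)) * g (v + w)
    have hφ : Measurable φ := by fun_prop
    calc _ ≤ ∫⁻ a : E3, C2 * (ENNReal.ofReal (Real.exp (-‖a‖ ^ 2)) *
          ∫⁻ t in Set.Ioi (0 : ℝ), φ (t • (‖a‖⁻¹ • a))) := by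
          refine lintegral_mono_ae ?_
          filter_upwards [Measure.ae_ne volume (0 : E3)] with a ha
          have ha' : 0 < ‖a‖ := norm_pos_iff.2 ha
          have hu : ‖(‖a‖⁻¹ • a)‖ = 1 := by
            rw [norm_smul, norm_inv, norm_norm, inv_mul_cancel₀ ha'.ne']
          have h := b2 v (‖a‖⁻¹ • a) g hu hg
          have hset : {V : E3 | 0 < inner ℝ V (‖a‖⁻¹ • a)} = {V : E3 | 0 < inner ℝ a V} := by
            ext V
            simp only [Set.mem_ofPred_eq]
            rw [real_inner_smul_right, mul_pos_iff_of_pos_left (inv_pos.2 ha'), real_inner_comm]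
          rw [hset] at h
          have e2 : ∀ t ∈ Set.Ioi (0 : ℝ), ENNReal.ofReal (t * Real.exp (-t ^ 2 / 4)) *
              g (v + t • (‖a‖⁻¹ • a)) = φ (t • (‖a‖⁻¹ • a)) := by
            intro t ht
            simp only [φ]
            rw [norm_smul t, hu, mul_one, Real.norm_of_nonneg (le_of_lt ht)]
          rw [setLIntegral_congr_fun measurableSet_Ioi e2] at h
          calc _ = ENNReal.ofReal (Real.exp (-‖a‖ ^ 2)) * ∫⁻ V in {V : E3 | 0 < inner ℝ a V},
                gainDensity γ g v V (‖a‖⁻¹ • a) := by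
                rw [← lintegral_const_mul' _ _ ENNReal.ofReal_ne_top,
                  ← lintegral_indicator (measurableSet_lt measurable_const (by fun_prop))]
                rfl
            _ ≤ ENNReal.ofReal (Real.exp (-‖a‖ ^ 2)) * _ := mul_le_mul' le_rfl h
            _ = _ := by ring
      _ = C2 * ∫⁻ a : E3, (ENNReal.ofReal (Real.exp (-‖a‖ ^ 2)) *
          ∫⁻ t in Set.Ioi (0 : ℝ), φ (t • (‖a‖⁻¹ • a))) := lintegral_const_mul' _ _ hC2
      _ ≤ C2 * (C1 * ∫⁻ w, ‖w‖ₑ⁻¹ ^ 2 * φ w) := mul_le_mul' le_rfl (b1 φ hφ)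
      _ ≤ C2 * (C1 * ∫⁻ w, gradKernel w * g (v + w)) := by
          refine mul_le_mul' le_rfl (mul_le_mul' le_rfl (lintegral_mono fun w => ?_))
          simp only [φ]
          rw [← mul_assoc]
          exact mul_le_mul' (ray_weight_le w) le_rfl
      _ = _ := by
          rw [mul_assoc, ← lintegral_add_left_eq_self (fun w => gradKernel (v - w) * g w) v]
          congr 3
          funext w
          rw [sub_add_cancel_left, gradKernel_neg]
  calc _ = c⁻¹ * (c * ∫⁻ p, gainV γ g v p ∂collMeasure) := by
        rw [← mul_assoc, ENNReal.inv_mul_cancel hc0 hc, one_mul]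
    _ ≤ c⁻¹ * ((C2 * C1) * ∫⁻ w, gradKernel (v - w) * g w) := mul_le_mul' le_rfl key
    _ = _ := (mul_assoc _ _ _).symm

/-- The loss term in `v_*` is dominated by convolution with `gradKernel`. -/
theorem lintegral_loss_le {γ : ℝ} (hγ0 : 0 ≤ γ) (hγ1 : γ ≤ 1) :
    ∃ C : ℝ≥0∞, C ≠ ∞ ∧ ∀ (v : E3) (g : E3 → ℝ≥0∞), Measurable g →
      ∫⁻ p, ENNReal.ofReal (cutoffWeight γ v p * halfGauss p.1 * halfGauss v) * g p.1
        ∂collMeasure ≤ C * ∫⁻ w, gradKernel (v - w) * g w := by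
  set c := ∫⁻ _ in Set.Ioo 0 (Real.pi / 2), ∫⁻ _ in Set.Ioo 0 (2 * Real.pi), (8 : ℝ≥0∞)
  have hc : c ≠ ∞ := by
    simp only [c, lintegral_const, Measure.restrict_apply MeasurableSet.univ, Set.univ_inter,
      Real.volume_Ioo]
    exact ENNReal.mul_ne_top (ENNReal.mul_ne_top (by simp) ENNReal.ofReal_ne_top)
      ENNReal.ofReal_ne_top
  refine ⟨c, hc, fun v g hg => ?_⟩
  rw [lintegral_collMeasure (by unfold cutoffWeight; fun_prop),
    ← lintegral_const_mul _ (by fun_prop)]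
  refine lintegral_mono_ae ?_
  filter_upwards [Measure.ae_ne volume v] with w hw
  have hr : 0 < ‖v - w‖ := norm_pos_iff.2 (sub_ne_zero.2 hw.symm)
  have key : ∀ θ ε, ENNReal.ofReal (cutoffWeight γ v (w, ε, θ) * halfGauss w * halfGauss v) ≤
      8 * gradKernel (v - w) := by
    intro θ ε
    rw [gradKernel_eq_ofReal (sub_ne_zero.2 hw.symm), show (8 : ℝ≥0∞) = ENNReal.ofReal 8 by simp,
      ← ENNReal.ofReal_mul (by norm_num)]
    apply ENNReal.ofReal_le_ofReal
    set r := ‖v - w‖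
    have hcs : Real.cos θ * Real.sin θ ≤ 1 := by
      nlinarith [sq_nonneg (Real.cos θ - Real.sin θ), Real.sin_sq_add_cos_sq θ]
    -- Since `|v|² + |w|² ≥ |v - w|²/2`, the Gaussians give `exp(-r²/4)`. Half of the exponent is
    -- kept for the kernel; the other half absorbs `r^{γ+1} ≤ 1 + r² ≤ 8 (1 + r²/8) ≤ 8 exp(r²/8)`.
    have hM : halfGauss w * halfGauss v ≤ Real.exp (-r ^ 2 / 8) * Real.exp (-r ^ 2 / 8) := by
      rw [halfGauss, halfGauss, ← Real.exp_add, ← Real.exp_add]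
      apply Real.exp_le_exp.2
      have := parallelogram_law_with_norm ℝ v w
      nlinarith [sq_nonneg ‖v + w‖]
    have hrγ : r ^ γ * r ≤ 1 + r ^ 2 := by
      rw [← Real.rpow_add_one hr.ne']
      rcases le_total r 1 with h | h
      · have := Real.rpow_le_one hr.le h (by linarith : 0 ≤ γ + 1)
        nlinarith
      · have := Real.rpow_le_rpow_of_exponent_le h (by linarith : γ + 1 ≤ 2)
        rw [Real.rpow_two] at this
        linarith
    have hexp : r ^ γ * r * Real.exp (-r ^ 2 / 8) ≤ 8 := by
      have h1 := Real.add_one_le_exp (r ^ 2 / 8)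
      rw [neg_div, Real.exp_neg, ← div_eq_mul_inv, div_le_iff₀ (Real.exp_pos _)]
      nlinarith
    calc cutoffWeight γ v (w, ε, θ) * halfGauss w * halfGauss v
        = r ^ γ * (Real.cos θ * Real.sin θ) * (halfGauss w * halfGauss v) := by
          simp only [cutoffWeight]; ring
      _ ≤ r ^ γ * 1 * (Real.exp (-r ^ 2 / 8) * Real.exp (-r ^ 2 / 8)) := by
          have := halfGauss_pos w
          have := halfGauss_pos v
          gcongr
      _ = (r ^ γ * r * Real.exp (-r ^ 2 / 8)) * (r⁻¹ * Real.exp (-r ^ 2 / 8)) := by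
          field_simp
      _ ≤ _ := by gcongr
  calc _ ≤ ∫⁻ θ in Set.Ioo 0 (Real.pi / 2), ∫⁻ ε in Set.Ioo 0 (2 * Real.pi),
        8 * (gradKernel (v - w) * g w) := by
        refine lintegral_mono fun θ => lintegral_mono fun ε => ?_
        rw [← mul_assoc]
        exact mul_le_mul' (key θ ε) le_rfl
    _ = _ := by
        simp only [c, lintegral_const]
        ring

/-! ### The operator `K` as a sum of three weighted integrals -/

/-- The velocity at which the `i`-th term of `K` evaluates its argument. -/
noncomputable def kPoint (i : Fin 3) (v : E3) (p : E3 × ℝ × ℝ) : E3 :=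
  match i with
  | 0 => postVs v p.1 p.2.1 p.2.2
  | 1 => postV v p.1 p.2.1 p.2.2
  | 2 => p.1

/-- The weight of the `i`-th term of `K`. -/
noncomputable def kWeight (B : ℝ → ℝ → ℝ) (i : Fin 3) (v : E3) (p : E3 × ℝ × ℝ) : ℝ :=
  match i with
  | 0 => Real.sqrt (maxwellian p.1) * Real.sqrt (maxwellian (postV v p.1 p.2.1 p.2.2)) *
      B ‖v - p.1‖ p.2.2
  | 1 => Real.sqrt (maxwellian p.1) * Real.sqrt (maxwellian (postVs v p.1 p.2.1 p.2.2)) *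
      B ‖v - p.1‖ p.2.2
  | 2 => -(Real.sqrt (maxwellian p.1) * Real.sqrt (maxwellian v) * B ‖v - p.1‖ p.2.2)

/-- The operator `K` in the form of a sum of weighted integrals. -/
noncomputable def kOp (B : ℝ → ℝ → ℝ) (g : E3 → ℝ) (v : E3) : ℝ :=
  ∑ i, ∫ p, kWeight B i v p * g (kPoint i v p) ∂collMeasure

instance : SigmaFinite collMeasure := by unfold collMeasure; infer_instance

@[fun_prop]
theorem measurable_maxwellian : Measurable maxwellian := by unfold maxwellian; fun_prop

theorem maxwellian_pos (v : E3) : 0 < maxwellian v := by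
  unfold maxwellian; have := Real.pi_pos; positivity

theorem measurable_kPoint {α : Type*} [MeasurableSpace α] {a : α → E3} {b : α → E3 × ℝ × ℝ}
    (ha : Measurable a) (hb : Measurable b) (i : Fin 3) :
    Measurable fun x => kPoint i (a x) (b x) := by
  fin_cases i <;> simp only [kPoint] <;> fun_prop

theorem measurable_kWeight {B : ℝ → ℝ → ℝ} (hB : Measurable (Function.uncurry B)) {α : Type*}
    [MeasurableSpace α] {a : α → E3} {b : α → E3 × ℝ × ℝ} (ha : Measurable a) (hb : Measurable b)
    (i : Fin 3) : Measurable fun x => kWeight B i (a x) (b x) := by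
  have h0 : Measurable fun x => (‖a x - (b x).1‖, (b x).2.2) := by fun_prop
  have h : Measurable fun x => B ‖a x - (b x).1‖ (b x).2.2 := hB.comp h0
  fin_cases i <;> simp only [kWeight] <;> fun_prop

theorem sqrt_maxwellian_le (v : E3) : Real.sqrt (maxwellian v) ≤ halfGauss v := by
  apply Real.sqrt_le_iff.2 ⟨(halfGauss_pos v).le, ?_⟩
  rw [halfGauss, ← Real.exp_nat_mul, maxwellian]
  have h : Real.pi ^ (-(3 / 2) : ℝ) ≤ 1 :=
    Real.rpow_le_one_of_one_le_of_nonpos (by linarith [Real.pi_gt_three]) (by norm_num)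
  calc _ ≤ 1 * Real.exp (-‖v‖ ^ 2) := by gcongr
    _ = _ := by rw [one_mul]; congr 1; push_cast; ring

/-- The collision cross-section is bounded by the cutoff weight almost everywhere. -/
theorem exists_cutoff_bound {γ : ℝ} {B : ℝ → ℝ → ℝ} (hB : AngularCutoff γ B) :
    ∃ C : ℝ, 0 ≤ C ∧ ∀ v : E3, ∀ᵐ p ∂collMeasure,
      0 ≤ B ‖v - p.1‖ p.2.2 ∧ B ‖v - p.1‖ p.2.2 ≤ C * cutoffWeight γ v p := by
  obtain ⟨C, hC⟩ := hB
  refine ⟨max C 0, le_max_right _ _, fun v => ?_⟩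
  filter_upwards [ae_collMeasure_ne v, ae_collMeasure_mem] with p hp hp'
  have hr : 0 < ‖v - p.1‖ := norm_pos_iff.2 (sub_ne_zero.2 hp.symm)
  have hθ := hp'.2
  obtain ⟨h1, h2⟩ := hC _ hr p.2.2 ⟨hθ.1.le, hθ.2.le⟩
  refine ⟨h1, h2.trans ?_⟩
  have hs : 0 ≤ Real.sin p.2.2 := Real.sin_nonneg_of_nonneg_of_le_pi hθ.1.le
    (by linarith [hθ.2, Real.pi_pos])
  have hc : 0 ≤ Real.cos p.2.2 := Real.cos_nonneg_of_mem_Icc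
    ⟨by linarith [hθ.1, Real.pi_pos], hθ.2.le⟩
  have : C ≤ max C 0 := le_max_left _ _
  calc C * ‖v - p.1‖ ^ γ * Real.cos p.2.2 * Real.sin p.2.2
      ≤ max C 0 * ‖v - p.1‖ ^ γ * Real.cos p.2.2 * Real.sin p.2.2 := by gcongr
    _ = _ := by rw [cutoffWeight]; ring

/-- Each of the three terms of `K` is dominated by convolution with `gradKernel`. -/
theorem lintegral_kWeight_le {γ : ℝ} (hγ0 : 0 ≤ γ) (hγ1 : γ ≤ 1) {B : ℝ → ℝ → ℝ}
    (hB : AngularCutoff γ B) :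
    ∃ C : ℝ≥0∞, C ≠ ∞ ∧ ∀ (i : Fin 3) (v : E3) (g : E3 → ℝ≥0∞), Measurable g →
      ∫⁻ p, ‖kWeight B i v p‖ₑ * g (kPoint i v p) ∂collMeasure ≤
        C * ∫⁻ w, gradKernel (v - w) * g w := by
  obtain ⟨C0, hC0, hb⟩ := exists_cutoff_bound hB
  obtain ⟨C1, hC1, b1⟩ := lintegral_gainV_le hγ0 hγ1
  obtain ⟨C2, hC2, b2⟩ := lintegral_loss_le hγ0 hγ1
  refine ⟨ENNReal.ofReal C0 * (C1 + C2), ENNReal.mul_ne_top ENNReal.ofReal_ne_top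
    (ENNReal.add_ne_top.2 ⟨hC1, hC2⟩), fun i v g hg => ?_⟩
  have aux : ∀ (a b : E3) (p : E3 × ℝ × ℝ) (x : ℝ≥0∞), 0 ≤ B ‖v - p.1‖ p.2.2 →
      B ‖v - p.1‖ p.2.2 ≤ C0 * cutoffWeight γ v p →
      ‖Real.sqrt (maxwellian a) * Real.sqrt (maxwellian b) * B ‖v - p.1‖ p.2.2‖ₑ * x ≤
        ENNReal.ofReal C0 *
          (ENNReal.ofReal (cutoffWeight γ v p * halfGauss a * halfGauss b) * x) := by
    intro a b p x h1 h2
    rw [Real.enorm_of_nonneg (by positivity), ← mul_assoc, ← ENNReal.ofReal_mul hC0]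
    refine mul_le_mul' (ENNReal.ofReal_le_ofReal ?_) le_rfl
    calc _ ≤ halfGauss a * halfGauss b * (C0 * cutoffWeight γ v p) := by
          have ha := sqrt_maxwellian_le a
          have hb := sqrt_maxwellian_le b
          have := (halfGauss_pos a).le
          have := (halfGauss_pos b).le
          gcongr
      _ = _ := by ring
  have fin : ∀ F : E3 × ℝ × ℝ → ℝ≥0∞, ∀ D ≤ C1 + C2,
      (∫⁻ p, F p ∂collMeasure ≤ D * ∫⁻ w, gradKernel (v - w) * g w) →
      (∀ᵐ p ∂collMeasure, ‖kWeight B i v p‖ₑ * g (kPoint i v p) ≤ ENNReal.ofReal C0 * F p) →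
      ∫⁻ p, ‖kWeight B i v p‖ₑ * g (kPoint i v p) ∂collMeasure ≤
        ENNReal.ofReal C0 * (C1 + C2) * ∫⁻ w, gradKernel (v - w) * g w := by
    intro F D hD hF hae
    calc _ ≤ ∫⁻ p, ENNReal.ofReal C0 * F p ∂collMeasure := lintegral_mono_ae hae
      _ = ENNReal.ofReal C0 * ∫⁻ p, F p ∂collMeasure :=
          lintegral_const_mul' _ _ ENNReal.ofReal_ne_top
      _ ≤ ENNReal.ofReal C0 * ((C1 + C2) * ∫⁻ w, gradKernel (v - w) * g w) :=
          mul_le_mul' le_rfl (hF.trans (mul_le_mul' hD le_rfl))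
      _ = _ := (mul_assoc _ _ _).symm
  match i with
  | 0 =>
    refine fin (gainVs γ g v) C1 le_self_add
      ((lintegral_gainVs_eq γ hg v).trans_le (b1 v g hg)) ?_
    filter_upwards [hb v] with p hp using aux _ _ p _ hp.1 hp.2
  | 1 =>
    refine fin (gainV γ g v) C1 le_self_add (b1 v g hg) ?_
    filter_upwards [hb v] with p hp using aux _ _ p _ hp.1 hp.2
  | 2 =>
    refine fin _ C2 le_add_self (b2 v g hg) ?_
    filter_upwards [hb v] with p hp
    simp only [kWeight, kPoint, enorm_neg]
    exact aux _ _ p _ hp.1 hp.2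

/-- The hypothesis that the terms of `K` are dominated by `C * gradKernel`. -/
def KDominated (B : ℝ → ℝ → ℝ) (C : ℝ≥0∞) : Prop :=
  ∀ (i : Fin 3) (v : E3) (g : E3 → ℝ≥0∞), Measurable g →
    ∫⁻ p, ‖kWeight B i v p‖ₑ * g (kPoint i v p) ∂collMeasure ≤
      C * ∫⁻ w, gradKernel (v - w) * g w

section

variable {B : ℝ → ℝ → ℝ} {C : ℝ≥0∞}

/-- Domination tested on the indicator of a measurable null set shows that the weight vanishes at
almost every collision whose evaluation point lies in that set. Hence each term of `K` is defined on
classes, for every `v`. -/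
theorem ae_gain_congr (hBm : Measurable (Function.uncurry B)) (hD : KDominated B C)
    {g g' : E3 → ℝ} (h : g =ᵐ[volume] g') (i : Fin 3) (v : E3) :
    (fun p => kWeight B i v p * g (kPoint i v p)) =ᵐ[collMeasure]
      fun p => kWeight B i v p * g' (kPoint i v p) := by
  set N := toMeasurable volume {w | g w ≠ g' w}
  have hN : MeasurableSet N := measurableSet_toMeasurable _ _
  have hN0 : volume N = 0 := by rw [measure_toMeasurable]; exact ae_iff.1 h
  have hm : Measurable (N.indicator fun _ => (1 : ℝ≥0∞)) := measurable_const.indicator hN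
  have h0 : ∫⁻ p, ‖kWeight B i v p‖ₑ * N.indicator (fun _ => 1) (kPoint i v p)
      ∂collMeasure = 0 := by
    refine le_antisymm ((hD i v _ hm).trans ?_) bot_le
    have : ∫⁻ w, gradKernel (v - w) * N.indicator (fun _ => 1) w = 0 := by
      rw [lintegral_eq_zero_iff (by fun_prop)]
      filter_upwards [measure_eq_zero_iff_ae_notMem.1 hN0] with w hw
      simp [hw]
    simp [this]
  have mk : Measurable fun p => kPoint i v p := measurable_kPoint measurable_const measurable_id i
  have mw : Measurable fun p => kWeight B i v p :=
    measurable_kWeight hBm measurable_const measurable_id i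
  have hm' : Measurable fun p => ‖kWeight B i v p‖ₑ * N.indicator (fun _ => 1) (kPoint i v p) :=
    mw.enorm.mul (hm.comp mk)
  rw [lintegral_eq_zero_iff hm'] at h0
  filter_upwards [h0] with p hp
  by_cases hpN : kPoint i v p ∈ N
  · have : kWeight B i v p = 0 := by simpa [hpN] using hp
    simp [this]
  · have : g (kPoint i v p) = g' (kPoint i v p) := by
      by_contra hne
      exact hpN (subset_toMeasurable _ _ hne)
    rw [this]

theorem aestronglyMeasurable_kTerm (hBm : Measurable (Function.uncurry B)) (hD : KDominated B C)
    {g : E3 → ℝ} (hg : AEMeasurable g) (i : Fin 3) (v : E3) :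
    AEStronglyMeasurable (fun p => kWeight B i v p * g (kPoint i v p)) collMeasure := by
  refine AEStronglyMeasurable.congr ?_ (ae_gain_congr hBm hD hg.ae_eq_mk.symm i v)
  have mk : Measurable fun p => kPoint i v p := measurable_kPoint measurable_const measurable_id i
  have mw : Measurable fun p => kWeight B i v p :=
    measurable_kWeight hBm measurable_const measurable_id i
  exact (mw.mul (hg.measurable_mk.comp mk)).aestronglyMeasurable

theorem lintegral_kTerm_le (hBm : Measurable (Function.uncurry B)) (hD : KDominated B C)
    {g : E3 → ℝ} (hg : AEMeasurable g) (i : Fin 3) (v : E3) :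
    ∫⁻ p, ‖kWeight B i v p * g (kPoint i v p)‖ₑ ∂collMeasure ≤
      C * ∫⁻ w, gradKernel (v - w) * ‖g w‖ₑ := by
  have e : ∫⁻ w, gradKernel (v - w) * ‖g w‖ₑ = ∫⁻ w, gradKernel (v - w) * ‖hg.mk g w‖ₑ := by
    refine lintegral_congr_ae ?_
    filter_upwards [hg.ae_eq_mk] with w hw
    rw [hw]
  rw [e]
  refine le_trans (le_of_eq ?_) (hD i v _ hg.measurable_mk.enorm)
  refine lintegral_congr_ae ?_
  filter_upwards [ae_gain_congr hBm hD hg.ae_eq_mk i v] with p hp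
  rw [hp, enorm_mul]

theorem integrable_kTerm (hBm : Measurable (Function.uncurry B)) (hD : KDominated B C)
    (hC : C ≠ ∞) {g : E3 → ℝ} (hg : AEMeasurable g) {v : E3}
    (hfin : ∫⁻ w, gradKernel (v - w) * ‖g w‖ₑ < ∞) (i : Fin 3) :
    Integrable (fun p => kWeight B i v p * g (kPoint i v p)) collMeasure :=
  ⟨aestronglyMeasurable_kTerm hBm hD hg i v,
    (lintegral_kTerm_le hBm hD hg i v).trans_lt (ENNReal.mul_lt_top hC.lt_top hfin)⟩

theorem kOp_congr (hBm : Measurable (Function.uncurry B)) (hD : KDominated B C)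
    {g g' : E3 → ℝ} (h : g =ᵐ[volume] g') (v : E3) : kOp B g v = kOp B g' v :=
  Finset.sum_congr rfl fun i _ => integral_congr_ae (ae_gain_congr hBm hD h i v)

theorem enorm_kOp_le (hBm : Measurable (Function.uncurry B)) (hD : KDominated B C)
    {g : E3 → ℝ} (hg : AEMeasurable g) (v : E3) :
    ‖kOp B g v‖ₑ ≤ 3 * C * ∫⁻ w, gradKernel (v - w) * ‖g w‖ₑ := by
  calc ‖kOp B g v‖ₑ ≤ ∑ i, ‖∫ p, kWeight B i v p * g (kPoint i v p) ∂collMeasure‖ₑ :=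
        enorm_sum_le _ _
    _ ≤ ∑ _i : Fin 3, C * ∫⁻ w, gradKernel (v - w) * ‖g w‖ₑ :=
        Finset.sum_le_sum fun i _ => (enorm_integral_le_lintegral_enorm _).trans
          (lintegral_kTerm_le hBm hD hg i v)
    _ = _ := by simp [mul_assoc]

theorem kOp_linear {g h : E3 → ℝ} {v : E3} (a b : ℝ)
    (hg : ∀ i, Integrable (fun p => kWeight B i v p * g (kPoint i v p)) collMeasure)
    (hh : ∀ i, Integrable (fun p => kWeight B i v p * h (kPoint i v p)) collMeasure) :
    kOp B (fun w => a * g w + b * h w) v = a * kOp B g v + b * kOp B h v := by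
  simp only [kOp, Finset.mul_sum, ← Finset.sum_add_distrib]
  refine Finset.sum_congr rfl fun i _ => ?_
  rw [← integral_const_mul, ← integral_const_mul, ← integral_add ((hg i).const_mul a)
    ((hh i).const_mul b)]
  congr 1
  funext p
  ring

/-! ### Identification of `K` with its three weighted integrals -/

/-- Conservation of energy. For equal velocities there is no unit collision direction, but then the
collision changes nothing. -/
theorem maxwellian_post (v vs : E3) (ε θ : ℝ) :
    maxwellian (postV v vs ε θ) * maxwellian (postVs v vs ε θ) =
      maxwellian v * maxwellian vs := by
  have h : ‖postV v vs ε θ‖ ^ 2 + ‖postVs v vs ε θ‖ ^ 2 = ‖v‖ ^ 2 + ‖vs‖ ^ 2 := by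
    rcases eq_or_ne vs v with rfl | hne
    · simp [postV, postVs]
    have h1 := norm_scatterDir hne ε θ
    rw [postV, postVs]
    set α := scatterDir v vs ε θ
    rw [norm_add_sq_real, norm_sub_sq_real, norm_smul, h1, real_inner_smul_right,
      real_inner_smul_right, mul_one, Real.norm_eq_abs, sq_abs, inner_sub_left]
    ring
  simp only [maxwellian]
  have e : ∀ a b : ℝ, Real.pi ^ (-(3 / 2) : ℝ) * Real.exp a *
      (Real.pi ^ (-(3 / 2) : ℝ) * Real.exp b) =
      (Real.pi ^ (-(3 / 2) : ℝ)) ^ 2 * Real.exp (a + b) := fun a b => by rw [Real.exp_add]; ring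
  rw [e, e]
  congr 2
  linarith

theorem sqrt_maxwellian_post (v vs : E3) (ε θ : ℝ) :
    Real.sqrt (maxwellian (postV v vs ε θ)) * Real.sqrt (maxwellian (postVs v vs ε θ)) =
      Real.sqrt (maxwellian v) * Real.sqrt (maxwellian vs) := by
  rw [← Real.sqrt_mul (maxwellian_pos _).le, maxwellian_post, Real.sqrt_mul (maxwellian_pos _).le]

/-- Energy conservation extracts `√M(v)` from the gain term, cancelling the prefactor of `L`; what
remains is one gain term and the loss term in `v_*`. -/
theorem collIntegrand_maxwellian_left (f : E3 → ℝ) (v : E3) (p : E3 × ℝ × ℝ) :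
    collIntegrand B maxwellian (weighted f) v p = Real.sqrt (maxwellian v) *
      (kWeight B 0 v p * f (kPoint 0 v p) + kWeight B 2 v p * f (kPoint 2 v p)) := by
  have h := sqrt_maxwellian_post v p.1 p.2.1 p.2.2
  have h1 := Real.mul_self_sqrt (maxwellian_pos (postV v p.1 p.2.1 p.2.2)).le
  have h2 := Real.mul_self_sqrt (maxwellian_pos v).le
  simp only [collIntegrand, weighted, kWeight, kPoint]
  linear_combination (Real.sqrt (maxwellian (postV v p.1 p.2.1 p.2.2)) *
    f (postVs v p.1 p.2.1 p.2.2) * B ‖v - p.1‖ p.2.2) * h -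
    (Real.sqrt (maxwellian (postVs v p.1 p.2.1 p.2.2)) *
    f (postVs v p.1 p.2.1 p.2.2) * B ‖v - p.1‖ p.2.2) * h1 +
    (Real.sqrt (maxwellian p.1) * f p.1 * B ‖v - p.1‖ p.2.2) * h2

/-- The subtracted part is the integrand of `ν f`, which the definition of `K` adds back. -/
theorem collIntegrand_maxwellian_right (f : E3 → ℝ) (v : E3) (p : E3 × ℝ × ℝ) :
    collIntegrand B (weighted f) maxwellian v p = Real.sqrt (maxwellian v) *
      (kWeight B 1 v p * f (kPoint 1 v p) - f v * (maxwellian p.1 * B ‖v - p.1‖ p.2.2)) := by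
  have h := sqrt_maxwellian_post v p.1 p.2.1 p.2.2
  have h1 := Real.mul_self_sqrt (maxwellian_pos (postVs v p.1 p.2.1 p.2.2)).le
  simp only [collIntegrand, weighted, kWeight, kPoint]
  linear_combination (Real.sqrt (maxwellian (postVs v p.1 p.2.1 p.2.2)) *
    f (postV v p.1 p.2.1 p.2.2) * B ‖v - p.1‖ p.2.2) * h -
    (Real.sqrt (maxwellian (postV v p.1 p.2.1 p.2.2)) *
    f (postV v p.1 p.2.1 p.2.2) * B ‖v - p.1‖ p.2.2) * h1

/-- Up to the factor `-√M(v)`, the integrand of `ν` is the third term of `K` applied to `√M`, so the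
domination of `K` already controls it. -/
theorem integrable_collFreq (hBm : Measurable (Function.uncurry B)) (hD : KDominated B C)
    (hC : C ≠ ∞) (v : E3) :
    Integrable (fun p : E3 × ℝ × ℝ => maxwellian p.1 * B ‖v - p.1‖ p.2.2) collMeasure := by
  have h := integrable_kTerm hBm hD hC (g := fun w => Real.sqrt (maxwellian w)) (v := v)
    (by fun_prop) ?_ 2
  · refine (h.const_mul (-(Real.sqrt (maxwellian v))⁻¹)).congr (ae_of_all _ fun p => ?_)
    have h1 := Real.mul_self_sqrt (maxwellian_pos p.1).le
    have h2 : Real.sqrt (maxwellian v) ≠ 0 := (Real.sqrt_pos.2 (maxwellian_pos v)).ne'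
    simp only [kWeight, kPoint]
    conv_rhs => rw [← h1]
    field_simp
  · refine lt_of_le_of_lt (lintegral_mono (g := fun w => gradKernel (v - w)) fun w => ?_) ?_
    · refine mul_le_of_le_one_right' ?_
      rw [Real.enorm_of_nonneg (Real.sqrt_nonneg _), ENNReal.ofReal_le_one]
      refine (sqrt_maxwellian_le w).trans (Real.exp_le_one_iff.2 ?_)
      nlinarith [sq_nonneg ‖w‖]
    · rw [lintegral_sub_left_eq_self gradKernel v]
      exact lintegral_gradKernel_lt_top

/-- If `f` is integrable against the dominating kernel then `K f` converges, to `kOp B f`. -/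
theorem collConverges_of_lintegral (hBm : Measurable (Function.uncurry B)) (hD : KDominated B C)
    (hC : C ≠ ∞) {f : E3 → ℝ} (hf : AEMeasurable f) {v : E3}
    (hfin : ∫⁻ w, gradKernel (v - w) * ‖f w‖ₑ < ∞) :
    CollConverges B f v ∧ collK B f v = kOp B f v := by
  have hi := integrable_kTerm hBm hD hC hf hfin
  have hν := integrable_collFreq hBm hD hC v
  have i1 : Integrable (collIntegrand B maxwellian (weighted f) v) collMeasure :=
    (((hi 0).add (hi 2)).const_mul (Real.sqrt (maxwellian v))).congr
      (ae_of_all _ fun p => (collIntegrand_maxwellian_left f v p).symm)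
  have i2 : Integrable (collIntegrand B (weighted f) maxwellian v) collMeasure :=
    (((hi 1).sub (hν.const_mul (f v))).const_mul (Real.sqrt (maxwellian v))).congr
      (ae_of_all _ fun p => (collIntegrand_maxwellian_right f v p).symm)
  refine ⟨⟨i1, i2, hν⟩, ?_⟩
  have h0 : Real.sqrt (maxwellian v) ≠ 0 := (Real.sqrt_pos.2 (maxwellian_pos v)).ne'
  simp only [collK, collL, collQ, collFreq, kOp, collIntegrand_maxwellian_left,
    collIntegrand_maxwellian_right, integral_const_mul, Fin.sum_univ_three]
  rw [integral_add (hi 0) (hi 2), integral_sub (hi 1) (hν.const_mul (f v)), integral_const_mul]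
  field_simp
  ring

theorem collFreq_nonneg {γ : ℝ} (hB : AngularCutoff γ B) (v : E3) : 0 ≤ collFreq B v := by
  obtain ⟨C0, hC0, hb⟩ := exists_cutoff_bound hB
  refine integral_nonneg_of_ae ?_
  filter_upwards [hb v] with p hp using mul_nonneg (maxwellian_pos _).le hp.1

theorem measurable_collFreq (hBm : Measurable (Function.uncurry B)) : Measurable (collFreq B) := by
  have h : Measurable fun q : E3 × E3 × ℝ × ℝ => maxwellian q.2.1 * B ‖q.1 - q.2.1‖ q.2.2.2 := by
    have : Measurable fun q : E3 × E3 × ℝ × ℝ => B ‖q.1 - q.2.1‖ q.2.2.2 :=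
      hBm.comp (by fun_prop : Measurable fun q : E3 × E3 × ℝ × ℝ => (‖q.1 - q.2.1‖, q.2.2.2))
    fun_prop
  exact (h.stronglyMeasurable.integral_prod_right' (ν := collMeasure)).measurable

end

/-! ### Weighted Cauchy–Schwarz estimates -/

theorem sq_lintegral_mul_le {α : Type*} [MeasurableSpace α] (μ : Measure α) {k f : α → ℝ≥0∞}
    (hk : Measurable k) (hf : Measurable f) :
    (∫⁻ a, k a * f a ∂μ) ^ 2 ≤ (∫⁻ a, k a ∂μ) * ∫⁻ a, k a * f a ^ 2 ∂μ := by
  have h := ENNReal.lintegral_mul_le_Lp_mul_Lq μ Real.HolderConjugate.two_two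
    (f := fun a => k a ^ (1 / 2 : ℝ)) (g := fun a => k a ^ (1 / 2 : ℝ) * f a)
    (by fun_prop) (by fun_prop)
  have e : ∀ x : ℝ≥0∞, x ^ (1 / 2 : ℝ) * x ^ (1 / 2 : ℝ) = x := fun x => by
    rw [← ENNReal.rpow_add_of_nonneg _ _ (by norm_num) (by norm_num)]; norm_num
  have e2 : ∀ x : ℝ≥0∞, (x ^ (1 / 2 : ℝ)) ^ (2 : ℝ) = x := fun x => by
    rw [← ENNReal.rpow_mul]; norm_num
  simp only [Pi.mul_apply, ← mul_assoc, e, e2] at h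
  calc _ ≤ ((∫⁻ a, k a ∂μ) ^ (1 / 2 : ℝ) *
        (∫⁻ a, (k a ^ (1 / 2 : ℝ) * f a) ^ (2 : ℝ) ∂μ) ^ (1 / 2 : ℝ)) ^ 2 := by gcongr
    _ = (∫⁻ a, k a ∂μ) * ∫⁻ a, (k a ^ (1 / 2 : ℝ) * f a) ^ (2 : ℝ) ∂μ := by
        rw [mul_pow, sq, sq, e, e]
    _ = _ := by
        congr 2
        funext a
        rw [ENNReal.mul_rpow_of_nonneg _ _ (by norm_num), e2, ENNReal.rpow_two]

theorem lintegral_gradKernel_sub (v : E3) : ∫⁻ w, gradKernel (v - w) = ∫⁻ w, gradKernel w :=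
  lintegral_sub_left_eq_self gradKernel v

theorem lintegral_gradKernel_sub' (w : E3) : ∫⁻ v, gradKernel (v - w) = ∫⁻ w, gradKernel w :=
  lintegral_sub_right_eq_self gradKernel w

/-- Two convolutions with `gradKernel` separated by a weight are bounded on `L²`. -/
theorem lintegral_conv_weight_conv_sq_le {μ G : E3 → ℝ≥0∞} (hμ : Measurable μ) (hG : Measurable G)
    {c : ℝ≥0∞} (hc : ∀ v, ∫⁻ w, gradKernel (v - w) * μ w ≤ c) :
    ∫⁻ v, (∫⁻ w, gradKernel (v - w) * (μ w * ∫⁻ z, gradKernel (w - z) * G z)) ^ 2 ≤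
      c ^ 2 * (∫⁻ w, gradKernel w) ^ 2 * ∫⁻ z, G z ^ 2 := by
  set N := ∫⁻ w, gradKernel w with hN
  have hm : Measurable fun w => ∫⁻ z, gradKernel (w - z) * G z :=
    Measurable.lintegral_prod_right' (f := fun q : E3 × E3 => gradKernel (q.1 - q.2) * G q.2)
      (by fun_prop)
  -- Cauchy–Schwarz with the measure `k(v - w) μ(w) dw` costs one factor `c`, and integrating in `v`
  -- gives `N`. Cauchy–Schwarz for the inner convolution gives the second `N`. Integrating in `w`,
  -- with the kernel symmetric, the remaining `μ(w)` gives the second `c`.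
  calc _ ≤ ∫⁻ v, c * ∫⁻ w, (gradKernel (v - w) * μ w) *
        (∫⁻ z, gradKernel (w - z) * G z) ^ 2 := by
        refine lintegral_mono fun v => ?_
        simp only [← mul_assoc (gradKernel _)]
        exact (sq_lintegral_mul_le volume (by fun_prop) hm).trans (mul_le_mul' (hc v) le_rfl)
    _ = c * ∫⁻ w, ∫⁻ v, (gradKernel (v - w) * μ w) *
        (∫⁻ z, gradKernel (w - z) * G z) ^ 2 := by
        rw [lintegral_const_mul _ (Measurable.lintegral_prod_right'
          (f := fun q : E3 × E3 => (gradKernel (q.1 - q.2) * μ q.2) *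
            (∫⁻ z, gradKernel (q.2 - z) * G z) ^ 2) (by fun_prop)), lintegral_lintegral_swap]
        simp only [Function.uncurry_def]
        fun_prop
    _ = c * ∫⁻ w, N * (μ w * (∫⁻ z, gradKernel (w - z) * G z) ^ 2) := by
        congr 2
        funext w
        simp only [mul_assoc]
        rw [lintegral_mul_const _ (by fun_prop), lintegral_gradKernel_sub']
    _ ≤ c * ∫⁻ w, N * (μ w * (N * ∫⁻ z, gradKernel (w - z) * G z ^ 2)) := by
        refine mul_le_mul' le_rfl (lintegral_mono fun w => mul_le_mul' le_rfl
          (mul_le_mul' le_rfl ?_))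
        refine (sq_lintegral_mul_le volume (by fun_prop) hG).trans ?_
        rw [lintegral_gradKernel_sub]
    _ = c * ((N * N) * ∫⁻ w, ∫⁻ z, (gradKernel (z - w) * μ w) * G z ^ 2) := by
        rw [← lintegral_const_mul _ (Measurable.lintegral_prod_right'
          (f := fun q : E3 × E3 => (gradKernel (q.2 - q.1) * μ q.1) * G q.2 ^ 2) (by fun_prop))]
        congr 2
        funext w
        simp only [mul_right_comm _ (μ w)]
        rw [lintegral_mul_const _ (by fun_prop)]
        simp only [gradKernel_sub_comm w]
        ring
    _ = c * ((N * N) * ∫⁻ z, (∫⁻ w, gradKernel (z - w) * μ w) * G z ^ 2) := by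
        rw [lintegral_lintegral_swap (by simp only [Function.uncurry_def]; fun_prop)]
        congr 3
        funext z
        rw [lintegral_mul_const _ (by fun_prop)]
    _ ≤ c * ((N * N) * ∫⁻ z, c * G z ^ 2) := by
        gcongr with z
        exact hc z
    _ = _ := by
        rw [lintegral_const_mul _ (by fun_prop)]
        ring

/-! ### The partial Fourier transform -/

/-- The Fourier transform in the space variable. -/
noncomputable def pFourier (u : E3 × E3 → ℝ) (ξ w : E3) : ℂ := 𝓕 (fun x => (u (x, w) : ℂ)) ξ

theorem pFourier_eq (u : E3 × E3 → ℝ) (ξ w : E3) :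
    pFourier u ξ w = ∫ x, (Real.fourierChar (-inner ℝ x ξ) : ℂ) * (u (x, w) : ℂ) := by
  rw [pFourier, Real.fourier_eq]
  rfl

theorem measurable_pFourier {u : E3 × E3 → ℝ} (hu : Measurable u) :
    Measurable fun q : E3 × E3 => pFourier u q.1 q.2 := by
  simp only [pFourier_eq]
  have h : Measurable fun p : (E3 × E3) × E3 =>
      (Real.fourierChar (-inner ℝ p.2 p.1.1) : ℂ) * (u (p.2, p.1.2) : ℂ) := by fun_prop
  exact (h.stronglyMeasurable.integral_prod_right' (ν := volume)).measurable

section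

variable {B : ℝ → ℝ → ℝ} {C : ℝ≥0∞}

theorem measurable_kTerm (hBm : Measurable (Function.uncurry B)) {u : E3 × E3 → ℝ}
    (hu : Measurable u) {α : Type*} [MeasurableSpace α] {a c : α → E3} {d : α → E3 × ℝ × ℝ}
    (ha : Measurable a) (hc : Measurable c) (hd : Measurable d) (i : Fin 3) :
    Measurable fun q => kWeight B i (c q) (d q) * u (a q, kPoint i (c q) (d q)) :=
  (measurable_kWeight hBm hc hd i).mul (hu.comp (ha.prodMk (measurable_kPoint hc hd i)))

theorem measurable_sum_integral {ι : Type*} [Fintype ι] {F : ι → E3 × E3 → E3 × ℝ × ℝ → ℝ}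
    (h : ∀ i, Measurable fun q : (E3 × E3) × E3 × ℝ × ℝ => F i q.1 q.2) :
    Measurable fun z => ∑ i, ∫ p, F i z p ∂collMeasure :=
  Finset.measurable_sum _ fun i _ =>
    ((h i).stronglyMeasurable.integral_prod_right' (ν := collMeasure)).measurable

theorem measurable_kOp (hBm : Measurable (Function.uncurry B)) {u : E3 × E3 → ℝ}
    (hu : Measurable u) :
    Measurable fun z : E3 × E3 => kOp B (fun w => u (z.1, w)) z.2 := by
  unfold kOp
  exact measurable_sum_integral (F := fun i z p => kWeight B i z.2 p * u (z.1, kPoint i z.2 p))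
    fun i => measurable_kTerm hBm hu (by fun_prop) (by fun_prop) (by fun_prop) i

theorem integrable_kTerm_prod (hBm : Measurable (Function.uncurry B)) (hD : KDominated B C)
    (hC : C ≠ ∞) {u : E3 × E3 → ℝ} (hu : Measurable u) {v : E3}
    (hfin : ∫⁻ x, ∫⁻ w, gradKernel (v - w) * ‖u (x, w)‖ₑ < ∞) (i : Fin 3) :
    Integrable (fun q : E3 × E3 × ℝ × ℝ => kWeight B i v q.2 * u (q.1, kPoint i v q.2))
      (volume.prod collMeasure) := by
  have hmx : Measurable fun q : E3 × E3 × ℝ × ℝ => kWeight B i v q.2 * u (q.1, kPoint i v q.2) :=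
    measurable_kTerm hBm hu measurable_fst measurable_const measurable_snd i
  refine ⟨hmx.aestronglyMeasurable, ?_⟩
  rw [hasFiniteIntegral_iff_enorm, lintegral_prod _ hmx.enorm.aemeasurable]
  refine lt_of_le_of_lt (lintegral_mono fun x => lintegral_kTerm_le hBm hD
    (g := fun w => u (x, w)) (by fun_prop) i v) ?_
  rw [lintegral_const_mul' _ _ hC]
  exact ENNReal.mul_lt_top hC.lt_top hfin

theorem integrable_fourierChar_mul {α : Type*} [MeasurableSpace α] {μ : Measure (E3 × α)}
    {F : E3 × α → ℝ} (hF : Integrable F μ) (ξ : E3) :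
    Integrable (fun q => (Real.fourierChar (-inner ℝ q.1 ξ) : ℂ) * (F q : ℂ)) μ := by
  refine (hF.ofReal (𝕜 := ℂ)).mono ?_ (ae_of_all _ fun q => ?_)
  · have h : Measurable fun q : E3 × α => (Real.fourierChar (-inner ℝ q.1 ξ) : ℂ) := by fun_prop
    exact h.aestronglyMeasurable.mul (hF.ofReal (𝕜 := ℂ)).aestronglyMeasurable
  · rw [norm_mul, Circle.norm_coe, one_mul]
    exact le_rfl

/-- `K` acts in velocity and the transform in space, so they commute by Fubini; the finiteness
hypothesis supplies joint integrability. -/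
theorem pFourier_kOp (hBm : Measurable (Function.uncurry B)) (hD : KDominated B C)
    (hC : C ≠ ∞) {u : E3 × E3 → ℝ} (hu : Measurable u) {v : E3}
    (hfin : ∫⁻ x, ∫⁻ w, gradKernel (v - w) * ‖u (x, w)‖ₑ < ∞) (ξ : E3) :
    pFourier (fun z => kOp B (fun w => u (z.1, w)) z.2) ξ v =
      ∑ i, ∫ p, (kWeight B i v p : ℂ) * pFourier u ξ (kPoint i v p) ∂collMeasure := by
  have hintc : ∀ i, Integrable (Function.uncurry fun (x : E3) (p : E3 × ℝ × ℝ) =>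
      (Real.fourierChar (-inner ℝ x ξ) : ℂ) *
      ((kWeight B i v p * u (x, kPoint i v p) : ℝ) : ℂ)) (volume.prod collMeasure) := fun i =>
    integrable_fourierChar_mul (integrable_kTerm_prod hBm hD hC hu hfin i) ξ
  rw [pFourier_eq]
  have e1 : ∀ x, (Real.fourierChar (-inner ℝ x ξ) : ℂ) *
      ((kOp B (fun w => u (x, w)) v : ℝ) : ℂ) = ∑ i, ∫ p, (Real.fourierChar (-inner ℝ x ξ) : ℂ) *
      ((kWeight B i v p * u (x, kPoint i v p) : ℝ) : ℂ) ∂collMeasure := by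
    intro x
    rw [kOp, Complex.ofReal_sum, Finset.mul_sum]
    refine Finset.sum_congr rfl fun i _ => ?_
    rw [← integral_complex_ofReal, integral_const_mul]
  have hI : ∀ i, Integrable fun x : E3 => ∫ p, (Real.fourierChar (-inner ℝ x ξ) : ℂ) *
      ((kWeight B i v p * u (x, kPoint i v p) : ℝ) : ℂ) ∂collMeasure := fun i =>
    (hintc i).integral_prod_left
  simp only [e1]
  rw [integral_finsetSum _ fun i _ => hI i]
  refine Finset.sum_congr rfl fun i _ => ?_
  rw [integral_integral_swap (hintc i)]
  refine integral_congr_ae (ae_of_all _ fun p => ?_)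
  beta_reduce
  rw [pFourier_eq, ← integral_const_mul]
  congr 1
  funext x
  push_cast
  ring

theorem enorm_pFourier_kOp_le (hBm : Measurable (Function.uncurry B)) (hD : KDominated B C)
    (hC : C ≠ ∞) {u : E3 × E3 → ℝ} (hu : Measurable u) {v : E3}
    (hfin : ∫⁻ x, ∫⁻ w, gradKernel (v - w) * ‖u (x, w)‖ₑ < ∞) (ξ : E3) :
    ‖pFourier (fun z => kOp B (fun w => u (z.1, w)) z.2) ξ v‖ₑ ≤
      3 * C * ∫⁻ w, gradKernel (v - w) * ‖pFourier u ξ w‖ₑ := by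
  have hm : Measurable (pFourier u ξ) :=
    Measurable.of_uncurry_left (f := pFourier u) (measurable_pFourier hu)
  rw [pFourier_kOp hBm hD hC hu hfin]
  calc _ ≤ ∑ i, ‖∫ p, (kWeight B i v p : ℂ) * pFourier u ξ (kPoint i v p) ∂collMeasure‖ₑ :=
        enorm_sum_le _ _
    _ ≤ ∑ _i : Fin 3, C * ∫⁻ w, gradKernel (v - w) * ‖pFourier u ξ w‖ₑ := by
        refine Finset.sum_le_sum fun i _ => (enorm_integral_le_lintegral_enorm _).trans ?_
        refine le_trans (le_of_eq ?_) (hD i v _ hm.enorm)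
        refine lintegral_congr fun p => ?_
        rw [enorm_mul, ← ofReal_norm, Complex.norm_real, ofReal_norm]
    _ = _ := by simp [mul_assoc]

end

/-! ### The transport operator on the whole space -/

/-- Damped transport on `ℝ³`, with travel distance at most `D`. -/
noncomputable def freeS (D : ℝ) (ν : E3 → ℝ) (h : E3 × E3 → ℝ) (z : E3 × E3) : ℝ :=
  ∫ s in Set.Ioc 0 (D / ‖z.2‖), transportIntegrand ν h z s

theorem measurable_transportIntegrand {ν : E3 → ℝ} (hν : Measurable ν) {h : E3 × E3 → ℝ}
    (hh : Measurable h) :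
    Measurable fun q : (E3 × E3) × ℝ => transportIntegrand ν h q.1 q.2 := by
  unfold transportIntegrand; fun_prop

theorem measurable_freeS (D : ℝ) {ν : E3 → ℝ} (hν : Measurable ν) {h : E3 × E3 → ℝ}
    (hh : Measurable h) : Measurable (freeS D ν h) := by
  set S : Set ((E3 × E3) × ℝ) := {q | 0 < q.2 ∧ q.2 ≤ D / ‖q.1.2‖}
  have h1 : MeasurableSet {q : (E3 × E3) × ℝ | 0 < q.2} :=
    measurableSet_lt measurable_const measurable_snd
  have h2 : MeasurableSet {q : (E3 × E3) × ℝ | q.2 ≤ D / ‖q.1.2‖} :=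
    measurableSet_le measurable_snd (by fun_prop)
  have hS : MeasurableSet S := h1.inter h2
  have hm := (measurable_transportIntegrand hν hh).indicator hS
  have e : freeS D ν h = fun z => ∫ s, S.indicator
      (fun q : (E3 × E3) × ℝ => transportIntegrand ν h q.1 q.2) (z, s) := by
    funext z
    rw [freeS, ← integral_indicator measurableSet_Ioc]
    rfl
  rw [e]
  exact (hm.stronglyMeasurable.integral_prod_right' (ν := volume)).measurable

theorem enorm_transportIntegrand_le {ν : E3 → ℝ} (hν : ∀ v, 0 ≤ ν v) (h : E3 × E3 → ℝ)
    (z : E3 × E3) {s : ℝ} (hs : 0 ≤ s) :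
    ‖transportIntegrand ν h z s‖ₑ ≤ ‖h (z.1 - s • z.2, z.2)‖ₑ := by
  rw [transportIntegrand, enorm_mul]
  refine mul_le_of_le_one_left' ?_
  rw [Real.enorm_of_nonneg (Real.exp_nonneg _), ENNReal.ofReal_le_one, Real.exp_le_one_iff]
  nlinarith [mul_nonneg (hν z.2) hs]

theorem enorm_freeS_le (D : ℝ) {ν : E3 → ℝ} (hν : ∀ v, 0 ≤ ν v) (h : E3 × E3 → ℝ)
    (z : E3 × E3) :
    ‖freeS D ν h z‖ₑ ≤ ∫⁻ s in Set.Ioc 0 (D / ‖z.2‖), ‖h (z.1 - s • z.2, z.2)‖ₑ :=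
  (enorm_integral_le_lintegral_enorm _).trans
    (setLIntegral_mono' measurableSet_Ioc fun _ hs => enorm_transportIntegrand_le hν h z hs.1.le)

/-- The Fourier multiplier of damped transport. -/
noncomputable def transportMultiplier (T a b : ℝ) : ℂ :=
  ∫ s in Set.Ioc 0 T, Complex.exp (-(a + 2 * Real.pi * b * Complex.I) * s)

/-- The first bound holds because the integrand has modulus at most `1`. For the second, the
antiderivative gives a numerator of modulus at most `2` over a denominator of modulus at least
`2π|b|`. Only the sign of the damping `a` enters. -/
theorem enorm_transportMultiplier_le {T a b : ℝ} (hT : 0 ≤ T) (ha : 0 ≤ a) :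
    ‖transportMultiplier T a b‖ₑ ≤ ENNReal.ofReal T ∧
      ‖transportMultiplier T a b‖ₑ ≤ ‖b‖ₑ⁻¹ := by
  have hn : ∀ s : ℝ, 0 ≤ s → ‖Complex.exp (-(a + 2 * Real.pi * b * Complex.I) * s)‖ ≤ 1 := by
    intro s hs
    rw [Complex.norm_exp]
    simp
    positivity
  constructor
  · refine (enorm_integral_le_lintegral_enorm _).trans ?_
    calc _ ≤ ∫⁻ _ in Set.Ioc 0 T, (1 : ℝ≥0∞) := by
          refine setLIntegral_mono' measurableSet_Ioc fun s hs => ?_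
          rw [← ofReal_norm, ENNReal.ofReal_le_one]
          exact hn s hs.1.le
      _ = _ := by simp
  · rcases eq_or_ne b 0 with rfl | hb
    · simp
    have hc : -((a : ℂ) + 2 * Real.pi * b * Complex.I) ≠ 0 := by
      intro h
      have := congrArg Complex.im h
      simp [Real.pi_ne_zero, hb] at this
    rw [transportMultiplier, ← intervalIntegral.integral_of_le hT, integral_exp_mul_complex hc,
      ← ofReal_norm, ← ofReal_norm, ← ENNReal.ofReal_inv_of_pos (norm_pos_iff.2 hb)]
    apply ENNReal.ofReal_le_ofReal
    rw [norm_div, div_le_iff₀ (norm_pos_iff.2 hc)]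
    have h1 : ‖Complex.exp (-(a + 2 * Real.pi * b * Complex.I) * T) -
        Complex.exp (-(a + 2 * Real.pi * b * Complex.I) * (0 : ℝ))‖ ≤ 2 := by
      refine (norm_sub_le _ _).trans ?_
      linarith [hn T hT, hn 0 le_rfl]
    have h2 : 2 * Real.pi * |b| ≤ ‖-((a : ℂ) + 2 * Real.pi * b * Complex.I)‖ := by
      refine le_trans (le_of_eq ?_) (Complex.abs_im_le_norm _)
      simp [abs_mul, abs_of_pos Real.pi_pos]
    have hb' : 0 < |b| := abs_pos.2 hb
    calc _ ≤ 2 := h1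
      _ ≤ ‖b‖⁻¹ * (2 * Real.pi * |b|) := by
          rw [Real.norm_eq_abs]
          field_simp
          linarith [Real.pi_gt_three]
      _ ≤ _ := by gcongr

/-- On the Fourier side transport acts as multiplication by `transportMultiplier`. -/
theorem pFourier_freeS {D : ℝ} {ν : E3 → ℝ} (hν : Measurable ν) (hν0 : ∀ v, 0 ≤ ν v)
    {h : E3 × E3 → ℝ} (hh : Measurable h) {v : E3} (hi : ∫⁻ x, ‖h (x, v)‖ₑ < ∞) (ξ : E3) :
    pFourier (freeS D ν h) ξ v =
      transportMultiplier (D / ‖v‖) (ν v) (inner ℝ v ξ) * pFourier h ξ v := by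
  have hmx : Measurable fun q : E3 × ℝ => transportIntegrand ν h (q.1, v) q.2 := by
    have h0 : Measurable fun q : E3 × ℝ => ((q.1, v), q.2) := by fun_prop
    exact (measurable_transportIntegrand hν hh).comp h0
  have hint : Integrable (fun q : E3 × ℝ => (Real.fourierChar (-inner ℝ q.1 ξ) : ℂ) *
      ((transportIntegrand ν h (q.1, v) q.2 : ℝ) : ℂ))
      (volume.prod (volume.restrict (Set.Ioc 0 (D / ‖v‖)))) := by
    have hm : Measurable (fun q : E3 × ℝ => (Real.fourierChar (-inner ℝ q.1 ξ) : ℂ) *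
      ((transportIntegrand ν h (q.1, v) q.2 : ℝ) : ℂ)) := by fun_prop
    refine ⟨hm.aestronglyMeasurable, ?_⟩
    rw [hasFiniteIntegral_iff_enorm, lintegral_prod_symm _ hm.enorm.aemeasurable]
    calc _ ≤ ∫⁻ s in Set.Ioc 0 (D / ‖v‖), ∫⁻ x, ‖h (x, v)‖ₑ := by
          refine setLIntegral_mono' measurableSet_Ioc fun s hs => ?_
          rw [← lintegral_sub_right_eq_self (fun x => ‖h (x, v)‖ₑ) (s • v)]
          refine lintegral_mono fun x => ?_
          rw [enorm_mul, ← ofReal_norm, Circle.norm_coe, ENNReal.ofReal_one, one_mul,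
            ← ofReal_norm, Complex.norm_real, ofReal_norm]
          exact enorm_transportIntegrand_le hν0 h (x, v) hs.1.le
      _ < ∞ := by
          rw [setLIntegral_const]
          exact ENNReal.mul_lt_top hi (by simp)
  rw [pFourier_eq]
  have e1 : ∀ x, (Real.fourierChar (-inner ℝ x ξ) : ℂ) * ((freeS D ν h (x, v) : ℝ) : ℂ) =
      ∫ s in Set.Ioc 0 (D / ‖v‖), (Real.fourierChar (-inner ℝ x ξ) : ℂ) *
      ((transportIntegrand ν h (x, v) s : ℝ) : ℂ) := by
    intro x
    rw [freeS, ← integral_complex_ofReal, integral_const_mul]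
  simp only [e1]
  rw [integral_integral_swap hint, transportMultiplier, ← integral_mul_const]
  refine setIntegral_congr_fun measurableSet_Ioc fun s _ => ?_
  -- Translating `x` by `s v` turns the shift in the argument of `h` into the phase `exp(-2πi s
  -- v·ξ)`.
  rw [pFourier_eq, ← integral_const_mul,
    ← integral_add_right_eq_self (fun x => (Real.fourierChar (-inner ℝ x ξ) : ℂ) *
      ((transportIntegrand ν h (x, v) s : ℝ) : ℂ)) (s • v)]
  refine integral_congr_ae (ae_of_all _ fun x => ?_)
  simp only [transportIntegrand, add_sub_cancel_right, Real.fourierChar_apply]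
  push_cast
  rw [← mul_assoc, ← mul_assoc, ← Complex.exp_add, ← Complex.exp_add]
  congr 2
  rw [inner_add_left, real_inner_smul_left]
  push_cast
  ring

/-! ### Estimates for the model operators -/

/-- `K` acting on functions of `(x, v)`, in the form of a sum of weighted integrals. -/
noncomputable def kOpX (B : ℝ → ℝ → ℝ) (f : E3 × E3 → ℝ) (z : E3 × E3) : ℝ :=
  kOp B (fun w => f (z.1, w)) z.2

/-- The transport of `K f`. -/
noncomputable def modelSK (D : ℝ) (B : ℝ → ℝ → ℝ) (f : E3 × E3 → ℝ) : E3 × E3 → ℝ :=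
  freeS D (collFreq B) (kOpX B f)

/-- The operator `K S K` on the whole space. -/
noncomputable def modelKSK (D : ℝ) (B : ℝ → ℝ → ℝ) (f : E3 × E3 → ℝ) : E3 × E3 → ℝ :=
  kOpX B (modelSK D B f)

theorem mul_le_sq_add_sq (a b : ℝ≥0∞) : a * b ≤ a ^ 2 + b ^ 2 := by
  rcases le_total a b with h | h
  · calc a * b ≤ b * b := mul_le_mul' h le_rfl
      _ ≤ _ := by rw [← sq]; exact le_add_self
  · calc a * b ≤ a * a := mul_le_mul' le_rfl h
      _ ≤ _ := by rw [← sq]; exact le_self_add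

/-- As `|w·ω| ≤ |w|` for a unit vector, `|w|⁻¹` lies below the weight already treated, for any
choice of `ω`. -/
theorem exists_lintegral_gradKernel_inv_le :
    ∃ c : ℝ≥0∞, c ≠ ∞ ∧ ∀ v : E3, ∫⁻ w, gradKernel (v - w) * ‖w‖ₑ⁻¹ ≤ c := by
  obtain ⟨c, hc, b⟩ := lintegral_gradKernel_weight_le
  refine ⟨c, hc, fun v => ?_⟩
  have hω : ‖(EuclideanSpace.single 0 1 : E3)‖ = 1 := by simp
  refine le_trans (lintegral_mono fun w => mul_le_mul' le_rfl ?_) (b v _ hω)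
  rw [← ENNReal.rpow_neg_one, show (-1 : ℝ) = -(1 / 2 + 1 / 2) by norm_num,
    rpow_neg_add (by simp) (by norm_num) (by norm_num)]
  refine mul_le_mul' le_rfl (rpow_neg_anti ?_ (by norm_num))
  rw [enorm_le_iff_norm_le]
  refine (norm_inner_le_norm _ _).trans ?_
  rw [hω, mul_one]

/-- At `w = 0` the left side is `0`, real division by zero being `0`; the truncated transport is
accordingly empty at zero velocity. -/
theorem ofReal_div_norm_le {D : ℝ} (hD0 : 0 ≤ D) (w : E3) :
    ENNReal.ofReal (D / ‖w‖) ≤ ENNReal.ofReal D * ‖w‖ₑ⁻¹ := by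
  rw [div_eq_mul_inv, ENNReal.ofReal_mul hD0]
  refine mul_le_mul' le_rfl ?_
  rcases eq_or_ne w 0 with rfl | hw
  · simp
  · rw [ENNReal.ofReal_inv_of_pos (norm_pos_iff.2 hw), ofReal_norm]

section

variable {B : ℝ → ℝ → ℝ} {C : ℝ≥0∞}

theorem measurable_kOpX (hBm : Measurable (Function.uncurry B)) {f : E3 × E3 → ℝ}
    (hf : Measurable f) : Measurable (kOpX B f) := measurable_kOp hBm hf

theorem measurable_modelSK (hBm : Measurable (Function.uncurry B)) (D : ℝ) {f : E3 × E3 → ℝ}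
    (hf : Measurable f) : Measurable (modelSK D B f) :=
  measurable_freeS D (measurable_collFreq hBm) (measurable_kOpX hBm hf)

theorem enorm_kOpX_le (hBm : Measurable (Function.uncurry B)) (hD : KDominated B C)
    {f : E3 × E3 → ℝ} (hf : Measurable f) (z : E3 × E3) :
    ‖kOpX B f z‖ₑ ≤ 3 * C * ∫⁻ w, gradKernel (z.2 - w) * ‖f (z.1, w)‖ₑ :=
  enorm_kOp_le hBm hD (g := fun w => f (z.1, w)) (by fun_prop) z.2

/-- The inequality `ab ≤ a² + b²` separates kernel and function, and the kernel part is integrated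
in `x` over `Ω` only. The bound holds for every `v`, which gives convergence at each velocity before
any transform is taken. -/
theorem lintegral_gradKernel_mul_le {Ω : Set E3} (hΩ : MeasurableSet Ω) {f : E3 × E3 → ℝ}
    (hf : Measurable f) (h0 : ∀ x ∉ Ω, ∀ w, f (x, w) = 0) (v : E3) :
    ∫⁻ x, ∫⁻ w, gradKernel (v - w) * ‖f (x, w)‖ₑ ≤
      volume Ω * (∫⁻ w, gradKernel w ^ 2) + ∫⁻ w, ∫⁻ x, ‖f (x, w)‖ₑ ^ 2 := by
  have hm : Measurable fun x => ∫⁻ w, ‖f (x, w)‖ₑ ^ 2 :=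
    Measurable.lintegral_prod_right' (f := fun q : E3 × E3 => ‖f q‖ₑ ^ 2) (by fun_prop)
  calc _ ≤ ∫⁻ x, ((Ω.indicator (fun _ => ∫⁻ w, gradKernel w ^ 2) x) + ∫⁻ w, ‖f (x, w)‖ₑ ^ 2) := by
        refine lintegral_mono fun x => ?_
        by_cases hx : x ∈ Ω
        · rw [Set.indicator_of_mem hx,
            ← lintegral_sub_left_eq_self (fun w => gradKernel w ^ 2) v,
            ← lintegral_add_left (by fun_prop)]
          exact lintegral_mono fun w => mul_le_sq_add_sq _ _
        · simp [h0 x hx]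
    _ = _ := by
        rw [lintegral_add_right _ hm, lintegral_indicator hΩ, setLIntegral_const, mul_comm,
          lintegral_lintegral_swap (f := fun x w => ‖f (x, w)‖ₑ ^ 2)
            (by simp only [Function.uncurry_def]; fun_prop)]

theorem lintegral_enorm_kOpX_le (hBm : Measurable (Function.uncurry B)) (hD : KDominated B C)
    (hC : C ≠ ∞) {f : E3 × E3 → ℝ} (hf : Measurable f) (v : E3) :
    ∫⁻ x, ‖kOpX B f (x, v)‖ₑ ≤
      3 * C * ∫⁻ x, ∫⁻ w, gradKernel (v - w) * ‖f (x, w)‖ₑ := by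
  rw [← lintegral_const_mul' _ _ (ENNReal.mul_ne_top (by simp) hC)]
  exact lintegral_mono fun x => enorm_kOpX_le hBm hD hf (x, v)

theorem lintegral_enorm_freeS_le {D : ℝ} (hD0 : 0 ≤ D) {ν : E3 → ℝ} (hν : ∀ v, 0 ≤ ν v)
    {h : E3 × E3 → ℝ} (hh : Measurable h) (w : E3) :
    ∫⁻ x, ‖freeS D ν h (x, w)‖ₑ ≤ ENNReal.ofReal D * ‖w‖ₑ⁻¹ * ∫⁻ x, ‖h (x, w)‖ₑ := by
  calc _ ≤ ∫⁻ x, ∫⁻ s in Set.Ioc 0 (D / ‖w‖), ‖h (x - s • w, w)‖ₑ :=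
        lintegral_mono fun x => enorm_freeS_le D hν h (x, w)
    _ = ∫⁻ s in Set.Ioc 0 (D / ‖w‖), ∫⁻ x, ‖h (x - s • w, w)‖ₑ :=
        lintegral_lintegral_swap (by simp only [Function.uncurry_def]; fun_prop)
    _ = ∫⁻ s in Set.Ioc 0 (D / ‖w‖), ∫⁻ x, ‖h (x, w)‖ₑ :=
        lintegral_congr fun s => lintegral_sub_right_eq_self (fun x => ‖h (x, w)‖ₑ) (s • w)
    _ = ENNReal.ofReal (D / ‖w‖) * ∫⁻ x, ‖h (x, w)‖ₑ := by
        rw [setLIntegral_const, Real.volume_Ioc, sub_zero, mul_comm]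
    _ ≤ _ := mul_le_mul' (ofReal_div_norm_le hD0 w) le_rfl

theorem lintegral_enorm_freeS_sq_le {D : ℝ} (hD0 : 0 ≤ D) {ν : E3 → ℝ} (hν : ∀ v, 0 ≤ ν v)
    {h : E3 × E3 → ℝ} (hh : Measurable h) (w : E3) :
    ∫⁻ x, ‖freeS D ν h (x, w)‖ₑ ^ 2 ≤
      (ENNReal.ofReal D * ‖w‖ₑ⁻¹) ^ 2 * ∫⁻ x, ‖h (x, w)‖ₑ ^ 2 := by
  set T := ENNReal.ofReal (D / ‖w‖)
  calc _ ≤ ∫⁻ x, T * ∫⁻ s in Set.Ioc 0 (D / ‖w‖), ‖h (x - s • w, w)‖ₑ ^ 2 := by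
        refine lintegral_mono fun x => ?_
        have h1 := sq_lintegral_mul_le (volume.restrict (Set.Ioc 0 (D / ‖w‖)))
          (k := fun _ => 1) (f := fun s => ‖h (x - s • w, w)‖ₑ) (by fun_prop) (by fun_prop)
        simp only [one_mul, lintegral_const, Measure.restrict_apply MeasurableSet.univ,
          Set.univ_inter, Real.volume_Ioc, sub_zero] at h1
        exact (pow_le_pow_left₀ bot_le (enorm_freeS_le D hν h (x, w)) 2).trans h1
    _ = T * ∫⁻ s in Set.Ioc 0 (D / ‖w‖), ∫⁻ x, ‖h (x - s • w, w)‖ₑ ^ 2 := by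
        rw [lintegral_const_mul' _ _ ENNReal.ofReal_ne_top, lintegral_lintegral_swap
          (by simp only [Function.uncurry_def]; fun_prop)]
    _ = T * ∫⁻ s in Set.Ioc 0 (D / ‖w‖), ∫⁻ x, ‖h (x, w)‖ₑ ^ 2 := by
        congr 1
        exact lintegral_congr fun s =>
          lintegral_sub_right_eq_self (fun x => ‖h (x, w)‖ₑ ^ 2) (s • w)
    _ = T ^ 2 * ∫⁻ x, ‖h (x, w)‖ₑ ^ 2 := by
        rw [setLIntegral_const, Real.volume_Ioc, sub_zero]
        ring
    _ ≤ _ := mul_le_mul' (pow_le_pow_left₀ bot_le (ofReal_div_norm_le hD0 w) 2) le_rfl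

/-- Absolute convergence of `K S K f` in the whole space, integrated over `x`. -/
theorem lintegral_gradKernel_modelSK_lt_top (hBm : Measurable (Function.uncurry B))
    (hD : KDominated B C) (hC : C ≠ ∞) (hν : ∀ v, 0 ≤ collFreq B v) {D : ℝ} (hD0 : 0 ≤ D)
    {Ω : Set E3} (hΩ : MeasurableSet Ω) (hΩf : volume Ω ≠ ∞) {f : E3 × E3 → ℝ}
    (hf : Measurable f) (h0 : ∀ x ∉ Ω, ∀ w, f (x, w) = 0)
    (hfin : ∫⁻ w, ∫⁻ x, ‖f (x, w)‖ₑ ^ 2 ≠ ∞) (v : E3) :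
    ∫⁻ x, ∫⁻ w, gradKernel (v - w) * ‖modelSK D B f (x, w)‖ₑ < ∞ := by
  obtain ⟨c, hc, hcb⟩ := exists_lintegral_gradKernel_inv_le
  set M := volume Ω * (∫⁻ w, gradKernel w ^ 2) + ∫⁻ w, ∫⁻ x, ‖f (x, w)‖ₑ ^ 2
  have hM : M ≠ ∞ := ENNReal.add_ne_top.2
    ⟨ENNReal.mul_ne_top hΩf lintegral_gradKernel_sq_lt_top.ne, hfin⟩
  have hm := measurable_modelSK hBm D hf
  calc _ = ∫⁻ w, gradKernel (v - w) * ∫⁻ x, ‖modelSK D B f (x, w)‖ₑ := by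
        rw [lintegral_lintegral_swap (by simp only [Function.uncurry_def]; fun_prop)]
        exact lintegral_congr fun w => lintegral_const_mul _ (by fun_prop)
    _ ≤ ∫⁻ w, gradKernel (v - w) * (ENNReal.ofReal D * ‖w‖ₑ⁻¹ * (3 * C * M)) := by
        refine lintegral_mono fun w => mul_le_mul' le_rfl ?_
        refine (lintegral_enorm_freeS_le hD0 hν (measurable_kOpX hBm hf) w).trans ?_
        refine mul_le_mul' le_rfl ((lintegral_enorm_kOpX_le hBm hD hC hf w).trans ?_)
        exact mul_le_mul' le_rfl (lintegral_gradKernel_mul_le hΩ hf h0 w)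
    _ = (∫⁻ w, gradKernel (v - w) * ‖w‖ₑ⁻¹) * (ENNReal.ofReal D * (3 * C * M)) := by
        rw [← lintegral_mul_const _ (by fun_prop)]
        refine lintegral_congr fun w => ?_
        ring
    _ < ∞ := ENNReal.mul_lt_top ((hcb v).trans_lt hc.lt_top)
        (ENNReal.mul_ne_top ENNReal.ofReal_ne_top
          (ENNReal.mul_ne_top (ENNReal.mul_ne_top (by simp) hC) hM)).lt_top

/-- The `L²` bound for `K S K` on the whole space. -/
theorem exists_lintegral_modelKSK_sq_le (hBm : Measurable (Function.uncurry B))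
    (hD : KDominated B C) (hC : C ≠ ∞) (hν : ∀ v, 0 ≤ collFreq B v) {D : ℝ} (hD0 : 0 ≤ D) :
    ∃ C' : ℝ≥0∞, C' ≠ ∞ ∧ ∀ f : E3 × E3 → ℝ, Measurable f →
      ∫⁻ v, ∫⁻ x, ‖modelKSK D B f (x, v)‖ₑ ^ 2 ≤ C' * ∫⁻ w, ∫⁻ x, ‖f (x, w)‖ₑ ^ 2 := by
  obtain ⟨c, hc, hcb⟩ := exists_lintegral_gradKernel_inv_le
  set N := ∫⁻ w, gradKernel w
  have hN : N ≠ ∞ := lintegral_gradKernel_lt_top.ne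
  set d := ENNReal.ofReal D
  refine ⟨(3 * C) ^ 2 * (c * (N * (d ^ 2 * ((3 * C) ^ 2 * (N * c))))), ?_, fun f hf => ?_⟩
  · have h3 : (3 * C) ^ 2 ≠ ∞ := ENNReal.pow_ne_top (ENNReal.mul_ne_top (by simp) hC)
    exact ENNReal.mul_ne_top h3 (ENNReal.mul_ne_top hc (ENNReal.mul_ne_top hN
      (ENNReal.mul_ne_top (ENNReal.pow_ne_top ENNReal.ofReal_ne_top)
        (ENNReal.mul_ne_top h3 (ENNReal.mul_ne_top hN hc)))))
  have h3 : (3 * C) ^ 2 ≠ ∞ := ENNReal.pow_ne_top (ENNReal.mul_ne_top (by simp) hC)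
  have hH := measurable_kOpX hBm hf
  have hU := measurable_modelSK hBm D hf
  have ne0 : ∀ᵐ w ∂(volume : Measure E3), w ≠ 0 := Measure.ae_ne volume 0
  have inv_mul : ∀ w : E3, w ≠ 0 → ‖w‖ₑ⁻¹ * ‖w‖ₑ = 1 := fun w hw =>
    ENNReal.inv_mul_cancel (by simpa using hw) (by simp)
  -- square of the first application of `K`
  have sH : ∀ x w, ‖kOpX B f (x, w)‖ₑ ^ 2 ≤
      (3 * C) ^ 2 * (N * ∫⁻ z, gradKernel (w - z) * ‖f (x, z)‖ₑ ^ 2) := by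
    intro x w
    refine (pow_le_pow_left₀ bot_le (enorm_kOpX_le hBm hD hf (x, w)) 2).trans ?_
    rw [mul_pow]
    refine mul_le_mul' le_rfl ((sq_lintegral_mul_le volume (by fun_prop) (by fun_prop)).trans ?_)
    rw [lintegral_gradKernel_sub]
  -- square of the second application of `K`
  have sA : ∀ x v, ‖modelKSK D B f (x, v)‖ₑ ^ 2 ≤
      (3 * C) ^ 2 * (c * ∫⁻ w, gradKernel (v - w) * (‖w‖ₑ * ‖modelSK D B f (x, w)‖ₑ ^ 2)) := by
    intro x v
    refine (pow_le_pow_left₀ bot_le (enorm_kOpX_le hBm hD hU (x, v)) 2).trans ?_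
    rw [mul_pow]
    refine mul_le_mul' le_rfl ?_
    -- Squared transport costs `|w|⁻²`, too singular to be paired with a single kernel uniformly in
    -- `v`. Here one `|w|⁻¹` goes to the outer kernel; the factor `|w|` left beside the square
    -- reduces `|w|⁻²` to the `|w|⁻¹` that the inner kernel absorbs.
    calc _ = (∫⁻ w, (gradKernel (v - w) * ‖w‖ₑ⁻¹) * (‖w‖ₑ * ‖modelSK D B f (x, w)‖ₑ)) ^ 2 := by
          congr 1
          refine lintegral_congr_ae ?_
          filter_upwards [ne0] with w hw
          rw [mul_assoc, ← mul_assoc _ ‖w‖ₑ, inv_mul w hw, one_mul]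
      _ ≤ _ := sq_lintegral_mul_le volume (by fun_prop) (by fun_prop)
      _ ≤ _ := by
          refine mul_le_mul' (hcb v) (le_of_eq (lintegral_congr_ae ?_))
          filter_upwards [ne0] with w hw
          rw [mul_pow, sq ‖w‖ₑ, mul_assoc, ← mul_assoc (‖w‖ₑ⁻¹), ← mul_assoc (‖w‖ₑ⁻¹),
            inv_mul w hw, one_mul]
  have sHx : ∀ w, ∫⁻ x, ‖kOpX B f (x, w)‖ₑ ^ 2 ≤
      (3 * C) ^ 2 * (N * ∫⁻ z, gradKernel (w - z) * ∫⁻ x, ‖f (x, z)‖ₑ ^ 2) := by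
    intro w
    refine (lintegral_mono fun x => sH x w).trans (le_of_eq ?_)
    rw [lintegral_const_mul' _ _ h3, lintegral_const_mul' _ _ hN,
      lintegral_lintegral_swap (by simp only [Function.uncurry_def]; fun_prop)]
    congr 3
    funext z
    exact lintegral_const_mul _ (by fun_prop)
  have mq : Measurable fun z => ∫⁻ x, ‖f (x, z)‖ₑ ^ 2 :=
    Measurable.lintegral_prod_left' (f := fun q : E3 × E3 => ‖f q‖ₑ ^ 2) (by fun_prop)
  have mqU : Measurable fun z => ∫⁻ x, ‖modelSK D B f (x, z)‖ₑ ^ 2 :=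
    Measurable.lintegral_prod_left' (f := fun q : E3 × E3 => ‖modelSK D B f q‖ₑ ^ 2) (by fun_prop)
  calc _ ≤ ∫⁻ v, ∫⁻ x, (3 * C) ^ 2 *
        (c * ∫⁻ w, gradKernel (v - w) * (‖w‖ₑ * ‖modelSK D B f (x, w)‖ₑ ^ 2)) :=
        lintegral_mono fun v => lintegral_mono fun x => sA x v
    _ = (3 * C) ^ 2 * (c * ∫⁻ v, ∫⁻ w, gradKernel (v - w) *
        (‖w‖ₑ * ∫⁻ x, ‖modelSK D B f (x, w)‖ₑ ^ 2)) := by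
        rw [← lintegral_const_mul' _ _ hc, ← lintegral_const_mul' _ _ h3]
        refine lintegral_congr fun v => ?_
        rw [lintegral_const_mul' _ _ h3, lintegral_const_mul' _ _ hc,
          lintegral_lintegral_swap (by simp only [Function.uncurry_def]; fun_prop)]
        congr 3
        funext w
        rw [lintegral_const_mul _ (by fun_prop), lintegral_const_mul _ (by fun_prop)]
    _ = (3 * C) ^ 2 * (c * ∫⁻ w, N * (‖w‖ₑ * ∫⁻ x, ‖modelSK D B f (x, w)‖ₑ ^ 2)) := by
        rw [lintegral_lintegral_swap (by simp only [Function.uncurry_def]; fun_prop)]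
        congr 3
        funext w
        rw [lintegral_mul_const _ (by fun_prop), lintegral_gradKernel_sub']
    _ ≤ (3 * C) ^ 2 * (c * ∫⁻ w, N * (d ^ 2 * (‖w‖ₑ⁻¹ * ((3 * C) ^ 2 *
        (N * ∫⁻ z, gradKernel (w - z) * ∫⁻ x, ‖f (x, z)‖ₑ ^ 2))))) := by
        refine mul_le_mul' le_rfl (mul_le_mul' le_rfl (lintegral_mono_ae ?_))
        filter_upwards [ne0] with w hw
        refine mul_le_mul' le_rfl ?_
        calc _ ≤ ‖w‖ₑ * ((d * ‖w‖ₑ⁻¹) ^ 2 * ∫⁻ x, ‖kOpX B f (x, w)‖ₑ ^ 2) :=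
              mul_le_mul' le_rfl (lintegral_enorm_freeS_sq_le hD0 hν hH w)
          _ = d ^ 2 * ((‖w‖ₑ⁻¹ * ‖w‖ₑ) * ‖w‖ₑ⁻¹ * ∫⁻ x, ‖kOpX B f (x, w)‖ₑ ^ 2) := by ring
          _ ≤ _ := by
              rw [inv_mul w hw, one_mul]
              exact mul_le_mul' le_rfl (mul_le_mul' le_rfl (sHx w))
    _ = (3 * C) ^ 2 * (c * (N * (d ^ 2 * ((3 * C) ^ 2 * (N * ∫⁻ w, ∫⁻ z,
          (gradKernel (z - w) * ‖w‖ₑ⁻¹) * ∫⁻ x, ‖f (x, z)‖ₑ ^ 2))))) := by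
        have hd : d ^ 2 ≠ ∞ := ENNReal.pow_ne_top ENNReal.ofReal_ne_top
        rw [lintegral_const_mul' _ _ hN, lintegral_const_mul' _ _ hd,
          ← lintegral_const_mul' _ _ hN, ← lintegral_const_mul' _ _ h3]
        congr 5
        funext w
        simp only [mul_right_comm _ (‖w‖ₑ⁻¹)]
        rw [lintegral_mul_const _ (by fun_prop)]
        simp only [gradKernel_sub_comm w]
        ring
    _ ≤ (3 * C) ^ 2 * (c * (N * (d ^ 2 * ((3 * C) ^ 2 * (N * ∫⁻ z,
          c * ∫⁻ x, ‖f (x, z)‖ₑ ^ 2))))) := by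
        rw [lintegral_lintegral_swap (by simp only [Function.uncurry_def]; fun_prop)]
        refine mul_le_mul' le_rfl (mul_le_mul' le_rfl (mul_le_mul' le_rfl (mul_le_mul' le_rfl
          (mul_le_mul' le_rfl (mul_le_mul' le_rfl (lintegral_mono fun z => ?_))))))
        rw [lintegral_mul_const _ (by fun_prop)]
        exact mul_le_mul' (hcb z) le_rfl
    _ = _ := by
        rw [lintegral_const_mul' _ _ hc]
        ring

/-- The Fourier side estimate: a gain of `|ξ|^(1/2)` in `L²`. -/
theorem exists_lintegral_pFourier_modelKSK_le (hBm : Measurable (Function.uncurry B))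
    (hD : KDominated B C) (hC : C ≠ ∞) (hν : ∀ v, 0 ≤ collFreq B v) {D : ℝ} (hD0 : 0 ≤ D)
    {Ω : Set E3} (hΩ : MeasurableSet Ω) (hΩf : volume Ω ≠ ∞) :
    ∃ C' : ℝ≥0∞, C' ≠ ∞ ∧ ∀ f : E3 × E3 → ℝ, Measurable f → (∀ x ∉ Ω, ∀ w, f (x, w) = 0) →
      ∫⁻ w, ∫⁻ x, ‖f (x, w)‖ₑ ^ 2 ≠ ∞ → ∀ ξ : E3, ξ ≠ 0 →
      ∫⁻ v, ‖pFourier (modelKSK D B f) ξ v‖ₑ ^ 2 ≤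
        C' * ‖ξ‖ₑ⁻¹ * ∫⁻ w, ‖pFourier f ξ w‖ₑ ^ 2 := by
  obtain ⟨c, hc, hcb⟩ := lintegral_gradKernel_weight_le
  set N := ∫⁻ w, gradKernel w
  have hN : N ≠ ∞ := lintegral_gradKernel_lt_top.ne
  set d := ENNReal.ofReal D
  have h3 : 3 * C ≠ ∞ := ENNReal.mul_ne_top (by simp) hC
  refine ⟨(3 * C) ^ 4 * d * (c ^ 2 * N ^ 2), ?_, fun f hf h0 hfin ξ hξ => ?_⟩
  · exact ENNReal.mul_ne_top (ENNReal.mul_ne_top (ENNReal.pow_ne_top h3) ENNReal.ofReal_ne_top)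
      (ENNReal.mul_ne_top (ENNReal.pow_ne_top hc) (ENNReal.pow_ne_top hN))
  have hξ' : 0 < ‖ξ‖ := norm_pos_iff.2 hξ
  set ω : E3 := ‖ξ‖⁻¹ • ξ
  have hω : ‖ω‖ = 1 := by rw [norm_smul, norm_inv, norm_norm, inv_mul_cancel₀ hξ'.ne']
  set μ : E3 → ℝ≥0∞ := fun w => ‖w‖ₑ ^ (-(1 / 2) : ℝ) * ‖inner ℝ w ω‖ₑ ^ (-(1 / 2) : ℝ)
  have hμ : Measurable μ := by fun_prop
  set e : ℝ≥0∞ := d ^ (1 / 2 : ℝ) * ‖ξ‖ₑ⁻¹ ^ (1 / 2 : ℝ)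
  have half : ∀ x : ℝ≥0∞, x ^ (1 / 2 : ℝ) * x ^ (1 / 2 : ℝ) = x := fun x => by
    rw [← ENNReal.rpow_add_of_nonneg _ _ (by norm_num) (by norm_num)]; norm_num
  have he : e ^ 2 = d * ‖ξ‖ₑ⁻¹ := by rw [mul_pow, sq, sq, half, half]
  have hH := measurable_kOpX hBm hf
  have hU := measurable_modelSK hBm D hf
  have finf : ∀ v, ∫⁻ x, ∫⁻ w, gradKernel (v - w) * ‖f (x, w)‖ₑ < ∞ := fun v =>
    (lintegral_gradKernel_mul_le hΩ hf h0 v).trans_lt (ENNReal.add_lt_top.2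
      ⟨(ENNReal.mul_ne_top hΩf lintegral_gradKernel_sq_lt_top.ne).lt_top, hfin.lt_top⟩)
  have finH : ∀ v, ∫⁻ x, ‖kOpX B f (x, v)‖ₑ < ∞ := fun v =>
    (lintegral_enorm_kOpX_le hBm hD hC hf v).trans_lt (ENNReal.mul_lt_top h3.lt_top (finf v))
  have bU : ∀ w, ‖pFourier (modelSK D B f) ξ w‖ₑ ≤ e * (3 * C) *
      (μ w * ∫⁻ z, gradKernel (w - z) * ‖pFourier f ξ z‖ₑ) := by
    intro w
    rw [modelSK, pFourier_freeS (measurable_collFreq hBm) hν hH (finH w), enorm_mul]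
    obtain ⟨m1, m2⟩ := enorm_transportMultiplier_le (T := D / ‖w‖) (b := inner ℝ w ξ)
      (by positivity) (hν w)
    set m := ‖transportMultiplier (D / ‖w‖) (collFreq B w) (inner ℝ w ξ)‖ₑ
    -- Geometric mean of the two multiplier bounds. The constant satisfies `e² = D/|ξ|`, which is
    -- the gain of the theorem.
    have hm : m ≤ e * μ w := by
      have m1' := m1.trans (ofReal_div_norm_le hD0 w)
      have hin : ‖inner ℝ w ξ‖ₑ = ‖ξ‖ₑ * ‖inner ℝ w ω‖ₑ := by
        have : inner ℝ w ξ = ‖ξ‖ * inner ℝ w ω := by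
          rw [real_inner_smul_right, ← mul_assoc, mul_inv_cancel₀ hξ'.ne', one_mul]
        rw [this, enorm_mul, enorm_norm]
      calc m = m ^ (1 / 2 : ℝ) * m ^ (1 / 2 : ℝ) := (half m).symm
        _ ≤ (d * ‖w‖ₑ⁻¹) ^ (1 / 2 : ℝ) * (‖inner ℝ w ξ‖ₑ⁻¹) ^ (1 / 2 : ℝ) :=
            mul_le_mul' (ENNReal.rpow_le_rpow m1' (by norm_num))
              (ENNReal.rpow_le_rpow m2 (by norm_num))
        _ = _ := by
            rw [hin, ENNReal.mul_inv (Or.inr (by simp)) (Or.inl (by simp)),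
              ENNReal.mul_rpow_of_nonneg _ _ (by norm_num),
              ENNReal.mul_rpow_of_nonneg _ _ (by norm_num)]
            simp only [e, μ, ENNReal.rpow_neg, ENNReal.inv_rpow]
            ring
    calc _ ≤ (e * μ w) * (3 * C * ∫⁻ z, gradKernel (w - z) * ‖pFourier f ξ z‖ₑ) :=
          mul_le_mul' hm (enorm_pFourier_kOp_le hBm hD hC hf (finf w) ξ)
      _ = _ := by ring
  have bA : ∀ v, ‖pFourier (modelKSK D B f) ξ v‖ₑ ≤ (3 * C * (e * (3 * C))) *
      ∫⁻ w, gradKernel (v - w) * (μ w * ∫⁻ z, gradKernel (w - z) * ‖pFourier f ξ z‖ₑ) := by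
    intro v
    refine (enorm_pFourier_kOp_le hBm hD hC hU
      (lintegral_gradKernel_modelSK_lt_top hBm hD hC hν hD0 hΩ hΩf hf h0 hfin v) ξ).trans ?_
    have he3 : e * (3 * C) ≠ ∞ := by
      refine ENNReal.mul_ne_top (ENNReal.mul_ne_top ?_ ?_) h3
      · exact ENNReal.rpow_ne_top_of_nonneg (by norm_num) ENNReal.ofReal_ne_top
      · exact ENNReal.rpow_ne_top_of_nonneg (by norm_num) (ENNReal.inv_ne_top.2 (by simpa using hξ))
    rw [mul_assoc (3 * C), ← lintegral_const_mul' _ _ he3]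
    refine mul_le_mul' le_rfl (lintegral_mono fun w => ?_)
    rw [mul_left_comm]
    exact mul_le_mul' le_rfl (bU w)
  have mf0 : Measurable (pFourier f ξ) :=
    Measurable.of_uncurry_left (f := pFourier f) (measurable_pFourier hf)
  have mf : Measurable fun z => ‖pFourier f ξ z‖ₑ := mf0.enorm
  have m1 : Measurable fun w => ∫⁻ z, gradKernel (w - z) * ‖pFourier f ξ z‖ₑ := by
    have mk : Measurable fun q : E3 × E3 => gradKernel (q.1 - q.2) := by fun_prop
    exact Measurable.lintegral_prod_right'
      (f := fun q : E3 × E3 => gradKernel (q.1 - q.2) * ‖pFourier f ξ q.2‖ₑ)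
      (mk.mul (mf.comp measurable_snd))
  have mI : Measurable fun v => ∫⁻ w, gradKernel (v - w) *
      (μ w * ∫⁻ z, gradKernel (w - z) * ‖pFourier f ξ z‖ₑ) := by
    have mk : Measurable fun q : E3 × E3 => gradKernel (q.1 - q.2) := by fun_prop
    exact Measurable.lintegral_prod_right' (f := fun q : E3 × E3 => gradKernel (q.1 - q.2) *
      (μ q.2 * ∫⁻ z, gradKernel (q.2 - z) * ‖pFourier f ξ z‖ₑ))
      (mk.mul ((hμ.comp measurable_snd).mul (m1.comp measurable_snd)))
  calc _ ≤ ∫⁻ v, (3 * C * (e * (3 * C))) ^ 2 * (∫⁻ w, gradKernel (v - w) *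
        (μ w * ∫⁻ z, gradKernel (w - z) * ‖pFourier f ξ z‖ₑ)) ^ 2 := by
        refine lintegral_mono fun v => ?_
        rw [← mul_pow]
        exact pow_le_pow_left₀ bot_le (bA v) 2
    _ = (3 * C * (e * (3 * C))) ^ 2 * ∫⁻ v, (∫⁻ w, gradKernel (v - w) *
        (μ w * ∫⁻ z, gradKernel (w - z) * ‖pFourier f ξ z‖ₑ)) ^ 2 :=
        lintegral_const_mul _ (mI.pow_const 2)
    _ ≤ (3 * C * (e * (3 * C))) ^ 2 * (c ^ 2 * N ^ 2 * ∫⁻ z, ‖pFourier f ξ z‖ₑ ^ 2) :=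
        mul_le_mul' le_rfl (lintegral_conv_weight_conv_sq_le hμ mf fun v => hcb v ω hω)
    _ = (3 * C) ^ 4 * e ^ 2 * (c ^ 2 * N ^ 2 * ∫⁻ z, ‖pFourier f ξ z‖ₑ ^ 2) := by ring
    _ = _ := by
        rw [he]
        ring

/-- The `H^{1/2}` bound for `K S K` on the whole space. -/
theorem exists_slobodeckij_modelKSK_le (hBm : Measurable (Function.uncurry B))
    (hD : KDominated B C) (hC : C ≠ ∞) (hν : ∀ v, 0 ≤ collFreq B v) {D : ℝ} (hD0 : 0 ≤ D)
    {Ω : Set E3} (hΩ : MeasurableSet Ω) (hΩf : volume Ω ≠ ∞) :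
    ∃ C' : ℝ≥0∞, C' ≠ ∞ ∧ ∀ f : E3 × E3 → ℝ, Measurable f → (∀ x ∉ Ω, ∀ w, f (x, w) = 0) →
      ∫⁻ w, ∫⁻ x, ‖f (x, w)‖ₑ ^ 2 ≠ ∞ →
      ∫⁻ v, ∫⁻ y, ∫⁻ x, ‖modelKSK D B f (x, v) - modelKSK D B f (y, v)‖ₑ ^ 2 / ‖x - y‖ₑ ^ 4 ≤
        C' * ∫⁻ w, ∫⁻ x, ‖f (x, w)‖ₑ ^ 2 := by
  obtain ⟨C1, hC1, b1⟩ := slobodeckij_half_le_fourier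
  obtain ⟨C2, hC2, b2⟩ := exists_lintegral_pFourier_modelKSK_le hBm hD hC hν hD0 hΩ hΩf
  obtain ⟨C3, hC3, b3⟩ := exists_lintegral_modelKSK_sq_le hBm hD hC hν hD0
  refine ⟨C1 * C2, ENNReal.mul_ne_top hC1 hC2, fun f hf h0 hfin => ?_⟩
  have hU := measurable_modelSK hBm D hf
  have hA : Measurable (modelKSK D B f) := measurable_kOpX hBm hU
  have memLp_of : ∀ g : E3 → ℝ, Measurable g → ∫⁻ x, ‖g x‖ₑ ^ 2 < ∞ →
      MemLp (fun x => (g x : ℂ)) 2 := by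
    intro g hg hg2
    have : MemLp g 2 := by
      refine ⟨hg.aestronglyMeasurable, ?_⟩
      rw [eLpNorm_lt_top_iff_lintegral_rpow_enorm_lt_top (by norm_num) (by norm_num)]
      simpa using hg2
    exact this.ofReal
  have mA2 : Measurable fun v => ∫⁻ x, ‖modelKSK D B f (x, v)‖ₑ ^ 2 :=
    Measurable.lintegral_prod_left' (f := fun q : E3 × E3 => ‖modelKSK D B f q‖ₑ ^ 2) (by fun_prop)
  have mf2 : Measurable fun v => ∫⁻ x, ‖f (x, v)‖ₑ ^ 2 :=
    Measurable.lintegral_prod_left' (f := fun q : E3 × E3 => ‖f q‖ₑ ^ 2) (by fun_prop)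
  -- The `L²` bound puts almost every velocity slice in `L²`, as the Fourier description of the
  -- seminorm requires.
  have aeA : ∀ᵐ v, ∫⁻ x, ‖modelKSK D B f (x, v)‖ₑ ^ 2 < ∞ :=
    ae_lt_top mA2 ((b3 f hf).trans_lt (ENNReal.mul_ne_top hC3 hfin).lt_top).ne
  have aef : ∀ᵐ w, ∫⁻ x, ‖f (x, w)‖ₑ ^ 2 < ∞ := ae_lt_top mf2 hfin
  have mFA : Measurable fun q : E3 × E3 => pFourier (modelKSK D B f) q.1 q.2 :=
    measurable_pFourier hA
  have mFf : Measurable fun q : E3 × E3 => pFourier f q.1 q.2 := measurable_pFourier hf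
  calc _ ≤ ∫⁻ v, C1 * ∫⁻ ξ, ‖ξ‖ₑ * ‖pFourier (modelKSK D B f) ξ v‖ₑ ^ 2 := by
        refine lintegral_mono_ae ?_
        filter_upwards [aeA] with v hv
        have hm : Measurable fun x => ((modelKSK D B f (x, v) : ℝ) : ℂ) := by fun_prop
        have hi : Integrable fun x => ((modelKSK D B f (x, v) : ℝ) : ℂ) := by
          refine Integrable.ofReal ⟨(by fun_prop : Measurable fun x =>
            modelKSK D B f (x, v)).aestronglyMeasurable, ?_⟩
          exact (lintegral_enorm_kOpX_le hBm hD hC hU v).trans_lt (ENNReal.mul_lt_top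
            (ENNReal.mul_ne_top (by simp) hC).lt_top
            (lintegral_gradKernel_modelSK_lt_top hBm hD hC hν hD0 hΩ hΩf hf h0 hfin v))
        have h := b1 _ hm hi (memLp_of (fun x => modelKSK D B f (x, v)) (by fun_prop) hv)
        refine le_trans (le_of_eq ?_) h
        refine lintegral_congr fun y => lintegral_congr fun x => ?_
        rw [← Complex.ofReal_sub, ← ofReal_norm (Complex.ofReal _), Complex.norm_real, ofReal_norm]
    _ = C1 * ∫⁻ ξ, ‖ξ‖ₑ * ∫⁻ v, ‖pFourier (modelKSK D B f) ξ v‖ₑ ^ 2 := by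
        rw [lintegral_const_mul' _ _ hC1,
          lintegral_lintegral_swap (by simp only [Function.uncurry_def]; fun_prop)]
        congr 2
        funext ξ
        exact lintegral_const_mul' _ _ (by simp)
    -- The weight `|ξ|` of the seminorm is cancelled exactly by the gain `|ξ|⁻¹`; the excluded
    -- frequency `ξ = 0` is a null set.
    _ ≤ C1 * ∫⁻ ξ, C2 * ∫⁻ w, ‖pFourier f ξ w‖ₑ ^ 2 := by
        refine mul_le_mul' le_rfl (lintegral_mono_ae ?_)
        filter_upwards [Measure.ae_ne volume (0 : E3)] with ξ hξ
        refine (mul_le_mul' le_rfl (b2 f hf h0 hfin ξ hξ)).trans (le_of_eq ?_)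
        rw [mul_assoc, mul_left_comm, ← mul_assoc ‖ξ‖ₑ,
          ENNReal.mul_inv_cancel (by simpa using hξ) (by simp), one_mul]
    _ = C1 * (C2 * ∫⁻ w, ∫⁻ ξ, ‖pFourier f ξ w‖ₑ ^ 2) := by
        rw [lintegral_const_mul' _ _ hC2,
          lintegral_lintegral_swap (by simp only [Function.uncurry_def]; fun_prop)]
    _ = C1 * (C2 * ∫⁻ w, ∫⁻ x, ‖f (x, w)‖ₑ ^ 2) := by
        congr 2
        refine lintegral_congr_ae ?_
        filter_upwards [aef] with w hw
        -- The slice is square integrable and vanishes off a set of finite measure, hence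
        -- integrable, and Plancherel returns to the space side.
        have hi : Integrable fun x => ((f (x, w) : ℝ) : ℂ) := by
          refine Integrable.ofReal ⟨(by fun_prop : Measurable fun x =>
            f (x, w)).aestronglyMeasurable, ?_⟩
          calc _ ≤ ∫⁻ x, (Ω.indicator 1 x + ‖f (x, w)‖ₑ ^ 2) := by
                refine lintegral_mono fun x => ?_
                by_cases hx : x ∈ Ω
                · rw [Set.indicator_of_mem hx]
                  simpa using mul_le_sq_add_sq 1 ‖f (x, w)‖ₑ
                · simp [h0 x hx w]
            _ = volume Ω + ∫⁻ x, ‖f (x, w)‖ₑ ^ 2 := by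
                rw [lintegral_add_right _ (by fun_prop), lintegral_indicator_one hΩ]
            _ < ∞ := ENNReal.add_lt_top.2 ⟨hΩf.lt_top, hw⟩
        have h := lintegral_enorm_fourier_sq hi (memLp_of (fun x => f (x, w)) (by fun_prop) hw)
        refine h.trans (lintegral_congr fun x => ?_)
        rw [← ofReal_norm, Complex.norm_real, ofReal_norm]
    _ = _ := (mul_assoc _ _ _).symm

end

/-! ### Transport in a convex domain -/

/-- By convexity a backward ray that is still in `Ω` at some time has not left it before. Openness
leaves a margin `δ/2` beyond `s`, which makes the comparison with the exit time strict. -/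
theorem mem_travelTimes_iff {Ω : Set E3} (hΩo : IsOpen Ω) (hΩc : Convex ℝ Ω) {x v : E3}
    (hx : x ∈ Ω) {s : ℝ} : s ∈ travelTimes Ω x v ↔ 0 < s ∧ x - s • v ∈ Ω := by
  refine and_congr_right fun hs => ⟨fun h => ?_, fun h => ?_⟩
  · by_contra hn
    exact absurd h (not_lt.2 (iInf_le_of_le s (iInf_le_of_le hs (iInf_le _ hn))))
  · have hc : ContinuousAt (fun t : ℝ => x - t • v) s := by fun_prop
    obtain ⟨δ, hδ, hb⟩ := Metric.mem_nhds_iff.1 (hc (hΩo.mem_nhds h))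
    have h2 : x - (s + δ / 2) • v ∈ Ω := hb (by
      rw [Metric.mem_ball, Real.dist_eq, add_sub_cancel_left, abs_of_pos (by positivity)]
      linarith)
    have hle : ENNReal.ofReal (s + δ / 2) ≤ exitTime Ω x v := by
      refine le_iInf fun t => le_iInf fun ht => le_iInf fun htn => ENNReal.ofReal_le_ofReal ?_
      by_contra! hlt
      refine htn ?_
      have hp : 0 < s + δ / 2 := by positivity
      have := hΩc hx h2 (a := 1 - t / (s + δ / 2)) (b := t / (s + δ / 2))
        (by rw [sub_nonneg, div_le_one hp]; exact hlt.le) (by positivity) (by ring)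
      convert this using 1
      rw [smul_sub, smul_smul, div_mul_cancel₀ _ hp.ne', sub_smul, one_smul]
      abel
    exact ((ENNReal.ofReal_lt_ofReal_iff (by positivity)).2 (by linarith)).trans_le hle

/-- Integration up to the exit time becomes integration over a fixed interval with the indicator of
`Ω` along the ray, and that indicator is built into any integrand extended by zero. -/
theorem travelTimes_eq {Ω : Set E3} (hΩo : IsOpen Ω) (hΩc : Convex ℝ Ω) {D : ℝ}
    (hD : ∀ x ∈ Ω, ∀ y ∈ Ω, ‖x - y‖ ≤ D) {x v : E3} (hx : x ∈ Ω) (hv : v ≠ 0) :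
    travelTimes Ω x v = Set.Ioc 0 (D / ‖v‖) ∩ (fun s : ℝ => x - s • v) ⁻¹' Ω := by
  ext s
  rw [mem_travelTimes_iff hΩo hΩc hx]
  refine ⟨fun ⟨h1, h2⟩ => ⟨⟨h1, ?_⟩, h2⟩, fun ⟨h1, h2⟩ => ⟨h1.1, h2⟩⟩
  rw [le_div_iff₀ (norm_pos_iff.2 hv)]
  have := hD x hx _ h2
  rwa [sub_sub_cancel, norm_smul, Real.norm_of_nonneg h1.le] at this

theorem phaseMeasure_eq (Ω : Set E3) :
    phaseMeasure Ω = (volume : Measure (E3 × E3)).restrict (Ω ×ˢ Set.univ) := by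
  rw [phaseMeasure, Measure.volume_eq_prod, ← Measure.prod_restrict, Measure.restrict_univ]

theorem ae_phaseMeasure {Ω : Set E3} {p : E3 × E3 → Prop} (h : ∀ᵐ z, p z) :
    ∀ᵐ z ∂phaseMeasure Ω, p z := by
  rw [phaseMeasure_eq]; exact ae_restrict_of_ae h

theorem ae_phaseMeasure_iff {Ω : Set E3} (hΩ : MeasurableSet Ω) {p : E3 × E3 → Prop} :
    (∀ᵐ z ∂phaseMeasure Ω, p z) ↔ ∀ᵐ z : E3 × E3, z.1 ∈ Ω → p z := by
  rw [phaseMeasure_eq, ae_restrict_iff' (hΩ.prod MeasurableSet.univ)]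
  simp

theorem ae_snd_ne_zero : ∀ᵐ z : E3 × E3, z.2 ≠ 0 := by
  have h : ∀ᵐ v : E3, v ≠ 0 := Measure.ae_ne volume 0
  exact Measure.quasiMeasurePreserving_snd.ae h

/-- Joint almost everywhere statements from slices at fixed velocity. -/
theorem ae_of_ae_slice {p : E3 × E3 → Prop} (hp : MeasurableSet {z | p z})
    (h : ∀ᵐ v : E3, ∀ᵐ x : E3, p (x, v)) : ∀ᵐ z, p z := by
  rw [Measure.volume_eq_prod, Measure.ae_prod_iff_ae_ae hp]
  exact (Measure.ae_ae_comm (p := fun x v => p (x, v)) hp).2 h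

/-- A property valid almost everywhere is valid almost everywhere along almost every
trajectory. -/
theorem ae_ae_transport {p : E3 × E3 → Prop} (h : ∀ᵐ z, p z) :
    ∀ᵐ z : E3 × E3, ∀ᵐ s : ℝ, p (z.1 - s • z.2, z.2) := by
  set N := toMeasurable volume {z | ¬ p z}
  have hN : MeasurableSet N := measurableSet_toMeasurable _ _
  have hN0 : volume N = 0 := by rw [measure_toMeasurable]; exact ae_iff.1 h
  have hNp : ∀ z, z ∉ N → p z := fun z hz => by
    by_contra hn
    exact hz (subset_toMeasurable _ _ hn)
  have key : ∀ᵐ z : E3 × E3, ∀ᵐ s : ℝ, (z.1 - s • z.2, z.2) ∉ N := by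
    have mq : Measurable fun q : (E3 × E3) × ℝ => (q.1.1 - q.2 • q.1.2, q.1.2) := by fun_prop
    -- At fixed `s` the shear `(x, v) ↦ (x - s v, v)` is a translation on each velocity slice, so it
    -- preserves null sets; Fubini then exchanges `s` and `(x, v)`.
    refine (Measure.ae_ae_comm (p := fun (z : E3 × E3) (s : ℝ) => (z.1 - s • z.2, z.2) ∉ N)
      (mq hN.compl)).2 (ae_of_all _ fun s => ?_)
    have ms : Measurable fun z : E3 × E3 => (z.1 - s • z.2, z.2) := by fun_prop
    refine ae_of_ae_slice (ms hN.compl) ?_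
    have h1 : ∀ᵐ z : E3 × E3, z ∉ N := measure_eq_zero_iff_ae_notMem.1 hN0
    have h2 : ∀ᵐ v : E3, ∀ᵐ x : E3, (x, v) ∉ N := by
      rw [Measure.volume_eq_prod, Measure.ae_prod_iff_ae_ae hN.compl] at h1
      exact (Measure.ae_ae_comm (p := fun x v => (x, v) ∉ N) hN.compl).1 h1
    filter_upwards [h2] with v hv
    exact (measurePreserving_sub_right volume (s • v)).quasiMeasurePreserving.ae hv
  filter_upwards [key] with z hz
  filter_upwards [hz] with s hs using hNp _ hs

/-- For fixed `v`, translation invariance makes the `x`-integral of the ray integrals equal to the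
travel time times the `L¹` norm of the slice, which is finite. -/
theorem ae_integrableOn_transportIntegrand {D : ℝ} {ν : E3 → ℝ} (hνm : Measurable ν)
    (hν : ∀ v, 0 ≤ ν v) {G : E3 × E3 → ℝ} (hG : Measurable G)
    (hfin : ∀ v, ∫⁻ x, ‖G (x, v)‖ₑ < ∞) :
    ∀ᵐ z : E3 × E3, IntegrableOn (transportIntegrand ν G z) (Set.Ioc 0 (D / ‖z.2‖)) := by
  have mJ : Measurable fun z : E3 × E3 =>
      ∫⁻ s in Set.Ioc 0 (D / ‖z.2‖), ‖G (z.1 - s • z.2, z.2)‖ₑ := by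
    have h1 : MeasurableSet {q : (E3 × E3) × ℝ | 0 < q.2} :=
      measurableSet_lt measurable_const measurable_snd
    have h2 : MeasurableSet {q : (E3 × E3) × ℝ | q.2 ≤ D / ‖q.1.2‖} :=
      measurableSet_le measurable_snd (by fun_prop)
    have hm : Measurable fun q : (E3 × E3) × ℝ => ‖G (q.1.1 - q.2 • q.1.2, q.1.2)‖ₑ := by fun_prop
    have := (hm.indicator (h1.inter h2)).lintegral_prod_right' (ν := volume)
    convert this using 2 with z
    rw [← lintegral_indicator measurableSet_Ioc]
    rfl
  have fin : ∀ᵐ z : E3 × E3, ∫⁻ s in Set.Ioc 0 (D / ‖z.2‖), ‖G (z.1 - s • z.2, z.2)‖ₑ < ∞ := by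
    refine ae_of_ae_slice (measurableSet_lt mJ measurable_const) (ae_of_all _ fun v => ?_)
    refine ae_lt_top (mJ.comp measurable_prodMk_right) (ne_of_lt ?_)
    calc ∫⁻ x, ∫⁻ s in Set.Ioc 0 (D / ‖v‖), ‖G (x - s • v, v)‖ₑ
        = ∫⁻ s in Set.Ioc 0 (D / ‖v‖), ∫⁻ x, ‖G (x - s • v, v)‖ₑ :=
          lintegral_lintegral_swap (by simp only [Function.uncurry_def]; fun_prop)
      _ = ∫⁻ s in Set.Ioc 0 (D / ‖v‖), ∫⁻ x, ‖G (x, v)‖ₑ :=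
          lintegral_congr fun s => lintegral_sub_right_eq_self (fun x => ‖G (x, v)‖ₑ) (s • v)
      _ < ∞ := by
          rw [setLIntegral_const, Real.volume_Ioc]
          exact ENNReal.mul_lt_top (hfin v) ENNReal.ofReal_lt_top
  filter_upwards [fin] with z hz
  have hm : Measurable fun s => transportIntegrand ν G z s :=
    Measurable.of_uncurry_left (f := transportIntegrand ν G) (measurable_transportIntegrand hνm hG)
  exact ⟨hm.aestronglyMeasurable, (setLIntegral_mono' measurableSet_Ioc fun s hs =>
    enorm_transportIntegrand_le hν G z hs.1.le).trans_lt hz⟩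

/-- On a convex domain `S_Ω` agrees with transport on the whole space. -/
theorem ae_opS_eq_freeS {Ω : Set E3} (hΩo : IsOpen Ω) (hΩc : Convex ℝ Ω) {D : ℝ}
    (hD : ∀ x ∈ Ω, ∀ y ∈ Ω, ‖x - y‖ ≤ D) {ν : E3 → ℝ} (hνm : Measurable ν)
    (hν : ∀ v, 0 ≤ ν v) {F G : E3 × E3 → ℝ} (hG : Measurable G)
    (h0 : ∀ x ∉ Ω, ∀ w, G (x, w) = 0) (hfin : ∀ v, ∫⁻ x, ‖G (x, v)‖ₑ < ∞)
    (hFG : F =ᵐ[phaseMeasure Ω] G) :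
    ∀ᵐ z ∂phaseMeasure Ω, IntegrableOn (transportIntegrand ν F z) (travelTimes Ω z.1 z.2) ∧
      opS Ω ν F z = freeS D ν G z := by
  have hFG' := (ae_phaseMeasure_iff hΩo.measurableSet).1 hFG
  refine (ae_phaseMeasure_iff hΩo.measurableSet).2 ?_
  filter_upwards [ae_ae_transport hFG', ae_snd_ne_zero,
    ae_integrableOn_transportIntegrand (D := D) hνm hν hG hfin] with z hz hv hi hx
  have hT := travelTimes_eq hΩo hΩc hD hx hv
  have hTm : MeasurableSet (travelTimes Ω z.1 z.2) := by
    rw [hT]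
    exact measurableSet_Ioc.inter ((by fun_prop : Measurable fun s : ℝ => z.1 - s • z.2)
      hΩo.measurableSet)
  have hsub : travelTimes Ω z.1 z.2 ⊆ Set.Ioc 0 (D / ‖z.2‖) := hT ▸ Set.inter_subset_left
  have hae : transportIntegrand ν G z =ᵐ[volume.restrict (travelTimes Ω z.1 z.2)]
      transportIntegrand ν F z := by
    filter_upwards [ae_restrict_mem hTm, ae_restrict_of_ae hz] with s hs hs'
    rw [hT] at hs
    rw [transportIntegrand, transportIntegrand, hs' hs.2]
  refine ⟨(hi.mono_set hsub).congr hae, ?_⟩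
  rw [opS, ← integral_congr_ae hae, freeS]
  -- Times of the interval outside `travelTimes` correspond to points outside `Ω`, where `G`
  -- vanishes.
  refine (setIntegral_eq_of_subset_of_forall_sdiff_eq_zero measurableSet_Ioc hsub
    fun s hs => ?_).symm
  have : z.1 - s • z.2 ∉ Ω := fun h => hs.2 (hT ▸ ⟨hs.1, h⟩)
  rw [transportIntegrand, h0 _ this, mul_zero]

section

variable {B : ℝ → ℝ → ℝ} {C : ℝ≥0∞}

/-- Almost everywhere convergence of `K F`, when `F` agrees almost everywhere with a function `U`
integrable against the dominating kernel. -/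
theorem ae_opK_eq_kOpX (hBm : Measurable (Function.uncurry B)) (hD : KDominated B C)
    (hC : C ≠ ∞) {Ω : Set E3} {F U : E3 × E3 → ℝ} (hU : Measurable U)
    (hfin : ∀ v, ∫⁻ x, ∫⁻ w, gradKernel (v - w) * ‖U (x, w)‖ₑ < ∞)
    (hFU : F =ᵐ[phaseMeasure Ω] U) :
    ∀ᵐ z ∂phaseMeasure Ω, CollConverges B (fun w => F (z.1, w)) z.2 ∧
      (∀ i, Integrable (fun p => kWeight B i z.2 p * U (z.1, kPoint i z.2 p)) collMeasure) ∧
      opK B F z = kOpX B U z := by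
  have mJ : Measurable fun z : E3 × E3 => ∫⁻ w, gradKernel (z.2 - w) * ‖U (z.1, w)‖ₑ :=
    Measurable.lintegral_prod_right' (f := fun q : (E3 × E3) × E3 =>
      gradKernel (q.1.2 - q.2) * ‖U (q.1.1, q.2)‖ₑ) (by fun_prop)
  have fin : ∀ᵐ z : E3 × E3, ∫⁻ w, gradKernel (z.2 - w) * ‖U (z.1, w)‖ₑ < ∞ :=
    ae_of_ae_slice (measurableSet_lt mJ measurable_const)
      (ae_of_all _ fun v => ae_lt_top (mJ.comp measurable_prodMk_right) (hfin v).ne)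
  have slice : ∀ᵐ z ∂phaseMeasure Ω, (fun w => F (z.1, w)) =ᵐ[volume] fun w => U (z.1, w) :=
    Measure.quasiMeasurePreserving_fst.ae (Measure.ae_ae_of_ae_prod hFU)
  filter_upwards [slice, ae_phaseMeasure fin] with z hz hf
  have hUm : Measurable fun w => U (z.1, w) := by fun_prop
  have hFm : AEMeasurable fun w => F (z.1, w) := hUm.aemeasurable.congr hz.symm
  have hf' : ∫⁻ w, gradKernel (z.2 - w) * ‖F (z.1, w)‖ₑ < ∞ := by
    rwa [lintegral_congr_ae (hz.mono fun w hw => by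
      show _ = gradKernel (z.2 - w) * ‖U (z.1, w)‖ₑ
      rw [show F (z.1, w) = U (z.1, w) from hw])]
  obtain ⟨h1, h2⟩ := collConverges_of_lintegral hBm hD hC hFm hf'
  refine ⟨h1, integrable_kTerm hBm hD hC hUm.aemeasurable hf, ?_⟩
  rw [opK, h2, kOpX, kOp_congr hBm hD hz]

theorem kOpX_eq_zero {Ω : Set E3} {g : E3 × E3 → ℝ} (h0 : ∀ x ∉ Ω, ∀ w, g (x, w) = 0) :
    ∀ x ∉ Ω, ∀ w, kOpX B g (x, w) = 0 := fun x hx w => by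
  simp [kOpX, kOp, h0 x hx]

/-! ### Zero extension of `L²` functions -/

/-- `g` is a measurable representative of `f` in `L²(Ω × ℝ³)`, extended by zero. -/
structure IsZeroExtension (Ω : Set E3) (f g : E3 × E3 → ℝ) : Prop where
  measurable : Measurable g
  eq_zero : ∀ x ∉ Ω, ∀ w, g (x, w) = 0
  ae_eq : f =ᵐ[phaseMeasure Ω] g
  lintegral_ne_top : ∫⁻ w, ∫⁻ x, ‖g (x, w)‖ₑ ^ 2 ≠ ∞

theorem eLpNorm_phaseMeasure_sq {Ω : Set E3} (g : E3 × E3 → ℝ) (hg : Measurable g) :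
    eLpNorm g 2 (phaseMeasure Ω) ^ 2 = ∫⁻ w, ∫⁻ x in Ω, ‖g (x, w)‖ₑ ^ 2 := by
  rw [eLpNorm_eq_lintegral_rpow_enorm_toReal (by norm_num) (by norm_num), phaseMeasure,
    ← ENNReal.rpow_natCast, ← ENNReal.rpow_mul, lintegral_prod_symm _ (by fun_prop)]
  simp

theorem IsZeroExtension.lintegral_eq {Ω : Set E3} {f g : E3 × E3 → ℝ}
    (h : IsZeroExtension Ω f g) :
    ∫⁻ w, ∫⁻ x, ‖g (x, w)‖ₑ ^ 2 = eLpNorm f 2 (phaseMeasure Ω) ^ 2 := by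
  rw [eLpNorm_congr_ae h.ae_eq, eLpNorm_phaseMeasure_sq g h.measurable]
  refine lintegral_congr fun w => (setLIntegral_eq_of_support_subset ?_).symm
  intro x hx
  by_contra hn
  simp [h.eq_zero x hn] at hx

theorem exists_isZeroExtension {Ω : Set E3} (hΩ : MeasurableSet Ω) {f : E3 × E3 → ℝ}
    (hf : MemLp f 2 (phaseMeasure Ω)) : ∃ g, IsZeroExtension Ω f g := by
  have hm := hf.1.aemeasurable
  set g := (Ω ×ˢ (Set.univ : Set E3)).indicator (hm.mk f)
  have hS : MeasurableSet (Ω ×ˢ (Set.univ : Set E3)) := hΩ.prod MeasurableSet.univ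
  have hg : Measurable g := hm.measurable_mk.indicator hS
  have h0 : ∀ x ∉ Ω, ∀ w, g (x, w) = 0 := fun x hx w => by simp [g, hx]
  have hae : f =ᵐ[phaseMeasure Ω] g := by
    refine hm.ae_eq_mk.trans ((ae_phaseMeasure_iff hΩ).2 (ae_of_all _ fun z hz => ?_))
    exact (Set.indicator_of_mem (Set.mk_mem_prod hz (Set.mem_univ _)) _).symm
  refine ⟨g, hg, h0, hae, ?_⟩
  have : ∫⁻ w, ∫⁻ x, ‖g (x, w)‖ₑ ^ 2 = ∫⁻ w, ∫⁻ x in Ω, ‖g (x, w)‖ₑ ^ 2 := by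
    refine lintegral_congr fun w => (setLIntegral_eq_of_support_subset ?_).symm
    intro x hx
    by_contra hn
    simp [h0 x hn] at hx
  rw [this, ← eLpNorm_phaseMeasure_sq g hg, ← eLpNorm_congr_ae hae]
  exact ENNReal.pow_ne_top hf.2.ne

end

/-! ### The operator `K S_Ω K` -/

section

variable {B : ℝ → ℝ → ℝ} {C : ℝ≥0∞}

theorem lintegral_enorm_kOpX_lt_top (hBm : Measurable (Function.uncurry B)) (hD : KDominated B C)
    (hC : C ≠ ∞) {f : E3 × E3 → ℝ} (hf : Measurable f)
    (hfin : ∀ v, ∫⁻ x, ∫⁻ w, gradKernel (v - w) * ‖f (x, w)‖ₑ < ∞) (v : E3) :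
    ∫⁻ x, ‖kOpX B f (x, v)‖ₑ < ∞ :=
  (lintegral_enorm_kOpX_le hBm hD hC hf v).trans_lt
    (ENNReal.mul_lt_top (ENNReal.mul_ne_top (by simp) hC).lt_top (hfin v))

namespace IsZeroExtension

variable {Ω : Set E3} {f g : E3 × E3 → ℝ}

theorem lintegral_gradKernel_lt_top (h : IsZeroExtension Ω f g) (hΩ : MeasurableSet Ω)
    (hΩf : volume Ω ≠ ∞) (v : E3) :
    ∫⁻ x, ∫⁻ w, gradKernel (v - w) * ‖g (x, w)‖ₑ < ∞ :=
  (lintegral_gradKernel_mul_le hΩ h.measurable h.eq_zero v).trans_lt (ENNReal.add_lt_top.2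
    ⟨(ENNReal.mul_ne_top hΩf lintegral_gradKernel_sq_lt_top.ne).lt_top, h.lintegral_ne_top.lt_top⟩)

theorem add_smul {f' g' : E3 × E3 → ℝ} (h : IsZeroExtension Ω f g)
    (h' : IsZeroExtension Ω f' g') (a b : ℝ) :
    IsZeroExtension Ω (fun z => a * f z + b * f' z) (fun z => a * g z + b * g' z) := by
  have m := h.measurable
  have m' := h'.measurable
  refine ⟨by fun_prop, fun x hx w => by simp [h.eq_zero x hx, h'.eq_zero x hx], ?_, ?_⟩
  · filter_upwards [h.ae_eq, h'.ae_eq] with z hz hz'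
    rw [hz, hz']
  -- Expanding the square and using `XY ≤ X² + Y²` gives the factor `3`; the constant `4` is a
  -- convenient upper bound.
  · refine ne_top_of_le_ne_top (b := 4 * ‖a‖ₑ ^ 2 * (∫⁻ w, ∫⁻ x, ‖g (x, w)‖ₑ ^ 2) +
      4 * ‖b‖ₑ ^ 2 * ∫⁻ w, ∫⁻ x, ‖g' (x, w)‖ₑ ^ 2) ?_ ?_
    · exact ENNReal.add_ne_top.2
        ⟨ENNReal.mul_ne_top (ENNReal.mul_ne_top (by simp) (by simp)) h.lintegral_ne_top,
          ENNReal.mul_ne_top (ENNReal.mul_ne_top (by simp) (by simp)) h'.lintegral_ne_top⟩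
    · have ha : 4 * ‖a‖ₑ ^ 2 ≠ ∞ := ENNReal.mul_ne_top (by simp) (by simp)
      have hb : 4 * ‖b‖ₑ ^ 2 ≠ ∞ := ENNReal.mul_ne_top (by simp) (by simp)
      have mg : Measurable fun w => 4 * ‖a‖ₑ ^ 2 * ∫⁻ x, ‖g (x, w)‖ₑ ^ 2 :=
        (Measurable.lintegral_prod_left' (f := fun q : E3 × E3 => ‖g q‖ₑ ^ 2)
          (by fun_prop)).const_mul _
      rw [← lintegral_const_mul' _ _ ha, ← lintegral_const_mul' _ _ hb, ← lintegral_add_left mg]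
      refine lintegral_mono fun w => ?_
      rw [← lintegral_const_mul' _ _ ha, ← lintegral_const_mul' _ _ hb,
        ← lintegral_add_left (by fun_prop)]
      refine lintegral_mono fun x => ?_
      have hx : ‖a * g (x, w) + b * g' (x, w)‖ₑ ≤ ‖a‖ₑ * ‖g (x, w)‖ₑ + ‖b‖ₑ * ‖g' (x, w)‖ₑ :=
        (enorm_add_le _ _).trans (by rw [enorm_mul, enorm_mul])
      calc _ ≤ (‖a‖ₑ * ‖g (x, w)‖ₑ + ‖b‖ₑ * ‖g' (x, w)‖ₑ) ^ 2 := pow_le_pow_left₀ bot_le hx 2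
        _ = (‖a‖ₑ * ‖g (x, w)‖ₑ) ^ 2 + 2 * ((‖a‖ₑ * ‖g (x, w)‖ₑ) * (‖b‖ₑ * ‖g' (x, w)‖ₑ)) +
            (‖b‖ₑ * ‖g' (x, w)‖ₑ) ^ 2 := by ring
        _ ≤ (‖a‖ₑ * ‖g (x, w)‖ₑ) ^ 2 + 2 * ((‖a‖ₑ * ‖g (x, w)‖ₑ) ^ 2 +
            (‖b‖ₑ * ‖g' (x, w)‖ₑ) ^ 2) + (‖b‖ₑ * ‖g' (x, w)‖ₑ) ^ 2 := by
            gcongr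
            exact mul_le_sq_add_sq _ _
        _ = 3 * ‖a‖ₑ ^ 2 * ‖g (x, w)‖ₑ ^ 2 + 3 * ‖b‖ₑ ^ 2 * ‖g' (x, w)‖ₑ ^ 2 := by ring
        _ ≤ _ := by gcongr <;> norm_num

end IsZeroExtension

variable {Ω : Set E3} (hΩo : IsOpen Ω) (hΩc : Convex ℝ Ω) (hΩf : volume Ω ≠ ∞) {D : ℝ}
  (hD0 : 0 ≤ D) (hdiam : ∀ x ∈ Ω, ∀ y ∈ Ω, ‖x - y‖ ≤ D) (hBm : Measurable (Function.uncurry B))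
  (hD : KDominated B C) (hC : C ≠ ∞) (hν : ∀ v, 0 ≤ collFreq B v)

include hΩo hΩf hBm hD hC

/-- This and the next two results pair convergence with an almost everywhere identity to a
measurable model: the identity at one stage is the hypothesis of the next. -/
theorem ae_opK {f g : E3 × E3 → ℝ} (h : IsZeroExtension Ω f g) :
    ∀ᵐ z ∂phaseMeasure Ω, CollConverges B (fun w => f (z.1, w)) z.2 ∧
      (∀ i, Integrable (fun p => kWeight B i z.2 p * g (z.1, kPoint i z.2 p)) collMeasure) ∧
      opK B f z = kOpX B g z :=
  ae_opK_eq_kOpX hBm hD hC h.measurable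
    (h.lintegral_gradKernel_lt_top hΩo.measurableSet hΩf) h.ae_eq

include hΩc hdiam hν

theorem ae_opSK {f g : E3 × E3 → ℝ} (h : IsZeroExtension Ω f g) :
    ∀ᵐ z ∂phaseMeasure Ω,
      IntegrableOn (transportIntegrand (collFreq B) (opK B f) z) (travelTimes Ω z.1 z.2) ∧
      opSK Ω B f z = modelSK D B g z :=
  ae_opS_eq_freeS hΩo hΩc hdiam (measurable_collFreq hBm) hν (measurable_kOpX hBm h.measurable)
    (kOpX_eq_zero h.eq_zero) (lintegral_enorm_kOpX_lt_top hBm hD hC h.measurable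
      (h.lintegral_gradKernel_lt_top hΩo.measurableSet hΩf))
    ((ae_opK hΩo hΩf hBm hD hC h).mono fun _ hz => hz.2.2)

include hD0

theorem ae_opKSK {f g : E3 × E3 → ℝ} (h : IsZeroExtension Ω f g) :
    ∀ᵐ z ∂phaseMeasure Ω, CollConverges B (fun w => opSK Ω B f (z.1, w)) z.2 ∧
      (∀ i, Integrable (fun p => kWeight B i z.2 p * modelSK D B g (z.1, kPoint i z.2 p))
        collMeasure) ∧
      opKSK Ω B f z = modelKSK D B g z :=
  ae_opK_eq_kOpX hBm hD hC (measurable_modelSK hBm D h.measurable)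
    (lintegral_gradKernel_modelSK_lt_top hBm hD hC hν hD0 hΩo.measurableSet hΩf h.measurable
      h.eq_zero h.lintegral_ne_top)
    ((ae_opSK hΩo hΩc hΩf hdiam hBm hD hC hν h).mono fun _ hz => hz.2)

/-- Bochner integrals are additive only where they converge, so linearity is propagated through `K`,
`S_Ω` and `K` in turn, each time on the full-measure set where the integrals of both models
converge. -/
theorem opKSK_add_smul {f₁ f₂ : E3 × E3 → ℝ} (h₁ : MemLp f₁ 2 (phaseMeasure Ω))
    (h₂ : MemLp f₂ 2 (phaseMeasure Ω)) (a b : ℝ) :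
    opKSK Ω B (fun z => a * f₁ z + b * f₂ z) =ᵐ[phaseMeasure Ω]
      fun z => a * opKSK Ω B f₁ z + b * opKSK Ω B f₂ z := by
  obtain ⟨g₁, e₁⟩ := exists_isZeroExtension hΩo.measurableSet h₁
  obtain ⟨g₂, e₂⟩ := exists_isZeroExtension hΩo.measurableSet h₂
  have e := e₁.add_smul e₂ a b
  have hνm := measurable_collFreq hBm
  have L : ∀ {f g : E3 × E3 → ℝ}, IsZeroExtension Ω f g → ∀ v, ∫⁻ x, ‖kOpX B g (x, v)‖ₑ < ∞ :=
    fun h => lintegral_enorm_kOpX_lt_top hBm hD hC h.measurable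
      (h.lintegral_gradKernel_lt_top hΩo.measurableSet hΩf)
  have k₁ := measurable_kOpX hBm e₁.measurable
  have k₂ := measurable_kOpX hBm e₂.measurable
  set G : E3 × E3 → ℝ := fun z => a * kOpX B g₁ z + b * kOpX B g₂ z
  have hG : Measurable G := by fun_prop
  have hG0 : ∀ x ∉ Ω, ∀ w, G (x, w) = 0 := fun x hx w => by
    simp only [G, kOpX_eq_zero e₁.eq_zero x hx, kOpX_eq_zero e₂.eq_zero x hx, mul_zero, add_zero]
  have hGfin : ∀ v, ∫⁻ x, ‖G (x, v)‖ₑ < ∞ := by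
    intro v
    have i₁ : Integrable fun x => kOpX B g₁ (x, v) :=
      ⟨(by fun_prop : Measurable fun x => kOpX B g₁ (x, v)).aestronglyMeasurable, L e₁ v⟩
    have i₂ : Integrable fun x => kOpX B g₂ (x, v) :=
      ⟨(by fun_prop : Measurable fun x => kOpX B g₂ (x, v)).aestronglyMeasurable, L e₂ v⟩
    exact ((i₁.const_mul a).add (i₂.const_mul b)).2
  have hK : opK B (fun z => a * f₁ z + b * f₂ z) =ᵐ[phaseMeasure Ω] G := by
    filter_upwards [ae_opK hΩo hΩf hBm hD hC e, ae_opK hΩo hΩf hBm hD hC e₁,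
      ae_opK hΩo hΩf hBm hD hC e₂] with z hz hz₁ hz₂
    rw [hz.2.2]
    exact kOp_linear a b hz₁.2.1 hz₂.2.1
  have hS : opSK Ω B (fun z => a * f₁ z + b * f₂ z) =ᵐ[phaseMeasure Ω]
      fun z => a * modelSK D B g₁ z + b * modelSK D B g₂ z := by
    filter_upwards [ae_opS_eq_freeS hΩo hΩc hdiam hνm hν hG hG0 hGfin hK,
      ae_phaseMeasure (ae_integrableOn_transportIntegrand (D := D) hνm hν k₁ (L e₁)),
      ae_phaseMeasure (ae_integrableOn_transportIntegrand (D := D) hνm hν k₂ (L e₂))]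
      with z hz hz₁ hz₂
    rw [opSK, hz.2, modelSK, modelSK, freeS, freeS, freeS, ← integral_const_mul,
      ← integral_const_mul, ← integral_add (hz₁.const_mul a) (hz₂.const_mul b)]
    congr 1
    funext s
    simp only [transportIntegrand, G]
    ring
  have u₁ := measurable_modelSK hBm D e₁.measurable
  have u₂ := measurable_modelSK hBm D e₂.measurable
  have fin : ∀ v, ∫⁻ x, ∫⁻ w, gradKernel (v - w) *
      ‖a * modelSK D B g₁ (x, w) + b * modelSK D B g₂ (x, w)‖ₑ < ∞ := by
    intro v
    have f₁ := lintegral_gradKernel_modelSK_lt_top hBm hD hC hν hD0 hΩo.measurableSet hΩf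
      e₁.measurable e₁.eq_zero e₁.lintegral_ne_top v
    have f₂ := lintegral_gradKernel_modelSK_lt_top hBm hD hC hν hD0 hΩo.measurableSet hΩf
      e₂.measurable e₂.eq_zero e₂.lintegral_ne_top v
    have m₁ : Measurable fun x => ‖a‖ₑ * ∫⁻ w, gradKernel (v - w) * ‖modelSK D B g₁ (x, w)‖ₑ :=
      (Measurable.lintegral_prod_right' (f := fun q : E3 × E3 =>
        gradKernel (v - q.2) * ‖modelSK D B g₁ q‖ₑ) (by fun_prop)).const_mul _
    have ha : ‖a‖ₑ ≠ ∞ := by simp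
    have hb : ‖b‖ₑ ≠ ∞ := by simp
    calc _ ≤ ∫⁻ x, (‖a‖ₑ * (∫⁻ w, gradKernel (v - w) * ‖modelSK D B g₁ (x, w)‖ₑ) +
          ‖b‖ₑ * ∫⁻ w, gradKernel (v - w) * ‖modelSK D B g₂ (x, w)‖ₑ) := by
          refine lintegral_mono fun x => ?_
          rw [← lintegral_const_mul' _ _ ha, ← lintegral_const_mul' _ _ hb,
            ← lintegral_add_left (by fun_prop)]
          refine lintegral_mono fun w => ?_
          calc _ ≤ gradKernel (v - w) *
                (‖a‖ₑ * ‖modelSK D B g₁ (x, w)‖ₑ + ‖b‖ₑ * ‖modelSK D B g₂ (x, w)‖ₑ) := by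
                refine mul_le_mul' le_rfl ((enorm_add_le _ _).trans ?_)
                rw [enorm_mul, enorm_mul]
            _ = _ := by ring
      _ = ‖a‖ₑ * (∫⁻ x, ∫⁻ w, gradKernel (v - w) * ‖modelSK D B g₁ (x, w)‖ₑ) +
          ‖b‖ₑ * ∫⁻ x, ∫⁻ w, gradKernel (v - w) * ‖modelSK D B g₂ (x, w)‖ₑ := by
          rw [lintegral_add_left m₁, lintegral_const_mul' _ _ ha, lintegral_const_mul' _ _ hb]
      _ < ∞ := ENNReal.add_lt_top.2
          ⟨ENNReal.mul_lt_top ha.lt_top f₁, ENNReal.mul_lt_top hb.lt_top f₂⟩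
  filter_upwards [ae_opK_eq_kOpX hBm hD hC
      (U := fun z => a * modelSK D B g₁ z + b * modelSK D B g₂ z) (by fun_prop) fin hS,
    ae_opKSK hΩo hΩc hΩf hD0 hdiam hBm hD hC hν e₁,
    ae_opKSK hΩo hΩc hΩf hD0 hdiam hBm hD hC hν e₂] with z hz hz₁ hz₂
  rw [opKSK, hz.2.2, hz₁.2.2, hz₂.2.2]
  exact kOp_linear a b hz₁.2.1 hz₂.2.1

/-- Equivalent functions share a zero extension, hence the same model. -/
theorem opKSK_congr {f₁ f₂ : E3 × E3 → ℝ} (h₂ : MemLp f₂ 2 (phaseMeasure Ω))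
    (h : f₁ =ᵐ[phaseMeasure Ω] f₂) : opKSK Ω B f₁ =ᵐ[phaseMeasure Ω] opKSK Ω B f₂ := by
  obtain ⟨g, e⟩ := exists_isZeroExtension hΩo.measurableSet h₂
  have e' : IsZeroExtension Ω f₁ g := ⟨e.measurable, e.eq_zero, h.trans e.ae_eq, e.4⟩
  filter_upwards [ae_opKSK hΩo hΩc hΩf hD0 hdiam hBm hD hC hν e,
    ae_opKSK hΩo hΩc hΩf hD0 hdiam hBm hD hC hν e'] with z hz hz'
  rw [hz.2.2, hz'.2.2]

theorem exists_eLpNorm_opKSK_le :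
    ∃ C' : ℝ≥0∞, C' ≠ ∞ ∧ ∀ f : E3 × E3 → ℝ, MemLp f 2 (phaseMeasure Ω) →
      AEStronglyMeasurable (opKSK Ω B f) (phaseMeasure Ω) ∧
      eLpNorm (opKSK Ω B f) 2 (phaseMeasure Ω) ^ 2 ≤ C' * eLpNorm f 2 (phaseMeasure Ω) ^ 2 := by
  obtain ⟨C', hC', b⟩ := exists_lintegral_modelKSK_sq_le hBm hD hC hν hD0
  refine ⟨C', hC', fun f hf => ?_⟩
  obtain ⟨g, e⟩ := exists_isZeroExtension hΩo.measurableSet hf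
  have hA : Measurable (modelKSK D B g) :=
    measurable_kOpX hBm (measurable_modelSK hBm D e.measurable)
  have hae : opKSK Ω B f =ᵐ[phaseMeasure Ω] modelKSK D B g :=
    (ae_opKSK hΩo hΩc hΩf hD0 hdiam hBm hD hC hν e).mono fun z hz => hz.2.2
  refine ⟨hA.aestronglyMeasurable.congr hae.symm, ?_⟩
  rw [eLpNorm_congr_ae hae, eLpNorm_phaseMeasure_sq _ hA, ← e.lintegral_eq]
  exact (lintegral_mono fun v => setLIntegral_le_lintegral _ _).trans (b g e.measurable)

/-- The whole-space double integral has a nonnegative integrand, so shrinking both domains to `Ω`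
only decreases it. -/
theorem exists_slobodeckij_opKSK_le :
    ∃ C' : ℝ≥0∞, C' ≠ ∞ ∧ ∀ f : E3 × E3 → ℝ, MemLp f 2 (phaseMeasure Ω) →
      slobodeckij (1 / 2) Ω (opKSK Ω B f) ≤ C' * eLpNorm f 2 (phaseMeasure Ω) ^ 2 := by
  obtain ⟨C', hC', b⟩ := exists_slobodeckij_modelKSK_le hBm hD hC hν hD0 hΩo.measurableSet hΩf
  refine ⟨C', hC', fun f hf => ?_⟩
  obtain ⟨g, e⟩ := exists_isZeroExtension hΩo.measurableSet hf
  have hae : ∀ᵐ z ∂phaseMeasure Ω, opKSK Ω B f z = modelKSK D B g z :=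
    (ae_opKSK hΩo hΩc hΩf hD0 hdiam hBm hD hC hν e).mono fun z hz => hz.2.2
  have hs : ∀ᵐ v : E3, ∀ᵐ x ∂volume.restrict Ω, opKSK Ω B f (x, v) = modelKSK D B g (x, v) :=
    Measure.ae_ae_of_ae_prod ((Measure.measurePreserving_swap
      (μ := (volume : Measure E3)) (ν := volume.restrict Ω)).quasiMeasurePreserving.ae hae)
  rw [← e.lintegral_eq]
  refine le_trans (lintegral_mono_ae ?_) (b g e.measurable e.eq_zero e.lintegral_ne_top)
  filter_upwards [hs] with v hv
  refine (lintegral_mono_ae ?_).trans (setLIntegral_le_lintegral Ω _)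
  filter_upwards [hv] with y hy
  refine (lintegral_mono_ae ?_).trans (setLIntegral_le_lintegral Ω _)
  filter_upwards [hv] with x hx
  rw [hx, hy]
  rcases eq_or_ne x y with rfl | hxy
  · simp
  have hp : 0 < ‖x - y‖ := norm_pos_iff.2 (sub_ne_zero.2 hxy)
  rw [show (3 + 2 * (1 / 2) : ℝ) = (4 : ℕ) by norm_num, Real.rpow_natCast,
    ENNReal.ofReal_div_of_pos (by positivity), ENNReal.ofReal_pow (abs_nonneg _),
    ENNReal.ofReal_pow (norm_nonneg _), ofReal_norm, ← Real.norm_eq_abs, ofReal_norm]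

/-- `K S_Ω K` as a linear map on `L²(Ω × ℝ³)`. -/
theorem exists_linearMap_opKSK :
    ∃ T : Lp ℝ 2 (phaseMeasure Ω) →ₗ[ℝ] Lp ℝ 2 (phaseMeasure Ω),
      ∀ (f : E3 × E3 → ℝ) (hf : MemLp f 2 (phaseMeasure Ω)),
        T (hf.toLp f) =ᵐ[phaseMeasure Ω] opKSK Ω B f := by
  obtain ⟨C', hC', b⟩ := exists_eLpNorm_opKSK_le hΩo hΩc hΩf hD0 hdiam hBm hD hC hν
  have mem : ∀ F : Lp ℝ 2 (phaseMeasure Ω), MemLp (opKSK Ω B F) 2 (phaseMeasure Ω) := by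
    intro F
    obtain ⟨h1, h2⟩ := b F (Lp.memLp F)
    refine ⟨h1, ?_⟩
    have : eLpNorm (opKSK Ω B F) 2 (phaseMeasure Ω) ^ 2 < ∞ := h2.trans_lt
      (ENNReal.mul_lt_top hC'.lt_top (ENNReal.pow_lt_top (Lp.memLp F).2))
    exact (ENNReal.pow_lt_top_iff.1 this).resolve_right (by norm_num)
  have lin := fun (F G : Lp ℝ 2 (phaseMeasure Ω)) (a b : ℝ) =>
    opKSK_add_smul hΩo hΩc hΩf hD0 hdiam hBm hD hC hν (Lp.memLp F) (Lp.memLp G) a b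
  have congr : ∀ {f₁ : E3 × E3 → ℝ} (F : Lp ℝ 2 (phaseMeasure Ω)), F =ᵐ[phaseMeasure Ω] f₁ →
      opKSK Ω B F =ᵐ[phaseMeasure Ω] opKSK Ω B f₁ := fun F h =>
    opKSK_congr hΩo hΩc hΩf hD0 hdiam hBm hD hC hν ((memLp_congr_ae h).1 (Lp.memLp F)) h
  refine ⟨{ toFun := fun F => (mem F).toLp _, map_add' := ?_, map_smul' := ?_ }, ?_⟩
  · intro F G
    refine Lp.ext ?_
    have h1 : (F + G : Lp ℝ 2 (phaseMeasure Ω)) =ᵐ[phaseMeasure Ω]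
        fun z => 1 * F z + 1 * G z := by
      filter_upwards [Lp.coeFn_add F G] with z hz
      simpa using hz
    filter_upwards [(mem (F + G)).coeFn_toLp, congr _ h1, lin F G 1 1,
      Lp.coeFn_add ((mem F).toLp _) ((mem G).toLp _), (mem F).coeFn_toLp, (mem G).coeFn_toLp]
      with z e1 e2 e3 e4 e5 e6
    rw [e1, e2, e3, e4, Pi.add_apply, e5, e6, one_mul, one_mul]
  · intro a F
    refine Lp.ext ?_
    have h1 : (a • F : Lp ℝ 2 (phaseMeasure Ω)) =ᵐ[phaseMeasure Ω]
        fun z => a * F z + 0 * F z := by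
      filter_upwards [Lp.coeFn_smul a F] with z hz
      simpa using hz
    filter_upwards [(mem (a • F)).coeFn_toLp, congr _ h1, lin F F a 0,
      Lp.coeFn_smul a ((mem F).toLp _), (mem F).coeFn_toLp] with z e1 e2 e3 e4 e5
    rw [e1, e2, e3, RingHom.id_apply, e4, Pi.smul_apply, e5, zero_mul, add_zero, smul_eq_mul]
  · intro f hf
    filter_upwards [(mem (hf.toLp f)).coeFn_toLp, congr _ hf.coeFn_toLp] with z e1 e2
    exact e1.trans e2

end

end KineticAveraging

/-! ### The main theorem -/

open KineticAveraging in
/-- On a bounded convex domain `Ω`, the operator `K S_Ω K` is a well-defined bounded linear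
operator from `L²(Ω × ℝ³)` to `L²_v(ℝ³; H^{1/2}_x(Ω))`. -/
theorem mainTheorem7 (γ : ℝ) (hγ0 : 0 ≤ γ) (hγ1 : γ ≤ 1)
    (B : ℝ → ℝ → ℝ) (hBm : Measurable (Function.uncurry B)) (hB : AngularCutoff γ B)
    (Ω : Set E3) (hΩo : IsOpen Ω) (hΩc : Convex ℝ Ω) (hΩb : Bornology.IsBounded Ω) :
    -- all the integrals involved converge absolutely, almost everywhere
    (∀ f : E3 × E3 → ℝ, MemLp f 2 (phaseMeasure Ω) →
      ∀ᵐ z ∂(phaseMeasure Ω),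
        CollConverges B (fun w => f (z.1, w)) z.2 ∧
        IntegrableOn (transportIntegrand (collFreq B) (opK B f) z) (travelTimes Ω z.1 z.2) ∧
        CollConverges B (fun w => opSK Ω B f (z.1, w)) z.2) ∧
    -- they define a linear operator on almost-everywhere classes
    (∃ T : Lp ℝ 2 (phaseMeasure Ω) →ₗ[ℝ] Lp ℝ 2 (phaseMeasure Ω),
      ∀ (f : E3 × E3 → ℝ) (hf : MemLp f 2 (phaseMeasure Ω)),
        T (hf.toLp f) =ᵐ[phaseMeasure Ω] opKSK Ω B f) ∧
    -- the operator takes values in, and is bounded into, the fractional Sobolev space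
    (∃ C : ℝ≥0, ∀ f : E3 × E3 → ℝ, MemLp f 2 (phaseMeasure Ω) →
      MemL2Hs (1 / 2) Ω (opKSK Ω B f) ∧
      normL2Hs (1 / 2) Ω (opKSK Ω B f) ≤ C * eLpNorm f 2 (phaseMeasure Ω)) := by
  obtain ⟨A, hA, hD⟩ := lintegral_kWeight_le hγ0 hγ1 hB
  have hν := collFreq_nonneg hB
  have hΩ := hΩo.measurableSet
  have hΩf : volume Ω ≠ ∞ := hΩb.measure_lt_top.ne
  obtain ⟨D, hdiam⟩ : ∃ D, ∀ x ∈ Ω, ∀ y ∈ Ω, ‖x - y‖ ≤ D :=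
    ⟨Metric.diam Ω, fun x hx y hy => by
      rw [← dist_eq_norm]; exact Metric.dist_le_diam_of_mem hΩb hx hy⟩
  -- The maximum with `0` records that the travel length is nonnegative, as the transport estimates
  -- require.
  have hdiam' : ∀ x ∈ Ω, ∀ y ∈ Ω, ‖x - y‖ ≤ max D 0 := fun x hx y hy =>
    (hdiam x hx y hy).trans (le_max_left _ _)
  refine ⟨fun f hf => ?_, exists_linearMap_opKSK hΩo hΩc hΩf (le_max_right _ _) hdiam' hBm hD hA hν,
    ?_⟩
  · obtain ⟨g, e⟩ := exists_isZeroExtension hΩ hf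
    filter_upwards [ae_opK hΩo hΩf hBm hD hA e, ae_opSK hΩo hΩc hΩf hdiam' hBm hD hA hν e,
      ae_opKSK hΩo hΩc hΩf (le_max_right _ _) hdiam' hBm hD hA hν e] with z h1 h2 h3
    exact ⟨h1.1, h2.1, h3.1⟩
  · obtain ⟨C₁, hC₁, b₁⟩ :=
      exists_eLpNorm_opKSK_le hΩo hΩc hΩf (le_max_right _ _) hdiam' hBm hD hA hν
    obtain ⟨C₂, hC₂, b₂⟩ :=
      exists_slobodeckij_opKSK_le hΩo hΩc hΩf (le_max_right _ _) hdiam' hBm hD hA hν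
    have hC : (C₁ + C₂) ^ (1 / 2 : ℝ) ≠ ∞ :=
      ENNReal.rpow_ne_top_of_nonneg (by norm_num) (ENNReal.add_ne_top.2 ⟨hC₁, hC₂⟩)
    -- The norm is the square root of the sum of two quantities bounded by `C₁` and `C₂` times the
    -- squared `L²` norm.
    refine ⟨((C₁ + C₂) ^ (1 / 2 : ℝ)).toNNReal, fun f hf => ?_⟩
    obtain ⟨m, h₁⟩ := b₁ f hf
    have h₂ := b₂ f hf
    have hf2 : eLpNorm f 2 (phaseMeasure Ω) ^ 2 < ∞ := ENNReal.pow_lt_top hf.2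
    refine ⟨⟨⟨m, ?_⟩, h₂.trans_lt (ENNReal.mul_lt_top hC₂.lt_top hf2)⟩, ?_⟩
    · exact (ENNReal.pow_lt_top_iff.1
        (h₁.trans_lt (ENNReal.mul_lt_top hC₁.lt_top hf2))).resolve_right (by norm_num)
    · rw [ENNReal.coe_toNNReal hC, normL2Hs]
      calc _ ≤ ((C₁ + C₂) * eLpNorm f 2 (phaseMeasure Ω) ^ 2) ^ (1 / 2 : ℝ) := by
            refine ENNReal.rpow_le_rpow ?_ (by norm_num)
            rw [add_mul]
            exact add_le_add h₁ h₂
        _ = _ := by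
            rw [ENNReal.mul_rpow_of_nonneg _ _ (by norm_num), ← ENNReal.rpow_natCast,
              ← ENNReal.rpow_mul]
            norm_num
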